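/- Throughout, $1\le p\le\infty$. For a Hilbert space $H$, $S^p(H)$ denotes the Schatten class: for $p<\infty$, the bounded operators $A$ with $\|A\|_p=\mathrm{Tr}(|A|^p)^{1/p}<\infty$; for $p=\infty$, the compact operators with the operator norm. For a $\sigma$-finite measure space $(X,\mu)$, identify $S^2(L^2(X,\mu))$ with $L^2(X\times X,\mu\otimes\mu)$ by means of integral kernels. For $\varphi\in L^\infty(X\times X,\mu\otimes\mu)$, let $M_\varphi$ be the multiplication of kernels by $\varphi$ on $S^2(L^2(X,\mu))$, and let $\|\varphi\|_{cbMS^p(L^2(X,\mu))}\in[0,\infty]$ be the completely bounded norm of $M_\varphi$ on $S^p$, i.e. the supremum over all Hilbert spaces $K$ of the norm of $M_\varphi\otimes\mathrm{id}$ on the dense subspace $(S^2\cap S^p)(L^2(X,\mu))\otimes S^p(K)$ of $S^p(L^2(X,\mu)\otimes_2 K)$ (it is finite if and only if $M_\varphi$ maps $S^2\cap S^p$ into $S^p$ and extends to a completely bounded map on $S^p$). Let $G$ be a locally compact (Hausdorff) second countable group with a left Haar measure $\mu$. Let $A(G)$ be the Fourier algebra, i.e. the set of coefficients $g\mapsto\langle\lambda(g)f,h\rangle$,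 $f,h\in L^2(G,\mu)$, of the left regular representation, and for $\varphi:G\to\mathbb C$ put $\check\varphi(g,h)=\varphi(g^{-1}h)$. The group $G$ has property $AP_{pcb}^{Schur}$ if there are a constant $C<\infty$ and a net $(\varphi_\alpha)$ in $A(G)$ such that $\varphi_\alpha\to1$ uniformly on compact subsets of $G$ and $\|\check\varphi_\alpha\|_{cbMS^p(L^2(G,\mu))}\le C$ for all $\alpha$; the infimum of such $C$ is denoted $\Lambda_{pcb}^{Schur}(G)$, with $\Lambda_{pcb}^{Schur}(G)=\infty$ if there is no such $C$. **Theorem.** Let $G$ be a locally compact second countable group and $\Gamma$ a lattice in $G$, i.e. a discrete subgroup of finite covolume. Then for every $1\le p\le\infty$, $$\Lambda_{pcb}^{Schur}(G)=\Lambda_{pcb}^{Schur}(\Gamma).$$ In particular, $G$ has property $AP_{pcb}^{Schur}$ if and only if $\Gamma$ does. -/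

import Mathlib

open MeasureTheory Filter
open scoped ENNReal NNReal TensorProduct ComplexConjugate

universe u

noncomputable section

namespace SchurAP

/-! ### Schatten classes -/

section Schatten

variable {H : Type*} [NormedAddCommGroup H] [InnerProductSpace ℂ H] [CompleteSpace H]

/-- The trace `∑ᵢ ⟪eᵢ, T eᵢ⟫ ∈ [0, ∞]` of a positive bounded operator `T`, computed in an
orthonormal basis `(eᵢ)` of `H`. It is only used for positive `T`, where the value does not depend
on the basis. -/
def posTrace (T : H →L[ℂ] H) : ℝ≥0∞ :=
  ∑' i, ENNReal.ofReal
    (inner ℂ ((exists_hilbertBasis ℂ H).choose_spec.choose i)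
      (T ((exists_hilbertBasis ℂ H).choose_spec.choose i))).re

open Classical in
/-- The Schatten norm of a bounded operator, with values in `[0, ∞]`: for `p < ∞` it is
`Tr(|A|^p)^{1/p}`, and for `p = ∞` it is the operator norm of `A` if `A` is compact and `∞` if
it is not. -/
def schattenNorm (p : ℝ≥0∞) (A : H →L[ℂ] H) : ℝ≥0∞ :=
  if p = ∞ then (if IsCompactOperator A then ‖A‖ₑ else ∞)
  else posTrace (CFC.abs A ^ p.toReal) ^ (1 / p.toReal)

/-- Membership in the Schatten class `S^p(H)`; in particular `S^∞(H)` is the space of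
compact operators. -/
def MemSchatten (p : ℝ≥0∞) (A : H →L[ℂ] H) : Prop :=
  schattenNorm p A < ∞

end Schatten

/-! ### Hilbert space tensor products -/

section Tensor

variable (H K : Type*) [NormedAddCommGroup H] [InnerProductSpace ℂ H]
  [NormedAddCommGroup K] [InnerProductSpace ℂ K]

/-- The Hilbert space tensor product `H ⊗₂ K`: the completion of the algebraic tensor product for
the inner product with `⟪h ⊗ k, h' ⊗ k'⟫ = ⟪h, h'⟫ ⟪k, k'⟫`. -/
abbrev HilbertTensor : Type _ :=
  UniformSpace.Completion (H ⊗[ℂ] K)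

variable {H K}

/-- The bounded operator `A ⊗ B` on `H ⊗₂ K`. -/
def tensorOp (A : H →L[ℂ] H) (B : K →L[ℂ] K) : HilbertTensor H K →L[ℂ] HilbertTensor H K :=
  (TensorProduct.mapL A B).completion

end Tensor

/-! ### Schur multipliers -/

section Schur

variable {X : Type u} [MeasurableSpace X]

/-- `A` is the Hilbert-Schmidt operator on `L²(X, μ)` with kernel `k ∈ L²(X × X, μ ⊗ μ)`, i.e.
`(A ξ)(x) = ∫ k(x, y) ξ(y) dμ(y)`. -/
def IsKernelOf (μ : Measure X) (k : X × X → ℂ) (A : Lp ℂ 2 μ →L[ℂ] Lp ℂ 2 μ) : Prop :=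
  MemLp k 2 (μ.prod μ) ∧ ∀ ξ : Lp ℂ 2 μ, A ξ =ᵐ[μ] fun x => ∫ y, k (x, y) * ξ y ∂μ

/-- The graph of the Schur multiplier with symbol `φ` on `S²(L²(X, μ)) = L²(X × X, μ ⊗ μ)`, where it
is the multiplication of kernels by `φ`: `A ∈ S²` and `A' = M_φ(A)`. -/
def IsSchurImage (μ : Measure X) (φ : X × X → ℂ) (A A' : Lp ℂ 2 μ →L[ℂ] Lp ℂ 2 μ) : Prop :=
  ∃ k : X × X → ℂ, IsKernelOf μ k A ∧ IsKernelOf μ (fun z => φ z * k z) A'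

/-- `φ ∈ L^∞(X × X, μ ⊗ μ)` and the Schur multiplier `M_φ` is completely bounded on
`S^p(L²(X, μ))` with completely bounded norm at most `C`: for every Hilbert space `K`, the map
`M_φ ⊗ id`, defined on the dense subspace `(S² ∩ S^p)(L²(X, μ)) ⊗ S^p(K)` of
`S^p(L²(X, μ) ⊗₂ K)`, is bounded by `C` for the norm of `S^p(L²(X, μ) ⊗₂ K)`; that is, it extends to
a bounded map of norm at most `C`. (With `K = ℂ` this says in particular that `M_φ` maps
`S² ∩ S^p` into `S^p` and extends to `S^p`.) -/
structure IsCBSchurBound (p : ℝ≥0∞) (μ : Measure X) (φ : X × X → ℂ) (C : ℝ≥0) : Prop where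
  memLp_top : MemLp φ ∞ (μ.prod μ)
  bound : ∀ (K : Type u) [NormedAddCommGroup K] [InnerProductSpace ℂ K] [CompleteSpace K]
    (n : ℕ) (A A' : Fin n → (Lp ℂ 2 μ →L[ℂ] Lp ℂ 2 μ)) (B : Fin n → (K →L[ℂ] K)),
    (∀ i, MemSchatten p (A i)) → (∀ i, IsSchurImage μ φ (A i) (A' i)) →
    (∀ i, MemSchatten p (B i)) →
    schattenNorm p (∑ i, tensorOp (A' i) (B i)) ≤ C * schattenNorm p (∑ i, tensorOp (A i) (B i))

/-- The completely bounded norm `‖φ‖_{cbMS^p(L²(X, μ))}` of the Schur multiplier with symbol `φ`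
(it is `∞` if the multiplier is not completely bounded on `S^p`). -/
def cbSchurNorm (p : ℝ≥0∞) (μ : Measure X) (φ : X × X → ℂ) : ℝ≥0∞ :=
  ⨅ (C : ℝ≥0) (_ : IsCBSchurBound p μ φ C), (C : ℝ≥0∞)

end Schur

/-! ### Approximation by Schur multipliers on a group -/

section GroupDefs

variable {G : Type u} [Group G] [MeasurableSpace G]

/-- The Fourier algebra `A(G)`: the coefficients `g ↦ ⟨λ(g) f, h⟩`, `f, h ∈ L²(G, μ)`, of the left
regular representation `(λ(g) f)(x) = f(g⁻¹ x)`, for a left Haar measure `μ`. -/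
def MemFourierAlgebra (μ : Measure G) (φ : G → ℂ) : Prop :=
  ∃ f h : G → ℂ, MemLp f 2 μ ∧ MemLp h 2 μ ∧ ∀ g, φ g = ∫ x, f (g⁻¹ * x) * conj (h x) ∂μ

/-- The symbol `φ̌(g, h) = φ(g⁻¹ h)`. -/
def herzSchurSymbol (φ : G → ℂ) : G × G → ℂ :=
  fun z => φ (z.1⁻¹ * z.2)

variable [TopologicalSpace G]

/-- There is a net `φ_α ∈ A(G)` that converges to `1` uniformly on compact subsets of `G` with
`‖φ̌_α‖_{cbMS^p(L²(G))} ≤ C` for all `α`. -/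
def HasSchurApprox (p : ℝ≥0∞) (μ : Measure G) (C : ℝ≥0) : Prop :=
  ∃ (ι : Type u) (_ : Preorder ι) (_ : IsDirectedOrder ι) (_ : Nonempty ι) (φ : ι → G → ℂ),
    (∀ α, MemFourierAlgebra μ (φ α)) ∧
    (∀ Q : Set G, IsCompact Q → TendstoUniformlyOn φ (fun _ => 1) atTop Q) ∧
    ∀ α, cbSchurNorm p μ (herzSchurSymbol (φ α)) ≤ C

/-- The property of completely bounded approximation by Schur multipliers on `S^p`, for a group `G`
with a left Haar measure `μ`. -/
def SchurAPpcb (p : ℝ≥0∞) (μ : Measure G) : Prop :=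
  ∃ C : ℝ≥0, HasSchurApprox p μ C

/-- The constant `Λ_{pcb}^{Schur}(G) ∈ [0, ∞]`, for a group `G` with a left Haar measure `μ`: the
infimum of the admissible constants, which is `∞` if there are none. -/
def schurConst (p : ℝ≥0∞) (μ : Measure G) : ℝ≥0∞ :=
  ⨅ (C : ℝ≥0) (_ : HasSchurApprox p μ C), (C : ℝ≥0∞)

/-- `Γ` is a lattice in `G`: a discrete subgroup of finite covolume. Here `μ` is a left Haar
measure, hence invariant under the action of `Γ` by left multiplication, and the covolume is the
measure of a fundamental domain for this action (all fundamental domains have the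
same measure). -/
structure IsLattice (Γ : Subgroup G) (μ : Measure G) : Prop where
  discrete : DiscreteTopology Γ
  finite_covolume : ∃ F : Set G, IsFundamentalDomain Γ F μ ∧ μ F < ∞

end GroupDefs

end SchurAP

end

/-!
For `φ` on `Γ`, a measurable `Γ`-equivariant map `κ : G → Γ` and the normalized Haar measure on the
fundamental domain `F = κ⁻¹(1)`, the induced function is `φ̂(g) = ∫_F φ(κ(y g)) dy`. A group with a
lattice is unimodular, so `φ̂(g⁻¹ h)` is also the average over `y ∈ F` of `φ(κ(y g)⁻¹ κ(y h))`: the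
induced symbol is an average of pullbacks of the symbol of `φ` along maps `G → Γ`, and each pullback
has completely bounded norm at most that of `φ`.

Conversely `φ` on `G` is averaged over a compact set `U ⊆ F` of positive measure:
`φ'(γ) = μ(U)⁻² ∫∫_{U × U} φ(u⁻¹ γ u')`. The translates `γ U` are disjoint, so their normalized
indicator functions are orthonormal in `L²(G)`, and the Schur multiplier of `φ'` is the compression
of that of `φ` to their span.

Norm estimates rest on a variational description of the Schatten norm: for `1 ≤ p < ∞`, `‖T‖_p` is
the supremum of `(∑ |⟪xᵢ, T yᵢ⟫|^p)^{1/p}` over orthonormal systems `x` and `y`. It makes the norm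
lower semicontinuous under weak limits and averages, and contractive under compressions.
-/

namespace SchurAP

open scoped InnerProduct InnerProductSpace

/-! ### Schatten norms -/

section PositiveOperators

variable {H E F : Type*} [NormedAddCommGroup H] [InnerProductSpace ℂ H] [CompleteSpace H]
  [NormedAddCommGroup E] [InnerProductSpace ℂ E] [NormedAddCommGroup F] [InnerProductSpace ℂ F]

/-- Douglas' factorization lemma. -/
theorem exists_contraction_comp_eq [CompleteSpace F] (A : E →L[ℂ] F) (B : E →L[ℂ] H)
    (h : ∀ x, ‖A x‖ ≤ ‖B x‖) : ∃ V : H →L[ℂ] F, ‖V‖ ≤ 1 ∧ V ∘L B = A := by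
  let R : Submodule ℂ H := B.range.topologicalClosure
  have : CompleteSpace R := (Submodule.isClosed_topologicalClosure _).completeSpace_coe
  have hmem (x : E) : B x ∈ R := Submodule.le_topologicalClosure _ ⟨x, rfl⟩
  let e : E →ₗ[ℂ] R := B.toLinearMap.codRestrict R hmem
  have he : DenseRange e := by
    intro y
    have himage : Subtype.val '' Set.range e = (B.range : Set H) := by
      rw [← Set.range_comp]
      rfl
    rw [closure_subtype, himage]
    exact y.2
  have hbound (x : E) : ‖A.toLinearMap x‖ ≤ 1 * ‖e x‖ := by simpa [e] using h x
  refine ⟨A.toLinearMap.extendOfNorm e ∘L R.orthogonalProjectionOnto, ?_, ?_⟩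
  · exact (ContinuousLinearMap.opNorm_comp_le _ _).trans <|
      mul_le_one₀ (LinearMap.opNorm_extendOfNorm_le he zero_le_one hbound) (norm_nonneg _)
        (Submodule.orthogonalProjectionOnto_norm_le _)
  · ext x
    have hproj : R.orthogonalProjectionOnto (B x) = e x :=
      Submodule.orthogonalProjectionOnto_mem_subspace_eq_self (K := R) ⟨B x, hmem x⟩
    simp only [ContinuousLinearMap.comp_apply, hproj]
    exact LinearMap.extendOfNorm_eq he ⟨1, hbound⟩ x

theorem inner_abs_apply_abs_apply (T : H →L[ℂ] H) (x y : H) :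
    ⟪CFC.abs T x, CFC.abs T y⟫_ℂ = ⟪T x, T y⟫_ℂ := by
  have hadj : (CFC.abs T)† = CFC.abs T := (CFC.abs_nonneg T).isSelfAdjoint.adjoint_eq
  have hmul : CFC.abs T (CFC.abs T y) = (T†) (T y) := DFunLike.congr_fun (CFC.abs_mul_abs T) y
  rw [← ContinuousLinearMap.adjoint_inner_right, hadj, hmul,
    ContinuousLinearMap.adjoint_inner_right]

theorem norm_abs_apply (T : H →L[ℂ] H) (x : H) : ‖CFC.abs T x‖ = ‖T x‖ := by
  rw [norm_eq_sqrt_re_inner (𝕜 := ℂ), norm_eq_sqrt_re_inner (𝕜 := ℂ), inner_abs_apply_abs_apply]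

theorem exists_contraction_comp_abs_eq (T : H →L[ℂ] H) :
    ∃ U : H →L[ℂ] H, ‖U‖ ≤ 1 ∧ U ∘L CFC.abs T = T :=
  exists_contraction_comp_eq T (CFC.abs T) fun x => (norm_abs_apply T x).ge

theorem inner_sqrt_apply_sqrt_apply {P : H →L[ℂ] H} (hP : 0 ≤ P) (x y : H) :
    ⟪CFC.sqrt P x, CFC.sqrt P y⟫_ℂ = ⟪x, P y⟫_ℂ := by
  have hadj : (CFC.sqrt P)† = CFC.sqrt P := (CFC.sqrt_nonneg P).isSelfAdjoint.adjoint_eq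
  have hmul : CFC.sqrt P (CFC.sqrt P y) = P y := DFunLike.congr_fun (CFC.sqrt_mul_sqrt_self P hP) y
  rw [← ContinuousLinearMap.adjoint_inner_right, hadj, hmul]

theorem norm_sqrt_apply_sq {P : H →L[ℂ] H} (hP : 0 ≤ P) (x : H) :
    ‖CFC.sqrt P x‖ ^ 2 = (⟪x, P x⟫_ℂ).re := by
  rw [← inner_sqrt_apply_sqrt_apply hP, inner_self_eq_norm_sq_to_K]
  norm_cast

theorem enorm_sqrt_apply_sq {P : H →L[ℂ] H} (hP : 0 ≤ P) (x : H) :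
    ‖CFC.sqrt P x‖ₑ ^ 2 = ENNReal.ofReal (⟪x, P x⟫_ℂ).re := by
  rw [← norm_sqrt_apply_sq hP, ENNReal.ofReal_pow (norm_nonneg _), ofReal_norm]

theorem re_inner_nonneg_of_nonneg {P : H →L[ℂ] H} (hP : 0 ≤ P) (x : H) : 0 ≤ (⟪x, P x⟫_ℂ).re := by
  rw [← norm_sqrt_apply_sq hP]
  positivity

theorem norm_inner_le_of_nonneg {P : H →L[ℂ] H} (hP : 0 ≤ P) (x y : H) :
    ‖⟪x, P y⟫_ℂ‖ ≤ ‖CFC.sqrt P x‖ * ‖CFC.sqrt P y‖ := by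
  rw [← inner_sqrt_apply_sqrt_apply hP]
  exact norm_inner_le_norm _ _

theorem rpow_tangent_le {r s t : ℝ} (hr : 1 ≤ r) (hs : 0 < s) (ht : 0 ≤ t) :
    (1 - r) * s ^ r + r * s ^ (r - 1) * t ≤ t ^ r := by
  have hbernoulli := one_add_mul_self_le_rpow_one_add (s := t / s - 1)
    (by linarith [div_nonneg ht hs.le]) hr
  rw [add_sub_cancel, Real.div_rpow ht hs.le, le_div_iff₀ (by positivity)] at hbernoulli
  have hpow : s ^ r = s ^ (r - 1) * s := by rw [← Real.rpow_add_one hs.ne', sub_add_cancel]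
  calc (1 - r) * s ^ r + r * s ^ (r - 1) * t
      = (1 + r * (t / s - 1)) * s ^ r := by rw [hpow]; field_simp; ring
    _ ≤ t ^ r := hbernoulli

theorem tangent_le_rpow_of_nonneg {P : H →L[ℂ] H} (hP : 0 ≤ P) {r s : ℝ} (hr : 1 ≤ r)
    (hs : 0 < s) :
    algebraMap ℝ (H →L[ℂ] H) ((1 - r) * s ^ r) + (r * s ^ (r - 1)) • P ≤ P ^ r := by
  have hsa : IsSelfAdjoint P := hP.isSelfAdjoint
  calc algebraMap ℝ (H →L[ℂ] H) ((1 - r) * s ^ r) + (r * s ^ (r - 1)) • P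
      = cfc (fun t : ℝ => (1 - r) * s ^ r + r * s ^ (r - 1) * t) P := by
        rw [cfc_const_add _ _ P, cfc_const_mul _ _ P, cfc_id' ℝ P]
    _ ≤ cfc (fun t : ℝ => t ^ r) P :=
        cfc_mono (fun t ht => rpow_tangent_le hr hs (spectrum_nonneg_of_nonneg hP ht))
          (by fun_prop) (Real.continuous_rpow_const (by linarith)).continuousOn
    _ = P ^ r := (CFC.rpow_eq_cfc_real hP).symm

/-- Jensen's inequality for the functional calculus of a positive operator. -/
theorem re_inner_rpow_le {P : H →L[ℂ] H} (hP : 0 ≤ P) {r : ℝ} (hr : 1 ≤ r) {x : H}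
    (hx : ‖x‖ ≤ 1) : (⟪x, P x⟫_ℂ).re ^ r ≤ (⟪x, (P ^ r) x⟫_ℂ).re := by
  set s : ℝ := (⟪x, P x⟫_ℂ).re with hs
  rcases (re_inner_nonneg_of_nonneg hP x).eq_or_lt with hzero | hpos
  · rw [hs, ← hzero, Real.zero_rpow (by linarith)]
    exact re_inner_nonneg_of_nonneg CFC.rpow_nonneg x
  have htangent := (ContinuousLinearMap.le_def _ _).1 (tangent_le_rpow_of_nonneg hP hr hpos)
    |>.re_inner_nonneg_right x
  have hlinear : (1 - r) * s ^ r * ‖x‖ ^ 2 + r * s ^ (r - 1) * s ≤ (⟪x, (P ^ r) x⟫_ℂ).re := by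
    simpa [sub_apply, inner_sub_right, inner_add_right, Algebra.algebraMap_eq_smul_one,
      inner_smul_right_eq_smul, inner_self_eq_norm_sq_to_K, ← Complex.ofReal_pow, ← hs]
      using htangent
  refine le_trans ?_ hlinear
  have hpow : s ^ (r - 1) * s = s ^ r := by rw [← Real.rpow_add_one hpos.ne', sub_add_cancel]
  have hx2 : ‖x‖ ^ 2 ≤ 1 := pow_le_one₀ (norm_nonneg x) hx
  rw [mul_assoc r, hpow]
  nlinarith [mul_nonneg (mul_nonneg (Real.rpow_nonneg hpos.le r) (sub_nonneg.2 hr))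
    (sub_nonneg.2 hx2)]

end PositiveOperators

theorem isCompactOperator_rankOne {H F : Type*} [NormedAddCommGroup H] [InnerProductSpace ℂ H]
    [NormedAddCommGroup F] [InnerProductSpace ℂ F] (x : F) (y : H) :
    IsCompactOperator (InnerProductSpace.rankOne ℂ x y) :=
  (isCompactOperator_of_locallyCompactSpace_dom (innerSL ℂ y)).clm_comp
    (ContinuousLinearMap.toSpanSingleton ℂ x)

section Trace

variable {H E F : Type*} [NormedAddCommGroup H] [InnerProductSpace ℂ H]
  [NormedAddCommGroup E] [InnerProductSpace ℂ E] [CompleteSpace E]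
  [NormedAddCommGroup F] [InnerProductSpace ℂ F] [CompleteSpace F]

theorem tsum_enorm_inner_sq {ι : Type*} (b : HilbertBasis ι ℂ H) (x : H) :
    ∑' i, ‖⟪b i, x⟫_ℂ‖ₑ ^ 2 = ‖x‖ₑ ^ 2 := by
  have hsum : HasSum (fun i => ‖⟪b i, x⟫_ℂ‖ ^ 2) (‖x‖ ^ 2) := by
    convert Complex.hasSum_re (b.hasSum_inner_mul_inner x x) using 1
    · ext i
      rw [← inner_conj_symm, Complex.mul_conj, Complex.ofReal_re, Complex.normSq_eq_norm_sq,
        RCLike.norm_conj]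
    · rw [inner_self_eq_norm_sq_to_K]
      norm_cast
  simp_rw [← ofReal_norm, ← ENNReal.ofReal_pow (norm_nonneg _)]
  rw [← ENNReal.ofReal_tsum_of_nonneg (fun i => by positivity) hsum.summable, hsum.tsum_eq]

theorem sum_enorm_inner_sq_le {ι : Type*} {e : ι → H} (he : Orthonormal ℂ e) (s : Finset ι)
    (x : H) : ∑ i ∈ s, ‖⟪e i, x⟫_ℂ‖ₑ ^ 2 ≤ ‖x‖ₑ ^ 2 := by
  simp_rw [← ofReal_norm, ← ENNReal.ofReal_pow (norm_nonneg _)]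
  rw [← ENNReal.ofReal_sum_of_nonneg fun i _ => by positivity]
  exact ENNReal.ofReal_le_ofReal (he.sum_inner_products_le x)

theorem enorm_adjoint (A : E →L[ℂ] F) : ‖A†‖ₑ = ‖A‖ₑ := by
  rw [← ofReal_norm, LinearIsometryEquiv.norm_map, ofReal_norm]

theorem enorm_inner_adjoint (A : E →L[ℂ] F) (x : E) (y : F) :
    ‖⟪x, (A†) y⟫_ℂ‖ₑ = ‖⟪y, A x⟫_ℂ‖ₑ := by
  rw [ContinuousLinearMap.adjoint_inner_right, ← inner_conj_symm, RCLike.enorm_conj]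

theorem tsum_enorm_sq_adjoint {ι κ : Type*} (A : E →L[ℂ] F) (b : HilbertBasis ι ℂ E)
    (c : HilbertBasis κ ℂ F) : ∑' i, ‖A (b i)‖ₑ ^ 2 = ∑' j, ‖(A†) (c j)‖ₑ ^ 2 := by
  simp_rw [← tsum_enorm_inner_sq c (A _), ← tsum_enorm_inner_sq b ((A†) _), enorm_inner_adjoint]
  exact ENNReal.tsum_comm

theorem posTrace_eq_tsum {ι : Type*} {P : E →L[ℂ] E} (hP : 0 ≤ P) (b : HilbertBasis ι ℂ E) :
    posTrace P = ∑' i, ‖CFC.sqrt P (b i)‖ₑ ^ 2 := by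
  have hadj : (CFC.sqrt P)† = CFC.sqrt P := (CFC.sqrt_nonneg P).isSelfAdjoint.adjoint_eq
  rw [tsum_enorm_sq_adjoint (CFC.sqrt P) b (exists_hilbertBasis ℂ E).choose_spec.choose, hadj]
  exact tsum_congr fun i => (enorm_sqrt_apply_sq hP _).symm

theorem sum_inner_le_posTrace {ι : Type*} {P : F →L[ℂ] F} (hP : 0 ≤ P) {e : ι → E}
    (he : Orthonormal ℂ e) (X : E →L[ℂ] F) (hX : ‖X‖ ≤ 1) (s : Finset ι) :
    ∑ i ∈ s, ENNReal.ofReal (⟪X (e i), P (X (e i))⟫_ℂ).re ≤ posTrace P := by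
  obtain ⟨w, b, -⟩ := exists_hilbertBasis ℂ F
  have hadj : (CFC.sqrt P)† = CFC.sqrt P := (CFC.sqrt_nonneg P).isSelfAdjoint.adjoint_eq
  have hinner (i : ι) (j : w) :
      ‖⟪b j, CFC.sqrt P (X (e i))⟫_ℂ‖ₑ = ‖⟪e i, (X†) (CFC.sqrt P (b j))⟫_ℂ‖ₑ := by
    rw [enorm_inner_adjoint, ← ContinuousLinearMap.adjoint_inner_left, hadj, ← inner_conj_symm,
      RCLike.enorm_conj]
  have hcontraction (y : F) : ‖(X†) y‖ₑ ≤ ‖y‖ₑ := by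
    simp only [enorm_le_iff_norm_le]
    exact (X†).le_of_opNorm_le ((LinearIsometryEquiv.norm_map _ X).trans_le hX) y |>.trans_eq
      (one_mul _)
  rw [posTrace_eq_tsum hP b]
  simp_rw [← enorm_sqrt_apply_sq hP, ← tsum_enorm_inner_sq b (CFC.sqrt P (X _))]
  rw [← Summable.tsum_finsetSum fun i _ => ENNReal.summable]
  simp_rw [hinner]
  gcongr with j
  exact (sum_enorm_inner_sq_le he s _).trans (by gcongr; exact hcontraction _)

theorem norm_inner_rpow_le {P : F →L[ℂ] F} (hP : 0 ≤ P) {r : ℝ} (hr : 1 ≤ r) {x y : F}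
    (hx : ‖x‖ ≤ 1) (hy : ‖y‖ ≤ 1) :
    ‖⟪x, P y⟫_ℂ‖ ^ r ≤ 2⁻¹ * (⟪x, (P ^ r) x⟫_ℂ).re + 2⁻¹ * (⟪y, (P ^ r) y⟫_ℂ).re := by
  have hr0 : 0 ≤ r := by linarith
  set a := ‖CFC.sqrt P x‖
  set b := ‖CFC.sqrt P y‖
  calc ‖⟪x, P y⟫_ℂ‖ ^ r ≤ (a * b) ^ r :=
        Real.rpow_le_rpow (norm_nonneg _) (norm_inner_le_of_nonneg hP x y) hr0
    _ = a ^ r * b ^ r := Real.mul_rpow (norm_nonneg _) (norm_nonneg _)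
    _ ≤ 2⁻¹ * (a ^ r) ^ 2 + 2⁻¹ * (b ^ r) ^ 2 := by nlinarith [sq_nonneg (a ^ r - b ^ r)]
    _ = 2⁻¹ * (⟪x, P x⟫_ℂ).re ^ r + 2⁻¹ * (⟪y, P y⟫_ℂ).re ^ r := by
        rw [Real.rpow_pow_comm (norm_nonneg _), Real.rpow_pow_comm (norm_nonneg _),
          norm_sqrt_apply_sq hP, norm_sqrt_apply_sq hP]
    _ ≤ _ := by gcongr <;> exact re_inner_rpow_le hP hr ‹_›

theorem sum_norm_inner_rpow_le_posTrace {L ι : Type*} [NormedAddCommGroup L]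
    [InnerProductSpace ℂ L] [CompleteSpace L] (T : L →L[ℂ] L) {r : ℝ} (hr : 1 ≤ r)
    {e : ι → E} {f : ι → F} (he : Orthonormal ℂ e) (hf : Orthonormal ℂ f)
    {X : E →L[ℂ] L} {Y : F →L[ℂ] L} (hX : ‖X‖ ≤ 1) (hY : ‖Y‖ ≤ 1) (s : Finset ι) :
    ∑ i ∈ s, ENNReal.ofReal (‖⟪Y (f i), T (X (e i))⟫_ℂ‖ ^ r) ≤ posTrace (CFC.abs T ^ r) := by
  -- Polar decomposition `T = U |T|`, with `U` absorbed into the left factor.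
  obtain ⟨U, hU, hUT⟩ := exists_contraction_comp_abs_eq T
  have hP : 0 ≤ CFC.abs T ^ r := CFC.rpow_nonneg
  set Z : F →L[ℂ] L := U† ∘L Y
  have hZ : ‖Z‖ ≤ 1 := (ContinuousLinearMap.opNorm_comp_le _ _).trans <|
    mul_le_one₀ ((LinearIsometryEquiv.norm_map _ U).trans_le hU) (norm_nonneg _) hY
  have hpolar (i : ι) : ⟪Y (f i), T (X (e i))⟫_ℂ = ⟪Z (f i), CFC.abs T (X (e i))⟫_ℂ := by
    rw [ContinuousLinearMap.comp_apply, ContinuousLinearMap.adjoint_inner_left,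
      ← ContinuousLinearMap.comp_apply U, hUT]
  have hterm (i : ι) : ENNReal.ofReal (‖⟪Y (f i), T (X (e i))⟫_ℂ‖ ^ r) ≤
      2⁻¹ * ENNReal.ofReal (⟪Z (f i), (CFC.abs T ^ r) (Z (f i))⟫_ℂ).re
      + 2⁻¹ * ENNReal.ofReal (⟪X (e i), (CFC.abs T ^ r) (X (e i))⟫_ℂ).re := by
    have hhalf : (2⁻¹ : ℝ≥0∞) = ENNReal.ofReal 2⁻¹ := by
      rw [ENNReal.ofReal_inv_of_pos two_pos, ENNReal.ofReal_ofNat]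
    have hZf := re_inner_nonneg_of_nonneg hP (Z (f i))
    have hXe := re_inner_nonneg_of_nonneg hP (X (e i))
    rw [hhalf, ← ENNReal.ofReal_mul (by norm_num), ← ENNReal.ofReal_mul (by norm_num),
      ← ENNReal.ofReal_add (by positivity) (by positivity), hpolar]
    exact ENNReal.ofReal_le_ofReal <| norm_inner_rpow_le (CFC.abs_nonneg T) hr
      (Z.unit_le_opNorm _ (hf.1 i).le |>.trans hZ) (X.unit_le_opNorm _ (he.1 i).le |>.trans hX)
  calc _ ≤ ∑ i ∈ s, (2⁻¹ * ENNReal.ofReal (⟪Z (f i), (CFC.abs T ^ r) (Z (f i))⟫_ℂ).re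
      + 2⁻¹ * ENNReal.ofReal (⟪X (e i), (CFC.abs T ^ r) (X (e i))⟫_ℂ).re) :=
        Finset.sum_le_sum fun i _ => hterm i
    _ ≤ 2⁻¹ * posTrace (CFC.abs T ^ r) + 2⁻¹ * posTrace (CFC.abs T ^ r) := by
        rw [Finset.sum_add_distrib, ← Finset.mul_sum, ← Finset.mul_sum]
        gcongr
        · exact sum_inner_le_posTrace hP hf Z hZ s
        · exact sum_inner_le_posTrace hP he X hX s
    _ = posTrace (CFC.abs T ^ r) := by rw [← add_mul, ENNReal.inv_two_add_inv_two, one_mul]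

theorem enorm_le_tsum_enorm_sq_rpow {ι : Type*} (b : HilbertBasis ι ℂ E) (A : E →L[ℂ] F) :
    ‖A‖ₑ ≤ (∑' i, ‖A (b i)‖ₑ ^ 2) ^ (2⁻¹ : ℝ) := by
  rw [← enorm_adjoint]
  refine ContinuousLinearMap.opENorm_le_bound _ fun y => ?_
  have hsq : ‖(A†) y‖ₑ ^ 2 ≤ (∑' i, ‖A (b i)‖ₑ ^ 2) * ‖y‖ₑ ^ 2 := by
    rw [← tsum_enorm_inner_sq b, ← ENNReal.tsum_mul_right]
    gcongr with i
    rw [enorm_inner_adjoint, ← mul_pow, mul_comm]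
    gcongr
    simpa only [enorm_eq_nnnorm, ← ENNReal.coe_mul, ENNReal.coe_le_coe] using
      nnnorm_inner_le_nnnorm (𝕜 := ℂ) y (A (b i))
  calc ‖(A†) y‖ₑ = (‖(A†) y‖ₑ ^ 2) ^ (2⁻¹ : ℝ) := (ENNReal.pow_rpow_inv_natCast two_ne_zero _).symm
    _ ≤ ((∑' i, ‖A (b i)‖ₑ ^ 2) * ‖y‖ₑ ^ 2) ^ (2⁻¹ : ℝ) := by gcongr
    _ = (∑' i, ‖A (b i)‖ₑ ^ 2) ^ (2⁻¹ : ℝ) * ‖y‖ₑ := by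
        rw [ENNReal.mul_rpow_of_nonneg _ _ (by positivity)]
        congr 1
        exact ENNReal.pow_rpow_inv_natCast two_ne_zero _

theorem isCompactOperator_of_tsum_enorm_sq_ne_top {ι : Type*} (b : HilbertBasis ι ℂ E)
    (A : E →L[ℂ] F) (h : ∑' i, ‖A (b i)‖ₑ ^ 2 ≠ ∞) : IsCompactOperator A := by
  classical
  let R (s : Finset ι) : E →L[ℂ] F := ∑ i ∈ s, InnerProductSpace.rankOne ℂ (A (b i)) (b i)
  have hR (s : Finset ι) : IsCompactOperator (R s) :=
    Submodule.sum_mem (compactOperator (RingHom.id ℂ) E F) fun i _ =>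
      isCompactOperator_rankOne (A (b i)) (b i)
  have hbasis (s : Finset ι) (i : ι) : (A - R s) (b i) = if i ∈ s then 0 else A (b i) := by
    have hRb : R s (b i) = if i ∈ s then A (b i) else 0 := by
      simp [R, sum_apply, orthonormal_iff_ite.1 b.orthonormal]
    rw [sub_apply, hRb]
    split_ifs <;> simp
  have htail (s : Finset ι) :
      ‖A - R s‖ₑ ≤ (∑' i : {i // i ∉ s}, ‖A (b i)‖ₑ ^ 2) ^ (2⁻¹ : ℝ) := by
    refine (enorm_le_tsum_enorm_sq_rpow b _).trans_eq ?_
    congr 1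
    refine .trans (tsum_congr fun i => ?_) (tsum_subtype {i | i ∉ s} fun i => ‖A (b i)‖ₑ ^ 2).symm
    by_cases hi : i ∈ s <;> simp [hbasis, hi]
  refine isCompactOperator_of_tendsto (F := R) (l := atTop) ?_ (Eventually.of_forall hR)
  rw [tendsto_iff_edist_tendsto_0]
  refine tendsto_of_tendsto_of_tendsto_of_le_of_le tendsto_const_nhds ?_ (fun _ => zero_le)
    fun s => by simpa [edist_comm _ A, edist_eq_enorm_sub] using htail s
  simpa using (ENNReal.tendsto_tsum_compl_atTop_zero h).ennrpow_const 2⁻¹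

end Trace

section CompactOperators

variable {H E F : Type*} [NormedAddCommGroup H] [InnerProductSpace ℂ H] [CompleteSpace H]
  [NormedAddCommGroup E] [InnerProductSpace ℂ E] [NormedAddCommGroup F] [InnerProductSpace ℂ F]

theorem isCompactOperator_of_norm_le [CompleteSpace F] {A : E →L[ℂ] F} {B : E →L[ℂ] H}
    (hB : IsCompactOperator B) (h : ∀ x, ‖A x‖ ≤ ‖B x‖) : IsCompactOperator A := by
  obtain ⟨V, -, rfl⟩ := exists_contraction_comp_eq A B h
  exact hB.clm_comp V

theorem isCompactOperator_abs {T : H →L[ℂ] H} (hT : IsCompactOperator T) :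
    IsCompactOperator (CFC.abs T : H →L[ℂ] H) :=
  isCompactOperator_of_norm_le hT fun x => (norm_abs_apply T x).le

theorem isCompactOperator_cfcₙ {T : H →L[ℂ] H} (hT : IsCompactOperator T) (f : ℝ → ℝ) :
    IsCompactOperator (cfcₙ f T : H →L[ℂ] H) := by
  have hzero : IsCompactOperator (0 : H →L[ℂ] H) := isCompactOperator_zero
  refine cfcₙ_cases (fun S : H →L[ℂ] H => IsCompactOperator (S : H → H)) T f hzero
    fun hf hf0 ha => ?_
  generalize (⟨⟨_, hf.domRestrict⟩, hf0⟩ : ContinuousMapZero (quasispectrum ℝ T) ℝ) = g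
  induction g using ContinuousMapZero.induction_on_of_compact with
  | zero => simpa only [map_zero] using hzero
  | id => rwa [cfcₙHom_id]
  | star_id => rwa [map_star, cfcₙHom_id, ha.star_eq]
  | add f g hf hg => rw [map_add]; exact hf.add hg
  | mul f g hf _ => rw [map_mul]; exact hf.comp_clm _
  | smul r f hf => rw [map_smul]; exact hf.smul r
  | frequently f hf =>
    exact hf.mem_of_closed <|
      isClosed_setOfPred_isCompactOperator.preimage (cfcₙHom_continuous ha)

theorem isCompactOperator_of_nnrpow {P : H →L[ℂ] H} (hP : 0 ≤ P) {s : ℝ≥0} (hs : s ≠ 0)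
    (h : IsCompactOperator (P ^ s : H →L[ℂ] H)) : IsCompactOperator P := by
  rw [← CFC.nnrpow_nnrpow_inv P hs, CFC.nnrpow_eq_cfcₙ_real _ _ CFC.nnrpow_nonneg]
  exact isCompactOperator_cfcₙ h _

theorem isCompactOperator_of_posTrace_ne_top (T : H →L[ℂ] H) {r : ℝ≥0} (hr : 0 < r)
    (h : posTrace (CFC.abs T ^ (r : ℝ)) ≠ ∞) : IsCompactOperator T := by
  obtain ⟨w, b, -⟩ := exists_hilbertBasis ℂ H
  have hpow : (0 : H →L[ℂ] H) ≤ CFC.abs T ^ r := CFC.nnrpow_nonneg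
  rw [← CFC.nnrpow_eq_rpow hr, posTrace_eq_tsum hpow b, CFC.sqrt_nnrpow] at h
  have habs : IsCompactOperator (CFC.abs T : H →L[ℂ] H) :=
    isCompactOperator_of_nnrpow (CFC.abs_nonneg T) (s := r / 2) (half_pos hr).ne'
      (isCompactOperator_of_tsum_enorm_sq_ne_top b _ h)
  exact isCompactOperator_of_norm_le habs fun x => (norm_abs_apply T x).ge

theorem mem_spectrum_of_apply_eq_smul {P : E →L[ℂ] E} {s : ℝ} {v : E} (hv : v ≠ 0)
    (h : P v = (s : ℂ) • v) : s ∈ spectrum ℝ P := by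
  rintro ⟨u, hu⟩
  have hker : (u : E →L[ℂ] E) v = 0 := by
    rw [hu, sub_apply, Algebra.algebraMap_eq_smul_one, smul_apply, one_apply_eq_self, h,
      Complex.coe_smul, sub_self]
  apply hv
  rw [← one_apply_eq_self (F := E →L[ℂ] E) v, ← u.inv_mul, mul_apply_eq_comp, hker, map_zero]

theorem cfc_apply_of_apply_eq_smul {P : H →L[ℂ] H} (hP : IsSelfAdjoint P) {s : ℝ} {v : H}
    (h : P v = (s : ℂ) • v) {f : ℝ → ℝ} (hf : ContinuousOn f (spectrum ℝ P)) :
    cfc f P v = (f s : ℂ) • v := by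
  rcases eq_or_ne v 0 with rfl | hv
  · simp
  have hs := mem_spectrum_of_apply_eq_smul hv h
  rw [cfc_apply f P hP hf]
  suffices ∀ g : C(spectrum ℝ P, ℝ), cfcHom hP g v = (g ⟨s, hs⟩ : ℂ) • v from this _
  intro g
  induction g using ContinuousMap.induction_on_of_compact with
  | const r =>
    rw [show ContinuousMap.const (spectrum ℝ P) r = algebraMap ℝ C(spectrum ℝ P, ℝ) r from rfl,
      AlgHomClass.commutes, Algebra.algebraMap_eq_smul_one, smul_apply, one_apply_eq_self]
    simp
  | id => simpa [cfcHom_id] using h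
  | star_id => simpa [map_star, cfcHom_id, hP.star_eq] using h
  | add f g hf hg =>
    rw [map_add, add_apply, hf, hg, ContinuousMap.add_apply, Complex.ofReal_add, add_smul]
  | mul f g hf hg =>
    rw [map_mul, mul_apply_eq_comp, hg, ContinuousLinearMap.map_smul, hf, smul_smul, mul_comm,
      ContinuousMap.mul_apply, Complex.ofReal_mul]
  | frequently f hf =>
    refine hf.mem_of_closed <| isClosed_eq ?_ ?_
    · exact (ContinuousLinearMap.apply ℂ H v).continuous.comp (cfcHom_continuous hP)
    · exact (Complex.continuous_ofReal.comp (continuous_eval_const _)).smul continuous_const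

theorem exists_hilbertBasis_of_orthogonalFamily {α : Type*} {V : α → Submodule ℂ H}
    (hV : OrthogonalFamily ℂ (fun a => V a) fun a => (V a).subtypeₗᵢ)
    (hclosed : ∀ a, IsClosed (V a : Set H)) (hsup : (⨆ a, V a)ᗮ = ⊥) :
    ∃ (w : ∀ a, Set (V a)) (b : HilbertBasis (Σ a, w a) ℂ H), ∀ i, b i ∈ V i.1 := by
  have hcomplete (a : α) : CompleteSpace (V a) := (hclosed a).completeSpace_coe
  choose w c _ using fun a => exists_hilbertBasis ℂ (V a)
  let v (i : Σ a, w a) : H := (V i.1).subtypeₗᵢ (c i.1 i.2)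
  have hv : Orthonormal ℂ v :=
    hV.orthonormal_sigma_orthonormal fun a => (c a).orthonormal
  have hspan : (Submodule.span ℂ (Set.range v))ᗮ = ⊥ := by
    rw [eq_bot_iff, ← hsup]
    intro x hx
    rw [← Submodule.iInf_orthogonal, Submodule.mem_iInf]
    intro a
    rw [← Submodule.orthogonalProjectionOnto_eq_zero_iff, ← (c a).repr.map_eq_zero_iff]
    ext i
    rw [(c a).repr_apply_apply, Submodule.inner_orthogonalProjectionOnto_eq_of_mem_left]
    exact (Submodule.mem_orthogonal _ _).1 hx _ (Submodule.subset_span ⟨⟨a, i⟩, rfl⟩)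
  refine ⟨w, HilbertBasis.mkOfOrthogonalEqBot hv hspan, fun i => ?_⟩
  rw [HilbertBasis.coe_mkOfOrthogonalEqBot]
  exact (c i.1 i.2).2

theorem exists_eigenbasis {H : Type u} [NormedAddCommGroup H] [InnerProductSpace ℂ H]
    [CompleteSpace H] {P : H →L[ℂ] H} (hP : 0 ≤ P) (hc : IsCompactOperator P) :
    ∃ (ι : Type u) (b : HilbertBasis ι ℂ H) (s : ι → ℝ),
      (∀ i, 0 ≤ s i) ∧ ∀ i, P (b i) = (s i : ℂ) • b i := by
  have hsym : (P : H →ₗ[ℂ] H).IsSymmetric := hP.isSelfAdjoint.isSymmetric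
  have hclosed (μ : ℂ) :
      IsClosed (Module.End.eigenspace (P : H →ₗ[ℂ] H) μ : Set H) := by
    have heq : (Module.End.eigenspace (P : H →ₗ[ℂ] H) μ : Set H) = {x | P x = μ • x} := by
      ext x
      exact Module.End.mem_eigenspace_iff
    rw [heq]
    exact isClosed_eq P.continuous (continuous_const_smul μ)
  obtain ⟨w, b, hb⟩ := exists_hilbertBasis_of_orthogonalFamily hsym.orthogonalFamily_eigenspaces
    hclosed (ContinuousLinearMap.orthogonalComplement_iSup_eigenspaces_eq_bot hc hsym)
  have hPb (i : Σ μ, w μ) : P (b i) = i.1 • b i := Module.End.mem_eigenspace_iff.1 (hb i)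
  have hinner (i : Σ μ, w μ) : ⟪b i, P (b i)⟫_ℂ = i.1 := by
    rw [hPb, inner_smul_right, inner_self_eq_norm_sq_to_K, b.orthonormal.1 i]
    simp
  have hreal (i : Σ μ, w μ) : ((i.1.re : ℝ) : ℂ) = i.1 := by
    rw [← Complex.conj_eq_iff_re, ← hinner i, inner_conj_symm]
    exact hsym _ _
  refine ⟨Σ μ, w μ, b, fun i => i.1.re, fun i => ?_, fun i => by rw [hreal, hPb]⟩
  simpa only [hinner] using re_inner_nonneg_of_nonneg hP (b i)

end CompactOperators

section SingularValues

variable {H : Type*} [NormedAddCommGroup H] [InnerProductSpace ℂ H] [CompleteSpace H]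

theorem inner_apply_apply_of_abs_apply_eq_smul {T : H →L[ℂ] H} {x y : H} {s : ℝ}
    (h : CFC.abs T y = (s : ℂ) • y) : ⟪T x, T y⟫_ℂ = (s : ℂ) ^ 2 * ⟪x, y⟫_ℂ := by
  have hadj : (CFC.abs T)† = CFC.abs T := (CFC.abs_nonneg T).isSelfAdjoint.adjoint_eq
  rw [← inner_abs_apply_abs_apply, h, inner_smul_right, ← ContinuousLinearMap.adjoint_inner_right,
    hadj, h, inner_smul_right, sq, mul_assoc]

theorem orthonormal_inv_smul_apply {T : H →L[ℂ] H} {ι : Type*} {e : ι → H}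
    (he : Orthonormal ℂ e) {s : ι → ℝ} (hs : ∀ i, CFC.abs T (e i) = (s i : ℂ) • e i)
    (hs0 : ∀ i, s i ≠ 0) : Orthonormal ℂ fun i => (s i : ℂ)⁻¹ • T (e i) := by
  classical
  refine orthonormal_iff_ite.2 fun i j => ?_
  rw [inner_smul_left, inner_smul_right, inner_apply_apply_of_abs_apply_eq_smul (hs j),
    orthonormal_iff_ite.1 he]
  split_ifs with hij
  · have : (s i : ℂ) ≠ 0 := mod_cast hs0 i
    subst hij
    simp only [map_inv₀, Complex.conj_ofReal]
    field_simp
  · simp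

theorem inner_inv_smul_apply {T : H →L[ℂ] H} {x : H} (hx : ‖x‖ = 1) {s : ℝ}
    (hs : CFC.abs T x = (s : ℂ) • x) : ⟪(s : ℂ)⁻¹ • T x, T x⟫_ℂ = s := by
  rw [inner_smul_left, inner_apply_apply_of_abs_apply_eq_smul hs, inner_self_eq_norm_sq_to_K, hx,
    map_inv₀, Complex.conj_ofReal]
  rcases eq_or_ne (s : ℂ) 0 with h0 | h0
  · simp [h0]
  · simp [sq, h0]

theorem posTrace_rpow_eq_tsum {P : H →L[ℂ] H} (hP : 0 ≤ P) {ι : Type*} (b : HilbertBasis ι ℂ H)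
    {s : ι → ℝ} (hs : ∀ i, P (b i) = (s i : ℂ) • b i) {r : ℝ} (hr : 0 ≤ r) :
    posTrace (P ^ r) = ∑' i, ENNReal.ofReal (s i ^ r) := by
  have hpow : 0 ≤ P ^ r := CFC.rpow_nonneg
  rw [posTrace_eq_tsum hpow b]
  refine tsum_congr fun i => ?_
  rw [enorm_sqrt_apply_sq hpow, CFC.rpow_eq_cfc_real hP, cfc_apply_of_apply_eq_smul
    hP.isSelfAdjoint (hs i) (Real.continuous_rpow_const hr).continuousOn, inner_smul_right,
    inner_self_eq_norm_sq_to_K, b.orthonormal.1 i]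
  simp

theorem posTrace_le_of_forall_sum_le {T : H →L[ℂ] H} (hT : IsCompactOperator T) {r : ℝ}
    (hr : 0 < r) {c : ℝ≥0∞}
    (h : ∀ (n : ℕ) (e f : Fin n → H), Orthonormal ℂ e → Orthonormal ℂ f →
      ∑ i, ENNReal.ofReal (‖⟪f i, T (e i)⟫_ℂ‖ ^ r) ≤ c) :
    posTrace (CFC.abs T ^ r) ≤ c := by
  obtain ⟨ι, b, s, hs0, hs⟩ := exists_eigenbasis (CFC.abs_nonneg T) (isCompactOperator_abs hT)
  have hsupport : Function.support (fun i => ENNReal.ofReal (s i ^ r)) ⊆ {i | s i ≠ 0} :=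
    fun i hi h0 => hi (by simp only [h0, Real.zero_rpow hr.ne', ENNReal.ofReal_zero])
  rw [posTrace_rpow_eq_tsum (CFC.abs_nonneg T) b hs hr.le,
    ← tsum_subtype_eq_of_support_subset hsupport, ENNReal.tsum_eq_iSup_sum]
  refine iSup_le fun t => ?_
  let i (j : Fin t.card) : ι := (t.equivFin.symm j : {i | s i ≠ 0})
  have hi : Function.Injective i :=
    Subtype.val_injective.comp (Subtype.val_injective.comp t.equivFin.symm.injective)
  have hbi : Orthonormal ℂ fun j => b (i j) := b.orthonormal.comp i hi
  have hnonzero (j : Fin t.card) : s (i j) ≠ 0 := (t.equivFin.symm j).1.2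
  calc ∑ k ∈ t, ENNReal.ofReal (s k ^ r) = ∑ j, ENNReal.ofReal (s (i j) ^ r) := by
        rw [← Finset.sum_coe_sort t, ← t.equivFin.symm.sum_comp]
    _ = ∑ j, ENNReal.ofReal (‖⟪(s (i j) : ℂ)⁻¹ • T (b (i j)), T (b (i j))⟫_ℂ‖ ^ r) := by
        refine Finset.sum_congr rfl fun j _ => ?_
        rw [inner_inv_smul_apply (hbi.1 j) (hs (i j)), Complex.norm_real,
          Real.norm_of_nonneg (hs0 _)]
    _ ≤ c := h _ _ _ hbi (orthonormal_inv_smul_apply hbi (fun j => hs (i j)) hnonzero)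

end SingularValues

section InnerProductSpace

variable {E : Type*} [NormedAddCommGroup E] [InnerProductSpace ℂ E]

theorem opNorm_le_of_forall_norm_inner_le {T : E →L[ℂ] E} {c : ℝ} (hc : 0 ≤ c)
    (h : ∀ x y, ‖x‖ = 1 → ‖y‖ = 1 → ‖⟪y, T x⟫_ℂ‖ ≤ c) : ‖T‖ ≤ c := by
  refine ContinuousLinearMap.opNorm_le_of_unit_norm hc fun x hx => ?_
  rcases eq_or_ne (T x) 0 with h0 | h0
  · rwa [h0, norm_zero]
  have hnorm : (‖T x‖ : ℂ) ≠ 0 := mod_cast norm_ne_zero_iff.2 h0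
  have hle := h x ((‖T x‖ : ℂ)⁻¹ • T x) hx (by simp [norm_smul, h0])
  rw [inner_smul_left, inner_self_eq_norm_sq_to_K] at hle
  simpa [sq, hnorm] using hle

end InnerProductSpace

section SchattenNorm

variable {H E F : Type*} [NormedAddCommGroup H] [InnerProductSpace ℂ H] [CompleteSpace H]
  [NormedAddCommGroup E] [InnerProductSpace ℂ E] [CompleteSpace E]
  [NormedAddCommGroup F] [InnerProductSpace ℂ F] [CompleteSpace F]
  {p : ℝ≥0∞}

theorem one_le_toReal_of_one_le (hp : 1 ≤ p) (hp' : p ≠ ∞) : 1 ≤ p.toReal := by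
  simpa using ENNReal.toReal_mono hp' hp

theorem norm_toLp_le_iff {ι : Type*} [Fintype ι] (hp : 1 ≤ p) (hp' : p ≠ ∞) (v : ι → ℂ)
    (c : ℝ≥0) :
    ‖WithLp.toLp p v‖ ≤ c ↔
      ∑ i, ENNReal.ofReal (‖v i‖ ^ p.toReal) ≤ (c : ℝ≥0∞) ^ p.toReal := by
  have h0 : 0 < p.toReal := one_pos.trans_le (one_le_toReal_of_one_le hp hp')
  rw [PiLp.norm_eq_sum h0, one_div, Real.rpow_inv_le_iff_of_pos
      (Finset.sum_nonneg fun i _ => by positivity) c.coe_nonneg h0,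
    ← ENNReal.ofReal_sum_of_nonneg (fun i _ => by positivity), ← ENNReal.ofReal_coe_nnreal,
    ENNReal.ofReal_rpow_of_nonneg c.coe_nonneg h0.le, ENNReal.ofReal_le_ofReal_iff (by positivity)]

theorem schattenNorm_le_coe_iff_of_ne_top (hp : 1 ≤ p) (hp' : p ≠ ∞) {T : H →L[ℂ] H} {c : ℝ≥0} :
    schattenNorm p T ≤ c ↔ posTrace (CFC.abs T ^ p.toReal) ≤ (c : ℝ≥0∞) ^ p.toReal := by
  have h0 : 0 < p.toReal := one_pos.trans_le (one_le_toReal_of_one_le hp hp')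
  rw [schattenNorm, if_neg hp', one_div, ENNReal.rpow_inv_le_iff h0]

theorem schattenNorm_top_le_coe_iff {T : H →L[ℂ] H} {c : ℝ≥0} :
    schattenNorm ∞ T ≤ c ↔ IsCompactOperator T ∧ ‖T‖ ≤ c := by
  rw [schattenNorm, if_pos rfl]
  split_ifs with hT
  · simp [hT, ← coe_nnnorm, enorm_eq_nnnorm]
  · simp [hT]

theorem isCompactOperator_of_memSchatten (hp : 1 ≤ p) {T : H →L[ℂ] H} (h : MemSchatten p T) :
    IsCompactOperator T := by
  obtain ⟨c, hc⟩ : ∃ c : ℝ≥0, (c : ℝ≥0∞) = schattenNorm p T := ⟨_, ENNReal.coe_toNNReal h.ne⟩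
  rcases eq_or_ne p ∞ with rfl | hp'
  · exact (schattenNorm_top_le_coe_iff.1 hc.ge).1
  · have hr : 0 < p.toNNReal := one_pos.trans_le (one_le_toReal_of_one_le hp hp')
    have htrace := (schattenNorm_le_coe_iff_of_ne_top hp hp').1 hc.ge
    exact isCompactOperator_of_posTrace_ne_top T hr
      (htrace.trans_lt (ENNReal.rpow_lt_top_of_nonneg ENNReal.toReal_nonneg ENNReal.coe_ne_top)).ne

theorem norm_toLp_le_of_schattenNorm_le (hp : 1 ≤ p) {T : H →L[ℂ] H} {c : ℝ≥0}
    (h : schattenNorm p T ≤ c) {n : ℕ} {e : Fin n → E} {f : Fin n → F} (he : Orthonormal ℂ e)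
    (hf : Orthonormal ℂ f) {X : E →L[ℂ] H} {Y : F →L[ℂ] H} (hX : ‖X‖ ≤ 1) (hY : ‖Y‖ ≤ 1) :
    ‖WithLp.toLp p fun i => ⟪Y (f i), T (X (e i))⟫_ℂ‖ ≤ c := by
  rcases eq_or_ne p ∞ with rfl | hp'
  · rw [PiLp.norm_eq_ciSup]
    refine Real.iSup_le (fun i => ?_) c.coe_nonneg
    calc ‖⟪Y (f i), T (X (e i))⟫_ℂ‖ ≤ ‖Y (f i)‖ * ‖T (X (e i))‖ := norm_inner_le_norm _ _
      _ ≤ 1 * (‖T‖ * 1) := by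
          gcongr
          · exact (Y.unit_le_opNorm _ (hf.1 i).le).trans hY
          · exact T.le_opNorm_of_le ((X.unit_le_opNorm _ (he.1 i).le).trans hX)
      _ ≤ c := by simpa using (schattenNorm_top_le_coe_iff.1 h).2
  · rw [norm_toLp_le_iff hp hp']
    exact (sum_norm_inner_rpow_le_posTrace T (one_le_toReal_of_one_le hp hp') he hf hX hY _).trans
      ((schattenNorm_le_coe_iff_of_ne_top hp hp').1 h)

/-- The variational description of the Schatten norm. It does not mention functional calculus, so
that the norm can be estimated after compressions and weak limits. -/
theorem schattenNorm_le_iff (hp : 1 ≤ p) {T : H →L[ℂ] H} {c : ℝ≥0} :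
    schattenNorm p T ≤ c ↔ IsCompactOperator T ∧
      ∀ (n : ℕ) (e f : Fin n → H), Orthonormal ℂ e → Orthonormal ℂ f →
        ‖WithLp.toLp p fun i => ⟪f i, T (e i)⟫_ℂ‖ ≤ c := by
  have hid : ‖ContinuousLinearMap.id ℂ H‖ ≤ 1 := ContinuousLinearMap.norm_id_le
  constructor
  · intro h
    refine ⟨isCompactOperator_of_memSchatten hp (h.trans_lt ENNReal.coe_lt_top),
      fun n e f he hf => ?_⟩
    simpa only [ContinuousLinearMap.id_apply] using
      norm_toLp_le_of_schattenNorm_le hp h he hf hid hid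
  rintro ⟨hT, h⟩
  rcases eq_or_ne p ∞ with rfl | hp'
  · refine schattenNorm_top_le_coe_iff.2 ⟨hT, opNorm_le_of_forall_norm_inner_le c.coe_nonneg
      fun x y hx hy => ?_⟩
    simpa [PiLp.norm_eq_ciSup] using h 1 (fun _ => x) (fun _ => y)
      (orthonormal_subsingleton_iff.2 fun _ => hx) (orthonormal_subsingleton_iff.2 fun _ => hy)
  · rw [schattenNorm_le_coe_iff_of_ne_top hp hp']
    exact posTrace_le_of_forall_sum_le hT (one_pos.trans_le (one_le_toReal_of_one_le hp hp'))
      fun n e f he hf => (norm_toLp_le_iff hp hp' _ c).1 (h n e f he hf)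

theorem enorm_inner_apply_le_schattenNorm (hp : 1 ≤ p) (T : H →L[ℂ] H) {x y : H} (hx : ‖x‖ = 1)
    (hy : ‖y‖ = 1) : ‖⟪y, T x⟫_ℂ‖ₑ ≤ schattenNorm p T := by
  have : Fact (1 ≤ p) := ⟨hp⟩
  rcases eq_or_ne (schattenNorm p T) ∞ with htop | htop
  · exact htop ▸ le_top
  obtain ⟨c, hc⟩ : ∃ c : ℝ≥0, (c : ℝ≥0∞) = schattenNorm p T := ⟨_, ENNReal.coe_toNNReal htop⟩
  have hconst : ∀ z : H, ‖z‖ = 1 → Orthonormal ℂ fun _ : Fin 1 => z := fun z hz =>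
    ⟨fun _ => hz, fun i j hij => absurd (Subsingleton.elim i j) hij⟩
  rw [← hc, enorm_eq_nnnorm, ENNReal.coe_le_coe]
  exact (PiLp.norm_apply_le _ (0 : Fin 1)).trans
    (((schattenNorm_le_iff hp).1 hc.ge).2 1 _ _ (hconst x hx) (hconst y hy))

theorem schattenNorm_conj_le (hp : 1 ≤ p) (T : H →L[ℂ] H) {X Y : E →L[ℂ] H} (hX : ‖X‖ ≤ 1)
    (hY : ‖Y‖ ≤ 1) : schattenNorm p (Y† ∘L T ∘L X) ≤ schattenNorm p T := by
  rcases eq_or_ne (schattenNorm p T) ∞ with htop | htop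
  · exact htop ▸ le_top
  obtain ⟨c, hc⟩ : ∃ c : ℝ≥0, (c : ℝ≥0∞) = schattenNorm p T := ⟨_, ENNReal.coe_toNNReal htop⟩
  have hT : IsCompactOperator T := isCompactOperator_of_memSchatten hp (lt_top_iff_ne_top.2 htop)
  rw [← hc, schattenNorm_le_iff hp]
  refine ⟨(hT.comp_clm X).clm_comp (Y†), fun n e f he hf => ?_⟩
  simpa only [ContinuousLinearMap.comp_apply, ContinuousLinearMap.adjoint_inner_right] using
    norm_toLp_le_of_schattenNorm_le hp hc.ge he hf hX hY

theorem schattenNorm_le_of_tendsto (hp : 1 ≤ p) {T : H →L[ℂ] H} (hT : IsCompactOperator T)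
    {ι : Type*} {l : Filter ι} [l.NeBot] {S : ι → (H →L[ℂ] H)}
    (hS : ∀ x y, Tendsto (fun i => ⟪x, S i y⟫_ℂ) l (nhds ⟪x, T y⟫_ℂ)) {c : ℝ≥0∞}
    (h : ∀ i, schattenNorm p (S i) ≤ c) : schattenNorm p T ≤ c := by
  rcases eq_or_ne c ∞ with rfl | htop
  · exact le_top
  lift c to ℝ≥0 using htop
  have : Fact (1 ≤ p) := ⟨hp⟩
  refine (schattenNorm_le_iff hp).2 ⟨hT, fun n e f he hf => ?_⟩
  have hlim : Tendsto (fun i => WithLp.toLp p fun j => ⟪f j, S i (e j)⟫_ℂ) l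
      (nhds (WithLp.toLp p fun j => ⟪f j, T (e j)⟫_ℂ)) :=
    ((PiLp.continuous_toLp p _).tendsto _).comp (tendsto_pi_nhds.2 fun j => hS _ _)
  exact le_of_tendsto hlim.norm <|
    Eventually.of_forall fun i => ((schattenNorm_le_iff hp).1 (h i)).2 n e f he hf

theorem schattenNorm_le_of_integral (hp : 1 ≤ p) {T : H →L[ℂ] H} (hT : IsCompactOperator T)
    {Ω : Type*} [MeasurableSpace Ω] {m : Measure Ω} [IsProbabilityMeasure m]
    {S : Ω → (H →L[ℂ] H)}
    (hS : ∀ x y, Integrable (fun ω => ⟪x, S ω y⟫_ℂ) m ∧ ∫ ω, ⟪x, S ω y⟫_ℂ ∂m = ⟪x, T y⟫_ℂ)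
    {c : ℝ≥0∞} (h : ∀ ω, schattenNorm p (S ω) ≤ c) : schattenNorm p T ≤ c := by
  rcases eq_or_ne c ∞ with rfl | htop
  · exact le_top
  lift c to ℝ≥0 using htop
  have : Fact (1 ≤ p) := ⟨hp⟩
  refine (schattenNorm_le_iff hp).2 ⟨hT, fun n e f he hf => ?_⟩
  let L := (PiLp.continuousLinearEquiv p ℂ fun _ : Fin n => ℂ).symm
  have hint : ∫ ω, L (fun j => ⟪f j, S ω (e j)⟫_ℂ) ∂m =
      WithLp.toLp p fun j => ⟪f j, T (e j)⟫_ℂ := by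
    have heval : ∫ ω, (fun j => ⟪f j, S ω (e j)⟫_ℂ) ∂m = fun j => ⟪f j, T (e j)⟫_ℂ := by
      funext j
      rw [eval_integral fun j => (hS _ _).1, (hS _ _).2]
    rw [L.integral_comp_comm, heval]
    rfl
  calc ‖WithLp.toLp p fun j => ⟪f j, T (e j)⟫_ℂ‖ ≤ c * m.real Set.univ :=
        hint ▸ norm_integral_le_of_norm_le_const (Eventually.of_forall fun ω =>
          ((schattenNorm_le_iff hp).1 (h ω)).2 n e f he hf)
    _ = c := by simp

theorem schattenNorm_rankOne_le (hp : 1 ≤ p) (x y : H) :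
    schattenNorm p (InnerProductSpace.rankOne ℂ x y) ≤ (‖x‖₊ * ‖y‖₊ : ℝ≥0) := by
  have : Fact (1 ≤ p) := ⟨hp⟩
  refine (schattenNorm_le_iff hp).2 ⟨isCompactOperator_rankOne x y, fun n e f he hf => ?_⟩
  have hx : √(∑ i, ‖⟪f i, x⟫_ℂ‖ ^ 2) ≤ ‖x‖ :=
    Real.sqrt_le_iff.2 ⟨norm_nonneg _, hf.sum_inner_products_le x⟩
  have hy : √(∑ i, ‖⟪y, e i⟫_ℂ‖ ^ 2) ≤ ‖y‖ := by
    simp_rw [norm_inner_symm y]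
    exact Real.sqrt_le_iff.2 ⟨norm_nonneg _, he.sum_inner_products_le y⟩
  set v : Fin n → ℂ := fun i => ⟪f i, InnerProductSpace.rankOne ℂ x y (e i)⟫_ℂ with hv
  have hsingle : WithLp.toLp p v = ∑ i, (PiLp.single p i (v i) : PiLp p fun _ : Fin n => ℂ) := by
    ext j
    simp [Finset.sum_apply, Pi.single_apply]
  calc ‖WithLp.toLp p v‖ ≤ ∑ i, ‖v i‖ := by
        rw [hsingle]
        exact (norm_sum_le _ _).trans_eq (by simp only [PiLp.norm_single])
    _ = ∑ i, ‖⟪f i, x⟫_ℂ‖ * ‖⟪y, e i⟫_ℂ‖ := by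
        simp only [hv, InnerProductSpace.rankOne_apply, inner_smul_right, norm_mul, mul_comm]
    _ ≤ √(∑ i, ‖⟪f i, x⟫_ℂ‖ ^ 2) * √(∑ i, ‖⟪y, e i⟫_ℂ‖ ^ 2) := Real.sum_mul_le_sqrt_mul_sqrt _ _ _
    _ ≤ ‖x‖ * ‖y‖ := by gcongr

theorem norm_le_of_schattenNorm_smul_rankOne_le (hp : 1 ≤ p) {a : ℂ} {x y : H} (hx : ‖x‖ = 1)
    (hy : ‖y‖ = 1) {c : ℝ≥0}
    (h : schattenNorm p (a • InnerProductSpace.rankOne ℂ x y) ≤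
      c * schattenNorm p (InnerProductSpace.rankOne ℂ x y)) : ‖a‖ ≤ c := by
  have hinner : ∀ z : H, ‖z‖ = 1 → ⟪z, z⟫_ℂ = 1 := fun z hz => by
    rw [inner_self_eq_norm_sq_to_K, hz, RCLike.ofReal_one, one_pow]
  have hnorm : ∀ z : H, ‖z‖ = 1 → ‖z‖₊ = 1 := fun z hz => NNReal.eq hz
  have hone := schattenNorm_rankOne_le hp x y
  rw [hnorm x hx, hnorm y hy, mul_one, ENNReal.coe_one] at hone
  have hentry := enorm_inner_apply_le_schattenNorm hp (a • InnerProductSpace.rankOne ℂ x y) hy hx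
  rw [smul_apply, InnerProductSpace.rankOne_apply, hinner y hy, one_smul, inner_smul_right,
    hinner x hx, mul_one] at hentry
  have hle := hentry.trans (h.trans (mul_le_mul_right hone _))
  rw [mul_one, enorm_eq_nnnorm, ENNReal.coe_le_coe] at hle
  exact hle

theorem memSchatten_rankOne (hp : 1 ≤ p) (x y : H) :
    MemSchatten p (InnerProductSpace.rankOne ℂ x y) :=
  (schattenNorm_rankOne_le hp x y).trans_lt ENNReal.coe_lt_top

end SchattenNorm

/-! ### Hilbert space tensor products and weak limits -/

section Tensor

variable {H H' H'' K K' K'' : Type*} [NormedAddCommGroup H] [InnerProductSpace ℂ H]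
  [NormedAddCommGroup K] [InnerProductSpace ℂ K]
  [NormedAddCommGroup H'] [InnerProductSpace ℂ H']
  [NormedAddCommGroup K'] [InnerProductSpace ℂ K']
  [NormedAddCommGroup H''] [InnerProductSpace ℂ H'']
  [NormedAddCommGroup K''] [InnerProductSpace ℂ K'']

/-- The elementary tensor `h ⊗ k` in the Hilbert space tensor product, as a bounded
bilinear map. -/
noncomputable def pureTensor : H →L[ℂ] K →L[ℂ] HilbertTensor H K :=
  ((TensorProduct.mk ℂ H K).compr₂
    (UniformSpace.Completion.toComplL (𝕜 := ℂ) (E := H ⊗[ℂ] K)).toLinearMap).mkContinuous₂ 1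
    fun h k => by simp [TensorProduct.norm_tmul]

theorem pureTensor_apply (h : H) (k : K) :
    pureTensor h k = ((h ⊗ₜ[ℂ] k : H ⊗[ℂ] K) : HilbertTensor H K) :=
  rfl

theorem inner_pureTensor (h h' : H) (k k' : K) :
    ⟪pureTensor h k, pureTensor h' k'⟫_ℂ = ⟪h, h'⟫_ℂ * ⟪k, k'⟫_ℂ := by
  rw [pureTensor_apply, pureTensor_apply, UniformSpace.Completion.inner_coe,
    TensorProduct.inner_tmul]

theorem norm_pureTensor_eq_one {h : H} {k : K} (hh : ‖h‖ = 1) (hk : ‖k‖ = 1) :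
    ‖pureTensor h k‖ = 1 := by
  rw [pureTensor_apply, UniformSpace.Completion.norm_coe, TensorProduct.norm_tmul, hh, hk, mul_one]

theorem hilbertTensor_induction {p : HilbertTensor H K → Prop} (z : HilbertTensor H K)
    (hclosed : IsClosed {z | p z}) (hzero : p 0) (hadd : ∀ x y, p x → p y → p (x + y))
    (hpure : ∀ h k, p (pureTensor h k)) : p z := by
  refine UniformSpace.Completion.induction_on z hclosed fun a => ?_
  induction a using TensorProduct.induction_on with
  | zero => rw [UniformSpace.Completion.coe_zero]; exact hzero
  | tmul x y => exact hpure x y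
  | add x y hx hy => rw [UniformSpace.Completion.coe_add]; exact hadd _ _ hx hy

theorem hilbertTensor_ext {F : Type*} [NormedAddCommGroup F] [NormedSpace ℂ F]
    {A B : HilbertTensor H K →L[ℂ] F} (h : ∀ x y, A (pureTensor x y) = B (pureTensor x y)) :
    A = B := by
  ext z
  exact hilbertTensor_induction z (isClosed_eq A.continuous B.continuous) (by simp only [map_zero])
    (fun x y hx hy => by rw [map_add, map_add, hx, hy]) h

/-- The bounded operator `A ⊗ B` between Hilbert space tensor products. -/
noncomputable def tensorMap (A : H →L[ℂ] H') (B : K →L[ℂ] K') :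
    HilbertTensor H K →L[ℂ] HilbertTensor H' K' :=
  (TensorProduct.mapL A B).completion

theorem tensorOp_eq_tensorMap (A : H →L[ℂ] H) (B : K →L[ℂ] K) : tensorOp A B = tensorMap A B :=
  rfl

@[simp]
theorem tensorMap_pureTensor (A : H →L[ℂ] H') (B : K →L[ℂ] K') (h : H) (k : K) :
    tensorMap A B (pureTensor h k) = pureTensor (A h) (B k) := by
  rw [pureTensor_apply, tensorMap, ContinuousLinearMap.completion_apply_coe,
    TensorProduct.mapL_tmul, pureTensor_apply]

theorem norm_tensorMap_le (A : H →L[ℂ] H') (B : K →L[ℂ] K') : ‖tensorMap A B‖ ≤ ‖A‖ * ‖B‖ := by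
  refine ContinuousLinearMap.opNorm_le_bound _ (by positivity) fun z => ?_
  induction z using UniformSpace.Completion.induction_on with
  | hp => exact isClosed_le (by fun_prop) (by fun_prop)
  | ih a =>
    rw [tensorMap, ContinuousLinearMap.completion_apply_coe, UniformSpace.Completion.norm_coe,
      UniformSpace.Completion.norm_coe]
    exact ContinuousLinearMap.le_of_opNorm_le _ (TensorProduct.norm_mapL_le A B) a

theorem isBoundedBilinearMap_tensorMap :
    IsBoundedBilinearMap ℂ fun p : (H →L[ℂ] H') × (K →L[ℂ] K') => tensorMap p.1 p.2 where
  add_left A A' B := hilbertTensor_ext fun x y => by simp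
  smul_left c A B := hilbertTensor_ext fun x y => by simp
  add_right A B B' := hilbertTensor_ext fun x y => by simp
  smul_right c A B := hilbertTensor_ext fun x y => by simp
  bound := ⟨1, one_pos, fun A B => (one_mul ‖A‖).symm ▸ norm_tensorMap_le A B⟩

theorem tensorMap_zero_left (B : K →L[ℂ] K') : tensorMap (0 : H →L[ℂ] H') B = 0 :=
  (isBoundedBilinearMap_tensorMap.isBoundedLinearMap_left B).map_zero

theorem tensorMap_zero_right (A : H →L[ℂ] H') : tensorMap A (0 : K →L[ℂ] K') = 0 :=
  (isBoundedBilinearMap_tensorMap.isBoundedLinearMap_right A).map_zero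

theorem tensorMap_smul_left (c : ℂ) (A : H →L[ℂ] H') (B : K →L[ℂ] K') :
    tensorMap (c • A) B = c • tensorMap A B :=
  isBoundedBilinearMap_tensorMap.smul_left c A B

theorem tensorMap_sum_left {ι : Type*} (s : Finset ι) (A : ι → (H →L[ℂ] H')) (B : K →L[ℂ] K') :
    tensorMap (∑ i ∈ s, A i) B = ∑ i ∈ s, tensorMap (A i) B :=
  map_sum (isBoundedBilinearMap_tensorMap.isBoundedLinearMap_left B).toContinuousLinearMap A s

theorem norm_tensorMap_id_le {A : H →L[ℂ] H'} (hA : ‖A‖ ≤ 1) :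
    ‖tensorMap A (ContinuousLinearMap.id ℂ K)‖ ≤ 1 :=
  (norm_tensorMap_le _ _).trans
    (mul_le_one₀ hA (norm_nonneg _) ContinuousLinearMap.norm_id_le)

theorem tensorMap_comp (A : H' →L[ℂ] H'') (B : K' →L[ℂ] K'') (A' : H →L[ℂ] H') (B' : K →L[ℂ] K') :
    tensorMap (A ∘L A') (B ∘L B') = tensorMap A B ∘L tensorMap A' B' :=
  hilbertTensor_ext fun x y => by simp

theorem adjoint_tensorMap [CompleteSpace H] [CompleteSpace H'] [CompleteSpace K] [CompleteSpace K']
    (A : H →L[ℂ] H') (B : K →L[ℂ] K') : (tensorMap A B)† = tensorMap (A†) (B†) := by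
  refine hilbertTensor_ext fun x y => ext_inner_right ℂ fun z => ?_
  refine hilbertTensor_induction z (isClosed_eq (by fun_prop) (by fun_prop)) (by simp)
    (fun a b ha hb => by rw [inner_add_right, inner_add_right, ha, hb]) fun h k => ?_
  simp only [ContinuousLinearMap.adjoint_inner_left, tensorMap_pureTensor, inner_pureTensor]

theorem tensorMap_rankOne (x : H') (y : H) (x' : K') (y' : K) :
    tensorMap (InnerProductSpace.rankOne ℂ x y) (InnerProductSpace.rankOne ℂ x' y') =
      InnerProductSpace.rankOne ℂ (pureTensor x x') (pureTensor y y') :=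
  hilbertTensor_ext fun h k => by simp [inner_pureTensor, smul_smul, mul_comm]

end Tensor

section StrongConvergence

variable {H H' K : Type*} [NormedAddCommGroup H] [InnerProductSpace ℂ H]
  [NormedAddCommGroup H'] [InnerProductSpace ℂ H'] [NormedAddCommGroup K] [InnerProductSpace ℂ K]
  {ι : Type*} {l : Filter ι}

theorem equicontinuous_of_norm_le_one {P : ι → (H →L[ℂ] H')} (hP : ∀ i, ‖P i‖ ≤ 1) :
    Equicontinuous fun i => ⇑(P i) :=
  (LipschitzWith.uniformEquicontinuous _ 1 fun i =>
    (P i).lipschitz.weaken (hP i)).equicontinuous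

theorem tendsto_tensorMap_id {P : ι → (H →L[ℂ] H)} (hP : ∀ i, ‖P i‖ ≤ 1)
    (hlim : ∀ x, Tendsto (fun i => P i x) l (nhds x)) (z : HilbertTensor H K) :
    Tendsto (fun i => tensorMap (P i) (ContinuousLinearMap.id ℂ K) z) l (nhds z) := by
  refine hilbertTensor_induction
    (p := fun z => Tendsto (fun i => tensorMap (P i) (ContinuousLinearMap.id ℂ K) z) l (nhds z)) z
    ?_ ?_ (fun x y hx hy => ?_) fun h k => ?_
  · exact (equicontinuous_of_norm_le_one fun i =>
      norm_tensorMap_id_le (hP i)).isClosed_setOfPred_tendsto continuous_id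
  · simp only [map_zero, tendsto_const_nhds]
  · simpa only [map_add] using hx.add hy
  · simp only [tensorMap_pureTensor, ContinuousLinearMap.id_apply]
    exact (((pureTensor (H := H) (K := K)).flip k).continuous.tendsto h).comp (hlim h)

theorem tendsto_comp_of_isCompactOperator {P : ι → (H' →L[ℂ] H')} (hP : ∀ i, ‖P i‖ ≤ 1)
    (hlim : ∀ x, Tendsto (fun i => P i x) l (nhds x)) {A : H →L[ℂ] H'}
    (hA : IsCompactOperator A) : Tendsto (fun i => P i ∘L A) l (nhds A) := by
  rw [Metric.tendsto_nhds]
  intro ε hε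
  have htotallyBounded : TotallyBounded (A '' Metric.closedBall 0 1) :=
    (hA.isCompact_closure_image_closedBall (f := (A : H →ₗ[ℂ] H')) 1).totallyBounded.subset
      subset_closure
  obtain ⟨t, ht, hcover⟩ := Metric.totallyBounded_iff.1 htotallyBounded (ε / 6) (by positivity)
  have hev : ∀ᶠ i in l, ∀ z ∈ t, dist (P i z) z < ε / 6 :=
    ht.eventually_all.2 fun z _ => Metric.tendsto_nhds.1 (hlim z) _ (by positivity)
  filter_upwards [hev] with i hi
  rw [dist_eq_norm]
  refine lt_of_le_of_lt (b := ε / 2) ?_ (by linarith)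
  refine ContinuousLinearMap.opNorm_le_of_unit_norm (by positivity) fun x hx => ?_
  obtain ⟨z, hz, hxz⟩ : ∃ z ∈ t, dist (A x) z < ε / 6 := by
    simpa using hcover ⟨x, by simp [hx], rfl⟩
  calc ‖P i (A x) - A x‖ = dist (P i (A x)) (A x) := (dist_eq_norm _ _).symm
    _ ≤ dist (P i (A x)) (P i z) + dist (P i z) z + dist z (A x) := dist_triangle4 _ _ _ _
    _ ≤ dist (A x) z + dist (P i z) z + dist z (A x) := by
        gcongr
        simpa only [NNReal.coe_one, one_mul] using
          ((P i).lipschitz.weaken (K' := 1) (hP i)).dist_le_mul (A x) z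
    _ ≤ ε / 2 := by
        rw [dist_comm z]
        linarith [hi z hz]

end StrongConvergence

section CompactTensor

variable {H H' K : Type*} [NormedAddCommGroup H] [InnerProductSpace ℂ H]
  [NormedAddCommGroup H'] [InnerProductSpace ℂ H'] [NormedAddCommGroup K] [InnerProductSpace ℂ K]

theorem norm_sum_rankOne_self_le {ι : Type*} {b : ι → H} (hb : Orthonormal ℂ b) (s : Finset ι) :
    ‖∑ i ∈ s, InnerProductSpace.rankOne ℂ (b i) (b i)‖ ≤ 1 := by
  refine ContinuousLinearMap.opNorm_le_bound _ zero_le_one fun x => ?_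
  rw [one_mul]
  refine le_of_sq_le_sq ?_ (norm_nonneg x)
  have hpythagoras := hb.orthogonalFamily.norm_sum (fun i => ⟪b i, x⟫_ℂ) s
  simp only [LinearIsometry.toSpanSingleton_apply] at hpythagoras
  simpa [hpythagoras] using hb.sum_inner_products_le x

theorem tendsto_sum_rankOne_self {ι : Type*} (b : HilbertBasis ι ℂ H) (x : H) :
    Tendsto (fun s : Finset ι => (∑ i ∈ s, InnerProductSpace.rankOne ℂ (b i) (b i)) x) atTop
      (nhds x) := by
  simpa [HasSum, b.repr_apply_apply] using b.hasSum_repr x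

theorem isCompactOperator_induction [CompleteSpace H] {A : H →L[ℂ] H} (hA : IsCompactOperator A)
    {p : (H →L[ℂ] H) → Prop} (hclosed : IsClosed {A | p A}) (hzero : p 0)
    (hadd : ∀ A B, p A → p B → p (A + B))
    (hrank : ∀ x y, p (InnerProductSpace.rankOne ℂ x y)) : p A := by
  classical
  obtain ⟨w, b, -⟩ := exists_hilbertBasis ℂ H
  refine hclosed.mem_of_tendsto (tendsto_comp_of_isCompactOperator
    (norm_sum_rankOne_self_le b.orthonormal) (tendsto_sum_rankOne_self b) hA)
    (Eventually.of_forall fun s => ?_)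
  change p _
  rw [ContinuousLinearMap.finsetSum_comp]
  exact Finset.sum_induction _ p hadd hzero fun i _ =>
    InnerProductSpace.rankOne_comp (b i) (b i) A ▸ hrank _ _

theorem isCompactOperator_tensorMap [CompleteSpace H] [CompleteSpace K] {A : H →L[ℂ] H}
    {B : K →L[ℂ] K} (hA : IsCompactOperator A) (hB : IsCompactOperator B) :
    IsCompactOperator (tensorMap A B) := by
  have hclosed : IsClosed {T : HilbertTensor H K →L[ℂ] HilbertTensor H K | IsCompactOperator T} :=
    isClosed_setOfPred_isCompactOperator
  have hbilin := isBoundedBilinearMap_tensorMap (H := H) (H' := H) (K := K) (K' := K)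
  refine isCompactOperator_induction hA (p := fun A => IsCompactOperator (tensorMap A B))
    (hclosed.preimage hbilin.continuous_left) ?_ (fun A A' h h' => ?_) fun x y => ?_
  · rw [tensorMap_zero_left]
    exact isCompactOperator_zero
  · exact hbilin.add_left A A' B ▸ h.add h'
  refine isCompactOperator_induction hB
    (p := fun B => IsCompactOperator (tensorMap (InnerProductSpace.rankOne ℂ x y) B))
    (hclosed.preimage hbilin.continuous_right) ?_ (fun B B' h h' => ?_) fun x' y' => ?_
  · rw [tensorMap_zero_right]
    exact isCompactOperator_zero
  · exact hbilin.add_right _ B B' ▸ h.add h'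
  · simpa only [tensorMap_rankOne] using isCompactOperator_rankOne _ _

end CompactTensor

section WeakIntegral

variable {L Ω : Type*} [NormedAddCommGroup L] [InnerProductSpace ℂ L] [MeasurableSpace Ω]

/-- `T` is the integral of the family `S` of operators in the weak operator topology. -/
def IsWeakIntegral (m : Measure Ω) (S : Ω → (L →L[ℂ] L)) (T : L →L[ℂ] L) : Prop :=
  ∀ x y, Integrable (fun ω => ⟪x, S ω y⟫_ℂ) m ∧ ∫ ω, ⟪x, S ω y⟫_ℂ ∂m = ⟪x, T y⟫_ℂ

theorem IsWeakIntegral.sum {m : Measure Ω} {ι : Type*} (s : Finset ι) {S : ι → Ω → (L →L[ℂ] L)}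
    {T : ι → (L →L[ℂ] L)} (h : ∀ i, IsWeakIntegral m (S i) (T i)) :
    IsWeakIntegral m (fun ω => ∑ i ∈ s, S i ω) (∑ i ∈ s, T i) := by
  intro x y
  simp only [sum_apply, inner_sum]
  refine ⟨integrable_finsetSum _ fun i _ => (h i x y).1, ?_⟩
  rw [integral_finsetSum _ fun i _ => (h i x y).1]
  exact Finset.sum_congr rfl fun i _ => (h i x y).2

theorem isClosed_setOf_integrable_and_integral_eq {Z : Type*} [TopologicalSpace Z]
    [FirstCountableTopology Z] {m : Measure Ω} [IsFiniteMeasure m] {F : Z → Ω → ℂ} {g : Z → ℂ}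
    {c : Z → ℝ} (hF : ∀ ω, Continuous fun z => F z ω) (hc : Continuous c)
    (hFc : ∀ z ω, ‖F z ω‖ ≤ c z) (hg : Continuous g) :
    IsClosed {z | Integrable (F z) m ∧ ∫ ω, F z ω ∂m = g z} := by
  refine isClosed_of_closure_subset fun z hz => ?_
  obtain ⟨u, hu, hlim⟩ := mem_closure_iff_seq_limit.1 hz
  have hFlim : ∀ᵐ ω ∂m, Tendsto (fun n => F (u n) ω) atTop (nhds (F z ω)) :=
    Eventually.of_forall fun ω => ((hF ω).tendsto z).comp hlim
  have hmeas (n : ℕ) : AEStronglyMeasurable (F (u n)) m := (hu n).1.aestronglyMeasurable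
  refine ⟨.of_bound (aestronglyMeasurable_of_tendsto_ae atTop hmeas hFlim) _
    (Eventually.of_forall (hFc z)), ?_⟩
  have hbound : ∀ᶠ n in atTop, ∀ᵐ ω ∂m, ‖F (u n) ω‖ ≤ c z + 1 :=
    (((hc.tendsto z).comp hlim).eventually_lt_const (lt_add_one _)).mono
      fun n hn => Eventually.of_forall fun ω => (hFc (u n) ω).trans hn.le
  have hintegral := tendsto_integral_filter_of_dominated_convergence (fun _ => c z + 1)
    (Eventually.of_forall hmeas) hbound (integrable_const _) hFlim
  exact tendsto_nhds_unique hintegral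
    (((hg.tendsto z).comp hlim).congr fun n => (hu n).2.symm)

theorem IsWeakIntegral.tensorMap {H K : Type*} [NormedAddCommGroup H] [InnerProductSpace ℂ H]
    [NormedAddCommGroup K] [InnerProductSpace ℂ K] {m : Measure Ω} [IsFiniteMeasure m]
    {S : Ω → (H →L[ℂ] H)} {T : H →L[ℂ] H} (h : IsWeakIntegral m S T) {M : ℝ}
    (hM : ∀ ω, ‖S ω‖ ≤ M) (B : K →L[ℂ] K) :
    IsWeakIntegral m (fun ω => tensorMap (S ω) B) (tensorMap T B) := by
  have hbound (ω : Ω) (x y : HilbertTensor H K) :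
      ‖⟪x, SchurAP.tensorMap (S ω) B y⟫_ℂ‖ ≤ ‖x‖ * (M * ‖B‖ * ‖y‖) := by
    have hnorm : ‖SchurAP.tensorMap (S ω) B‖ ≤ M * ‖B‖ :=
      (norm_tensorMap_le _ _).trans (by gcongr; exact hM ω)
    exact (norm_inner_le_norm _ _).trans <|
      mul_le_mul_of_nonneg_left (ContinuousLinearMap.le_of_opNorm_le _ hnorm y) (norm_nonneg x)
  intro x y
  refine hilbertTensor_induction x (isClosed_setOf_integrable_and_integral_eq
    (g := fun z => ⟪z, SchurAP.tensorMap T B y⟫_ℂ) (by fun_prop) (by fun_prop)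
    (fun z ω => hbound ω z y) (by fun_prop)) (by simp) (fun a b ha hb => ?_)
    fun a b => ?_
  · simp only [inner_add_left]
    exact ⟨ha.1.add hb.1, by rw [integral_add ha.1 hb.1, ha.2, hb.2]⟩
  refine hilbertTensor_induction y (isClosed_setOf_integrable_and_integral_eq
    (g := fun z => ⟪pureTensor a b, SchurAP.tensorMap T B z⟫_ℂ) (by fun_prop) (by fun_prop)
    (fun z ω => hbound ω _ z) (by fun_prop)) (by simp) (fun c d hc hd => ?_)
    fun c d => ?_
  · simp only [map_add, inner_add_right]
    exact ⟨hc.1.add hd.1, by rw [integral_add hc.1 hd.1, hc.2, hd.2]⟩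
  simp only [tensorMap_pureTensor, inner_pureTensor]
  exact ⟨(h a c).1.mul_const _, by rw [integral_mul_const, (h a c).2]⟩

theorem exists_isWeakIntegral [CompleteSpace L] {m : Measure Ω} [IsFiniteMeasure m]
    {S : Ω → (L →L[ℂ] L)} (hS : ∀ x y, AEStronglyMeasurable (fun ω => ⟪x, S ω y⟫_ℂ) m) {M : ℝ}
    (hM : ∀ ω, ‖S ω‖ ≤ M) : ∃ T, IsWeakIntegral m S T := by
  have hbound : ∀ x y ω, ‖⟪x, S ω y⟫_ℂ‖ ≤ ‖x‖ * (M * ‖y‖) := fun x y ω =>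
    (norm_inner_le_norm _ _).trans (by gcongr; exact (S ω).le_of_opNorm_le (hM ω) y)
  have hint : ∀ x y, Integrable (fun ω => ⟪x, S ω y⟫_ℂ) m := fun x y =>
    .of_bound (hS x y) _ (.of_forall (hbound x y))
  let b : L →L⋆[ℂ] L →L[ℂ] ℂ := LinearMap.mkContinuous₂
    (LinearMap.mk₂'ₛₗ (starRingEnd ℂ) (RingHom.id ℂ) (fun x y => ∫ ω, ⟪x, S ω y⟫_ℂ ∂m)
      (fun x x' y => by
        simp only [inner_add_left]
        exact integral_add (hint x y) (hint x' y))
      (fun c x y => by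
        simp only [inner_smul_left]
        exact integral_const_mul _ _)
      (fun x y y' => by
        simp only [map_add, inner_add_right]
        exact integral_add (hint x y) (hint x y'))
      (fun c x y => by
        simp only [map_smul, inner_smul_right]
        exact integral_const_mul _ _)) (M * m.real Set.univ) fun x y =>
    (norm_integral_le_of_norm_le_const (.of_forall (hbound x y))).trans_eq (by ring)
  refine ⟨(InnerProductSpace.continuousLinearMapOfBilin b)†, fun x y => ⟨hint x y, ?_⟩⟩
  rw [ContinuousLinearMap.adjoint_inner_right,
    InnerProductSpace.continuousLinearMapOfBilin_apply]
  rfl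

end WeakIntegral

/-! ### Kernels and transference of Schur multipliers -/

section SquareIntegrable

variable {X F : Type*} [MeasurableSpace X] [NormedAddCommGroup F] {μ : Measure X}

theorem eLpNorm_two_sq (μ : Measure X) (f : X → F) :
    eLpNorm f 2 μ ^ 2 = ∫⁻ x, ‖f x‖ₑ ^ 2 ∂μ := by
  simpa using eLpNorm_nnreal_pow_eq_lintegral (μ := μ) (f := f) (p := 2) (by norm_num)

theorem memLp_two_iff_lintegral_enorm_sq_lt_top {f : X → F} (hf : AEStronglyMeasurable f μ) :
    MemLp f 2 μ ↔ ∫⁻ x, ‖f x‖ₑ ^ 2 ∂μ < ∞ := by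
  rw [← eLpNorm_two_sq, ENNReal.pow_lt_top_iff, or_iff_left two_ne_zero]
  exact ⟨fun h => h.2, fun h => ⟨hf, h⟩⟩

theorem enorm_Lp_sq (f : Lp F 2 μ) : ‖f‖ₑ ^ 2 = ∫⁻ x, ‖f x‖ₑ ^ 2 ∂μ := by
  rw [Lp.enorm_def, eLpNorm_two_sq]

theorem inner_toLp_left {f : X → ℂ} (hf : MemLp f 2 μ) (ξ : Lp ℂ 2 μ) :
    ⟪hf.toLp f, ξ⟫_ℂ = ∫ x, conj (f x) * ξ x ∂μ := by
  rw [L2.inner_def]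
  refine integral_congr_ae ?_
  filter_upwards [hf.coeFn_toLp] with x hx
  rw [hx, RCLike.inner_apply, mul_comm]

theorem memLp_two_mul_prod [SFinite μ] {f g : X → ℂ} (hf : MemLp f 2 μ) (hg : MemLp g 2 μ) :
    MemLp (fun z : X × X => f z.1 * g z.2) 2 (μ.prod μ) := by
  refine (memLp_two_iff_lintegral_enorm_sq_lt_top (hf.1.comp_fst.mul hg.1.comp_snd)).2 ?_
  simp only [Pi.mul_apply, enorm_mul, mul_pow]
  rw [lintegral_prod_mul (hf.1.enorm.pow_const 2) (hg.1.enorm.pow_const 2), ← eLpNorm_two_sq,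
    ← eLpNorm_two_sq]
  exact ENNReal.mul_lt_top (ENNReal.pow_lt_top hf.2) (ENNReal.pow_lt_top hg.2)

end SquareIntegrable

section Kernels

variable {X : Type u} [MeasurableSpace X] {μ : Measure X} [SFinite μ] {k : X × X → ℂ}

theorem aemeasurable_lintegral_section_sq (hk : AEStronglyMeasurable k (μ.prod μ)) :
    AEMeasurable (fun x => ∫⁻ y, ‖k (x, y)‖ₑ ^ 2 ∂μ) μ :=
  (hk.enorm.pow_const 2).lintegral_prod_right'

theorem lintegral_section_sq (hk : AEStronglyMeasurable k (μ.prod μ)) :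
    ∫⁻ x, ∫⁻ y, ‖k (x, y)‖ₑ ^ 2 ∂μ ∂μ = eLpNorm k 2 (μ.prod μ) ^ 2 := by
  rw [eLpNorm_two_sq, lintegral_prod (fun z : X × X => ‖k z‖ₑ ^ 2) (hk.enorm.pow_const 2)]

theorem ae_exists_integral_section_eq_inner (hk : MemLp k 2 (μ.prod μ)) :
    ∀ᵐ x ∂μ, ∃ v : Lp ℂ 2 μ, (∀ ξ : Lp ℂ 2 μ, ∫ y, k (x, y) * ξ y ∂μ = ⟪v, ξ⟫_ℂ) ∧
      ‖v‖ₑ ^ 2 = ∫⁻ y, ‖k (x, y)‖ₑ ^ 2 ∂μ := by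
  have hfinite : ∫⁻ x, ∫⁻ y, ‖k (x, y)‖ₑ ^ 2 ∂μ ∂μ ≠ ∞ :=
    lintegral_section_sq hk.1 ▸ ENNReal.pow_ne_top hk.2.ne
  filter_upwards [hk.1.prodMk_left, ae_lt_top' (aemeasurable_lintegral_section_sq hk.1) hfinite]
    with x hmeas hlt
  have hx : MemLp (fun y => conj (k (x, y))) 2 μ := by
    rw [memLp_two_iff_lintegral_enorm_sq_lt_top
      (RCLike.continuous_conj.comp_aestronglyMeasurable hmeas)]
    simpa only [RCLike.enorm_conj] using hlt
  refine ⟨hx.toLp _, fun ξ => ?_, ?_⟩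
  · simp only [inner_toLp_left, RCLike.conj_conj]
  · simp only [Lp.enorm_toLp, eLpNorm_two_sq, RCLike.enorm_conj]

theorem eLpNorm_kernel_apply_le (hk : MemLp k 2 (μ.prod μ)) (ξ : Lp ℂ 2 μ) :
    eLpNorm (fun x => ∫ y, k (x, y) * ξ y ∂μ) 2 μ ≤ eLpNorm k 2 (μ.prod μ) * ‖ξ‖ₑ := by
  rw [← ENNReal.pow_le_pow_left_iff two_ne_zero, eLpNorm_two_sq, mul_pow,
    ← lintegral_section_sq hk.1, ← lintegral_mul_const'' _ (aemeasurable_lintegral_section_sq hk.1)]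
  refine lintegral_mono_ae ?_
  filter_upwards [ae_exists_integral_section_eq_inner hk] with x ⟨v, hv, hnorm⟩
  rw [hv, ← hnorm, ← mul_pow]
  gcongr
  simp only [← ofReal_norm, ← ENNReal.ofReal_mul (norm_nonneg _)]
  exact ENNReal.ofReal_le_ofReal (norm_inner_le_norm _ _)

theorem memLp_kernel_apply (hk : MemLp k 2 (μ.prod μ)) (ξ : Lp ℂ 2 μ) :
    MemLp (fun x => ∫ y, k (x, y) * ξ y ∂μ) 2 μ :=
  ⟨(hk.1.mul (Lp.aestronglyMeasurable ξ).comp_snd).integral_prod_right',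
    (eLpNorm_kernel_apply_le hk ξ).trans_lt (ENNReal.mul_lt_top hk.2 enorm_lt_top)⟩

theorem exists_isKernelOf (hk : MemLp k 2 (μ.prod μ)) :
    ∃ A : Lp ℂ 2 μ →L[ℂ] Lp ℂ 2 μ, IsKernelOf μ k A ∧ ‖A‖ ≤ (eLpNorm k 2 (μ.prod μ)).toReal := by
  let A₀ : Lp ℂ 2 μ →ₗ[ℂ] Lp ℂ 2 μ :=
    { toFun := fun ξ => (memLp_kernel_apply hk ξ).toLp _
      map_add' := fun ξ η => by
        rw [← MemLp.toLp_add, MemLp.toLp_eq_toLp_iff]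
        filter_upwards [ae_exists_integral_section_eq_inner hk] with x ⟨v, hv, _⟩
        rw [Pi.add_apply, hv, hv, hv, inner_add_right]
      map_smul' := fun c ξ => by
        rw [RingHom.id_apply, ← MemLp.toLp_const_smul, MemLp.toLp_eq_toLp_iff]
        filter_upwards [ae_exists_integral_section_eq_inner hk] with x ⟨v, hv, _⟩
        rw [Pi.smul_apply, hv, hv, inner_smul_right, smul_eq_mul] }
  have hbound (ξ : Lp ℂ 2 μ) : ‖A₀ ξ‖ ≤ (eLpNorm k 2 (μ.prod μ)).toReal * ‖ξ‖ := by
    change ‖(memLp_kernel_apply hk ξ).toLp _‖ ≤ _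
    rw [Lp.norm_toLp, ← toReal_enorm ξ, ← ENNReal.toReal_mul]
    exact ENNReal.toReal_mono (ENNReal.mul_ne_top hk.2.ne enorm_ne_top)
      (eLpNorm_kernel_apply_le hk ξ)
  exact ⟨A₀.mkContinuous _ hbound, ⟨hk, fun ξ => (memLp_kernel_apply hk ξ).coeFn_toLp⟩,
    LinearMap.mkContinuous_norm_le _ ENNReal.toReal_nonneg _⟩

theorem IsKernelOf.isCompactOperator {A : Lp ℂ 2 μ →L[ℂ] Lp ℂ 2 μ} (h : IsKernelOf μ k A) :
    IsCompactOperator A := by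
  obtain ⟨w, b, -⟩ := exists_hilbertBasis ℂ (Lp ℂ 2 μ)
  refine isCompactOperator_of_tsum_enorm_sq_ne_top b A
    (ne_top_of_le_ne_top (ENNReal.pow_ne_top (n := 2) h.1.2.ne) ?_)
  rw [ENNReal.tsum_eq_iSup_sum]
  refine iSup_le fun s => ?_
  rw [← lintegral_section_sq h.1.1]
  simp_rw [enorm_Lp_sq]
  rw [← lintegral_finsetSum' _ fun i _ => (Lp.aestronglyMeasurable _).enorm.pow_const 2]
  refine lintegral_mono_ae ?_
  have happly : ∀ᵐ x ∂μ, ∀ i ∈ s, A (b i) x = ∫ y, k (x, y) * b i y ∂μ :=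
    (Finset.eventually_all s).2 fun i _ => h.2 (b i)
  filter_upwards [ae_exists_integral_section_eq_inner h.1, happly] with x ⟨v, hv, hnorm⟩ hx
  calc ∑ i ∈ s, ‖A (b i) x‖ₑ ^ 2 = ∑ i ∈ s, ‖⟪b i, v⟫_ℂ‖ₑ ^ 2 := by
        refine Finset.sum_congr rfl fun i hi => ?_
        rw [hx i hi, hv, ← inner_conj_symm, RCLike.enorm_conj]
    _ ≤ ‖v‖ₑ ^ 2 := sum_enorm_inner_sq_le b.orthonormal s v
    _ = ∫⁻ y, ‖k (x, y)‖ₑ ^ 2 ∂μ := hnorm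

theorem integrable_conj_mul_kernel_mul (hk : MemLp k 2 (μ.prod μ)) (ξ η : Lp ℂ 2 μ) :
    Integrable (fun z : X × X => conj (ξ z.1) * k z * η z.2) (μ.prod μ) := by
  refine (hk.integrable_mul (memLp_two_mul_prod (Lp.memLp ξ).star (Lp.memLp η))).congr
    (Eventually.of_forall fun z => ?_)
  simp [mul_comm, mul_left_comm]

theorem IsKernelOf.inner_eq {A : Lp ℂ 2 μ →L[ℂ] Lp ℂ 2 μ} (h : IsKernelOf μ k A)
    (ξ η : Lp ℂ 2 μ) :
    ⟪ξ, A η⟫_ℂ = ∫ z : X × X, conj (ξ z.1) * k z * η z.2 ∂(μ.prod μ) := by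
  rw [integral_prod _ (integrable_conj_mul_kernel_mul h.1 ξ η), L2.inner_def]
  refine integral_congr_ae ?_
  filter_upwards [h.2 η] with x hx
  rw [hx, RCLike.inner_apply, mul_comm, ← integral_const_mul]
  simp only [mul_assoc]

theorem isKernelOf_rankOne (ξ η : Lp ℂ 2 μ) :
    IsKernelOf μ (fun z => ξ z.1 * conj (η z.2)) (InnerProductSpace.rankOne ℂ ξ η) := by
  refine ⟨memLp_two_mul_prod (Lp.memLp ξ) (Lp.memLp η).star, fun ζ => ?_⟩
  rw [InnerProductSpace.rankOne_apply]
  filter_upwards [Lp.coeFn_smul ⟪η, ζ⟫_ℂ ξ] with x hx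
  rw [hx, Pi.smul_apply, L2.inner_def, smul_eq_mul, ← integral_mul_const]
  refine integral_congr_ae (Eventually.of_forall fun y => ?_)
  simp only [RCLike.inner_apply]
  ring

end Kernels

section Multipliers

variable {X : Type u} [MeasurableSpace X] {μ : Measure X} {p : ℝ≥0∞} {φ : X × X → ℂ} {C C' : ℝ≥0}

theorem IsKernelOf.const_smul {k : X × X → ℂ} {A : Lp ℂ 2 μ →L[ℂ] Lp ℂ 2 μ}
    (h : IsKernelOf μ k A) (c : ℂ) : IsKernelOf μ (fun z => c * k z) (c • A) := by
  refine ⟨h.1.const_mul c, fun ξ => ?_⟩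
  rw [smul_apply]
  filter_upwards [Lp.coeFn_smul c (A ξ), h.2 ξ] with x hsmul hA
  rw [hsmul, Pi.smul_apply, hA, smul_eq_mul, ← integral_const_mul]
  simp only [mul_assoc]

theorem IsCBSchurBound.mono (h : IsCBSchurBound p μ φ C) (hC : C ≤ C') :
    IsCBSchurBound p μ φ C' :=
  ⟨h.1, fun K _ _ _ n A A' B hA hA' hB => (h.2 K n A A' B hA hA' hB).trans (by gcongr)⟩

theorem IsCBSchurBound.bound_sum (h : IsCBSchurBound p μ φ C) {K : Type u}
    [NormedAddCommGroup K] [InnerProductSpace ℂ K] [CompleteSpace K] {ι : Type*} (s : Finset ι)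
    {A A' : ι → (Lp ℂ 2 μ →L[ℂ] Lp ℂ 2 μ)} {B : ι → (K →L[ℂ] K)} (hA : ∀ i, MemSchatten p (A i))
    (hA' : ∀ i, IsSchurImage μ φ (A i) (A' i)) (hB : ∀ i, MemSchatten p (B i)) :
    schattenNorm p (∑ i ∈ s, tensorMap (A' i) (B i)) ≤
      C * schattenNorm p (∑ i ∈ s, tensorMap (A i) (B i)) := by
  have hbound := h.2 K s.card (fun j => A (s.equivFin.symm j)) (fun j => A' (s.equivFin.symm j))
    (fun j => B (s.equivFin.symm j)) (fun _ => hA _) (fun _ => hA' _) fun _ => hB _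
  simp only [tensorOp_eq_tensorMap] at hbound
  rwa [s.equivFin.symm.sum_comp fun i => tensorMap (A' i) (B i),
    s.equivFin.symm.sum_comp fun i => tensorMap (A i) (B i),
    Finset.sum_coe_sort s fun i => tensorMap (A' i) (B i),
    Finset.sum_coe_sort s fun i => tensorMap (A i) (B i)] at hbound

theorem cbSchurNorm_le_iff :
    cbSchurNorm p μ φ ≤ C ↔ ∀ C' : ℝ≥0, C < C' → IsCBSchurBound p μ φ C' := by
  constructor
  · intro h C' hC
    have hlt : cbSchurNorm p μ φ < C' := h.trans_lt (ENNReal.coe_lt_coe.2 hC)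
    simp only [cbSchurNorm, iInf_lt_iff] at hlt
    obtain ⟨D, hD, hDC⟩ := hlt
    exact hD.mono (ENNReal.coe_lt_coe.1 hDC).le
  · intro h
    refine ENNReal.le_of_forall_pos_le_add fun ε hε _ => ?_
    exact (iInf₂_le (C + ε) (h (C + ε) (lt_add_of_pos_right _ hε))).trans
      (ENNReal.coe_add C ε).le

end Multipliers

section NormalizedIndicator

variable {X Λ : Type*} [MeasurableSpace X] {μ : Measure X} {S : Λ → Set X} {a : ℝ}

/-- The unit vector `a^{-1/2} 1_{S γ}` of `L²(X, μ)`, where each set `S γ` has measure `a`. -/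
noncomputable def normalizedIndicator (hS : ∀ γ, MeasurableSet (S γ))
    (hμ : ∀ γ, μ (S γ) = ENNReal.ofReal a) (γ : Λ) : Lp ℂ 2 μ :=
  indicatorConstLp 2 (hS γ) (hμ γ ▸ ENNReal.ofReal_ne_top) (√a : ℂ)⁻¹

theorem normalizedIndicator_ae_eq (hS : ∀ γ, MeasurableSet (S γ))
    (hμ : ∀ γ, μ (S γ) = ENNReal.ofReal a) (γ : Λ) :
    normalizedIndicator hS hμ γ =ᵐ[μ] (S γ).indicator fun _ => (√a : ℂ)⁻¹ :=
  indicatorConstLp_coeFn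

theorem conj_mul_normalizedIndicator_ae_eq [DecidableEq Λ] (ha : 0 ≤ a)
    (hS : ∀ γ, MeasurableSet (S γ)) (hμ : ∀ γ, μ (S γ) = ENNReal.ofReal a)
    (hd : Pairwise (Function.onFun Disjoint S)) (γ γ' : Λ) :
    (fun x => conj (normalizedIndicator hS hμ γ x) * normalizedIndicator hS hμ γ' x) =ᵐ[μ]
      if γ = γ' then (S γ).indicator fun _ => (a : ℂ)⁻¹ else 0 := by
  filter_upwards [normalizedIndicator_ae_eq hS hμ γ, normalizedIndicator_ae_eq hS hμ γ']
    with x hx hx'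
  rw [hx, hx']
  split_ifs with h
  · subst h
    by_cases hxS : x ∈ S γ
    · simp only [Set.indicator_of_mem hxS, map_inv₀, Complex.conj_ofReal]
      rw [← mul_inv, ← Complex.ofReal_mul, Real.mul_self_sqrt ha]
    · simp [hxS]
  · by_cases hxS : x ∈ S γ
    · simp [Set.disjoint_left.1 (hd h) hxS]
    · simp [hxS]

theorem orthonormal_normalizedIndicator (ha : 0 < a) (hS : ∀ γ, MeasurableSet (S γ))
    (hμ : ∀ γ, μ (S γ) = ENNReal.ofReal a) (hd : Pairwise (Function.onFun Disjoint S)) :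
    Orthonormal ℂ (normalizedIndicator hS hμ) := by
  classical
  refine orthonormal_iff_ite.2 fun γ γ' => ?_
  simp only [L2.inner_def, RCLike.inner_apply']
  rw [integral_congr_ae (conj_mul_normalizedIndicator_ae_eq ha.le hS hμ hd γ γ')]
  split_ifs
  · rw [integral_indicator_const _ (hS γ), measureReal_def, hμ, ENNReal.toReal_ofReal ha.le,
      Complex.real_smul, mul_inv_cancel₀ (Complex.ofReal_ne_zero.2 ha.ne')]
  · exact integral_zero _ _

end NormalizedIndicator

section PointBasis

variable {Λ : Type u} [MeasurableSpace Λ] {ν : Measure Λ} {c : ℝ}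

theorem eq_of_ae_eq_of_singleton (hc : 0 < c) (hν : ∀ γ, ν {γ} = ENNReal.ofReal c) {Y : Type*}
    {f g : Λ → Y} (h : f =ᵐ[ν] g) : f = g := by
  funext γ
  by_contra hne
  have hnull : ν {γ} = 0 := measure_mono_null (Set.singleton_subset_iff.2 hne) h
  rw [hν, ENNReal.ofReal_eq_zero] at hnull
  exact hc.not_ge hnull

variable [MeasurableSingletonClass Λ]

/-- The unit vector `c^{-1/2} 1_{γ}` of `L²(Λ, ν)`, where `ν` gives mass `c` to each point. -/
noncomputable def pointMass (hν : ∀ γ, ν {γ} = ENNReal.ofReal c) : Λ → Lp ℂ 2 ν :=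
  normalizedIndicator measurableSet_singleton hν

theorem pointMass_apply (hc : 0 < c) (hν : ∀ γ, ν {γ} = ENNReal.ofReal c) (γ : Λ) :
    pointMass hν γ = Set.indicator {γ} fun _ => (√c : ℂ)⁻¹ :=
  eq_of_ae_eq_of_singleton hc hν (normalizedIndicator_ae_eq measurableSet_singleton hν γ)

theorem inner_pointMass (hc : 0 < c) (hν : ∀ γ, ν {γ} = ENNReal.ofReal c) (γ : Λ) (ξ : Lp ℂ 2 ν) :
    ⟪pointMass hν γ, ξ⟫_ℂ = √c * ξ γ := by
  have hsqrt : (√c : ℂ) * √c = c := by rw [← Complex.ofReal_mul, Real.mul_self_sqrt hc.le]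
  have hsqrt_ne : (√c : ℂ) ≠ 0 := Complex.ofReal_ne_zero.2 (Real.sqrt_pos.2 hc).ne'
  rw [pointMass, normalizedIndicator,
    L2.inner_indicatorConstLp_eq_inner_setIntegral ℂ (measurableSet_singleton γ),
    integral_singleton, measureReal_def, hν, ENNReal.toReal_ofReal hc.le, RCLike.inner_apply,
    Complex.real_smul, map_inv₀, Complex.conj_ofReal, ← hsqrt]
  field_simp

theorem orthonormal_pointMass (hc : 0 < c) (hν : ∀ γ, ν {γ} = ENNReal.ofReal c) :
    Orthonormal ℂ (pointMass hν) :=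
  orthonormal_normalizedIndicator hc _ hν fun _ _ => Set.disjoint_singleton.2

theorem orthogonal_span_pointMass (hc : 0 < c) (hν : ∀ γ, ν {γ} = ENNReal.ofReal c) :
    (Submodule.span ℂ (Set.range (pointMass hν)))ᗮ = ⊥ := by
  refine (Submodule.eq_bot_iff _).2 fun ξ hξ => Lp.ext (Eventually.of_forall fun γ => ?_)
  have hinner := (Submodule.mem_orthogonal _ _).1 hξ _ (Submodule.subset_span ⟨γ, rfl⟩)
  rw [inner_pointMass hc] at hinner
  rw [congrFun (eq_of_ae_eq_of_singleton hc hν (Lp.coeFn_zero ℂ 2 ν)) γ]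
  exact (mul_eq_zero.1 hinner).resolve_left
    (Complex.ofReal_ne_zero.2 (Real.sqrt_pos.2 hc).ne')

/-- The Hilbert basis of `L²(Λ, ν)` given by the normalized point masses, where `ν` gives mass `c`
to each point. -/
noncomputable def pointBasis (hc : 0 < c) (hν : ∀ γ, ν {γ} = ENNReal.ofReal c) :
    HilbertBasis Λ ℂ (Lp ℂ 2 ν) :=
  HilbertBasis.mkOfOrthogonalEqBot (orthonormal_pointMass hc hν) (orthogonal_span_pointMass hc hν)

theorem coe_pointBasis (hc : 0 < c) (hν : ∀ γ, ν {γ} = ENNReal.ofReal c) :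
    ⇑(pointBasis hc hν) = pointMass hν :=
  HilbertBasis.coe_mkOfOrthogonalEqBot _ _

theorem inner_pointBasis (hc : 0 < c) (hν : ∀ γ, ν {γ} = ENNReal.ofReal c) (γ : Λ)
    (ξ : Lp ℂ 2 ν) : ⟪pointBasis hc hν γ, ξ⟫_ℂ = √c * ξ γ := by
  rw [coe_pointBasis, inner_pointMass hc]

theorem pointBasis_apply_of_ne (hc : 0 < c) (hν : ∀ γ, ν {γ} = ENNReal.ofReal c) {γ x : Λ}
    (hx : x ≠ γ) : pointBasis hc hν γ x = 0 := by
  rw [coe_pointBasis, pointMass_apply hc, Set.indicator_of_notMem (by simpa using hx)]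

theorem IsSchurImage.inner_eq (hc : 0 < c) (hν : ∀ γ, ν {γ} = ENNReal.ofReal c)
    {φ : Λ × Λ → ℂ} {A A' : Lp ℂ 2 ν →L[ℂ] Lp ℂ 2 ν} (h : IsSchurImage ν φ A A') (γ γ' : Λ) :
    ⟪pointBasis hc hν γ, A' (pointBasis hc hν γ')⟫_ℂ =
      φ (γ, γ') * ⟪pointBasis hc hν γ, A (pointBasis hc hν γ')⟫_ℂ := by
  obtain ⟨k, hk, hk'⟩ := h
  rw [inner_pointBasis, inner_pointBasis,
    congrFun (eq_of_ae_eq_of_singleton hc hν (hk.2 _)) γ,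
    congrFun (eq_of_ae_eq_of_singleton hc hν (hk'.2 _)) γ, mul_left_comm]
  refine congrArg (_ * ·) ?_
  rw [← integral_const_mul]
  refine integral_congr_ae (Eventually.of_forall fun y => ?_)
  rcases eq_or_ne y γ' with rfl | hy
  · exact mul_assoc _ _ _
  · simp only [pointBasis_apply_of_ne hc hν hy, mul_zero]

theorem isSchurImage_rankOne_pointBasis [SFinite ν] (hc : 0 < c)
    (hν : ∀ γ, ν {γ} = ENNReal.ofReal c) (φ : Λ × Λ → ℂ) (γ γ' : Λ) :
    IsSchurImage ν φ (InnerProductSpace.rankOne ℂ (pointBasis hc hν γ) (pointBasis hc hν γ'))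
      (φ (γ, γ') •
        InnerProductSpace.rankOne ℂ (pointBasis hc hν γ) (pointBasis hc hν γ')) := by
  refine ⟨_, isKernelOf_rankOne _ _, ?_⟩
  convert (isKernelOf_rankOne (pointBasis hc hν γ) (pointBasis hc hν γ')).const_smul (φ (γ, γ'))
    using 1
  funext ⟨x, y⟩
  rcases eq_or_ne x γ with rfl | hx
  · rcases eq_or_ne y γ' with rfl | hy
    · rfl
    · simp [pointBasis_apply_of_ne hc hν hy]
  · simp [pointBasis_apply_of_ne hc hν hx]

end PointBasis

section BlockColumn

variable {F H : Type*} [NormedAddCommGroup F] [InnerProductSpace ℂ F]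
  [NormedAddCommGroup H] [InnerProductSpace ℂ H] [CompleteSpace H]

theorem adjoint_pureTensor_pureTensor (x y : F) (k : H) :
    ((pureTensor x)†) (pureTensor y k) = ⟪x, y⟫_ℂ • k := by
  refine ext_inner_left ℂ fun l => ?_
  rw [ContinuousLinearMap.adjoint_inner_right, inner_pureTensor, inner_smul_right]

theorem tensorMap_rankOne_left (x y : F) (B : H →L[ℂ] H) :
    tensorMap (InnerProductSpace.rankOne ℂ x y) B = pureTensor x ∘L B ∘L (pureTensor y)† := by
  refine hilbertTensor_ext fun h k => ?_
  simp only [tensorMap_pureTensor, InnerProductSpace.rankOne_apply, ContinuousLinearMap.comp_apply,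
    adjoint_pureTensor_pureTensor, map_smul, smul_apply]

variable {Λ : Type*} {b : Λ → F} {P : Λ → (H →L[ℂ] H)} {E : Finset Λ}

/-- The block column `∑ γ ∈ E, b γ ⊗ P γ` from `H` to `F ⊗₂ H`. For `b` orthonormal, conjugation by
it turns matrices with entries in the operators on `H` into operators on `H`. -/
noncomputable def blockColumn (b : Λ → F) (P : Λ → (H →L[ℂ] H)) (E : Finset Λ) :
    H →L[ℂ] HilbertTensor F H :=
  ∑ γ ∈ E, pureTensor (b γ) ∘L P γ

theorem adjoint_blockColumn (hP : ∀ γ, IsSelfAdjoint (P γ)) :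
    (blockColumn b P E)† = ∑ γ ∈ E, P γ ∘L (pureTensor (b γ))† := by
  simp only [blockColumn, map_sum, ContinuousLinearMap.adjoint_comp, (hP _).adjoint_eq]

theorem adjoint_blockColumn_comp_pureTensor (hb : Orthonormal ℂ b)
    (hP : ∀ γ, IsSelfAdjoint (P γ)) {γ : Λ} (hγ : γ ∈ E) :
    (blockColumn b P E)† ∘L pureTensor (b γ) = P γ := by
  classical
  ext k
  simp only [adjoint_blockColumn hP, ContinuousLinearMap.comp_apply, sum_apply,
    adjoint_pureTensor_pureTensor, orthonormal_iff_ite.1 hb, ite_smul, one_smul, zero_smul,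
    apply_ite (P _), map_zero, Finset.sum_ite_eq', hγ, if_true]

theorem adjoint_pureTensor_comp_blockColumn (hb : Orthonormal ℂ b)
    (hP : ∀ γ, IsSelfAdjoint (P γ)) {γ : Λ} (hγ : γ ∈ E) :
    (pureTensor (b γ))† ∘L blockColumn b P E = P γ := by
  rw [← (hP γ).adjoint_eq, ← adjoint_blockColumn_comp_pureTensor hb hP hγ,
    ContinuousLinearMap.adjoint_comp, ContinuousLinearMap.adjoint_adjoint]

theorem norm_sum_le_one_of_orthogonalIdempotents (hP : OrthogonalIdempotents P)
    (hsa : ∀ γ, IsSelfAdjoint (P γ)) (E : Finset Λ) : ‖∑ γ ∈ E, P γ‖ ≤ 1 :=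
  IsStarProjection.norm_le _ ⟨hP.isIdempotentElem_sum, isSelfAdjoint_sum E fun γ _ => hsa γ⟩

theorem norm_blockColumn_le_one (hb : Orthonormal ℂ b) (hP : OrthogonalIdempotents P)
    (hsa : ∀ γ, IsSelfAdjoint (P γ)) : ‖blockColumn b P E‖ ≤ 1 := by
  have hgram : (blockColumn b P E)† ∘L blockColumn b P E = ∑ γ ∈ E, P γ := by
    conv_lhs => rw [adjoint_blockColumn hsa, ContinuousLinearMap.finsetSum_comp]
    refine Finset.sum_congr rfl fun γ hγ => ?_
    rw [ContinuousLinearMap.comp_assoc, adjoint_pureTensor_comp_blockColumn hb hsa hγ]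
    exact hP.idem γ
  refine (sq_le_one_iff₀ (norm_nonneg (blockColumn b P E))).1 ?_
  rw [sq, ← ContinuousLinearMap.norm_adjoint_comp_self, hgram]
  exact norm_sum_le_one_of_orthogonalIdempotents hP hsa E

theorem sum_tensorMap_rankOne_eq_blockColumn_comp (hP : ∀ γ, IsSelfAdjoint (P γ))
    (T : H →L[ℂ] H) :
    ∑ i ∈ E ×ˢ E, tensorMap (InnerProductSpace.rankOne ℂ (b i.1) (b i.2)) (P i.1 ∘L T ∘L P i.2) =
      blockColumn b P E ∘L T ∘L (blockColumn b P E)† := by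
  rw [adjoint_blockColumn hP, blockColumn]
  simp only [Finset.sum_product, tensorMap_rankOne_left, ContinuousLinearMap.finsetSum_comp,
    ContinuousLinearMap.comp_finsetSum, ContinuousLinearMap.comp_assoc]
  exact Finset.sum_comm

theorem adjoint_blockColumn_comp_sum_tensorMap_comp (hb : Orthonormal ℂ b)
    (hP : OrthogonalIdempotents P) (hsa : ∀ γ, IsSelfAdjoint (P γ)) (φ : Λ × Λ → ℂ)
    (T : H →L[ℂ] H) :
    (blockColumn b P E)† ∘L (∑ i ∈ E ×ˢ E, tensorMap
        (φ i • InnerProductSpace.rankOne ℂ (b i.1) (b i.2)) (P i.1 ∘L T ∘L P i.2)) ∘L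
        blockColumn b P E =
      ∑ γ ∈ E, ∑ γ' ∈ E, φ (γ, γ') • (P γ ∘L T ∘L P γ') := by
  rw [← Finset.sum_product', ContinuousLinearMap.finsetSum_comp,
    ContinuousLinearMap.comp_finsetSum]
  refine Finset.sum_congr rfl fun i hi => ?_
  obtain ⟨h1, h2⟩ := Finset.mem_product.1 hi
  calc (blockColumn b P E)† ∘L tensorMap (φ i • InnerProductSpace.rankOne ℂ (b i.1) (b i.2))
          (P i.1 ∘L T ∘L P i.2) ∘L blockColumn b P E
      = φ i • (((blockColumn b P E)† ∘L pureTensor (b i.1)) ∘L (P i.1 ∘L T ∘L P i.2) ∘L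
          ((pureTensor (b i.2))† ∘L blockColumn b P E)) := by
        rw [tensorMap_smul_left, tensorMap_rankOne_left]
        simp only [ContinuousLinearMap.smul_comp, ContinuousLinearMap.comp_smul,
          ContinuousLinearMap.comp_assoc]
    _ = φ i • ((P i.1 * P i.1) ∘L T ∘L (P i.2 * P i.2)) := by
        rw [adjoint_blockColumn_comp_pureTensor hb hsa h1,
          adjoint_pureTensor_comp_blockColumn hb hsa h2]
        rfl
    _ = φ i • (P i.1 ∘L T ∘L P i.2) := by rw [hP.idem i.1, hP.idem i.2]

end BlockColumn

theorem IsCBSchurBound.schattenNorm_sum_smul_comp_le {Λ : Type u} [MeasurableSpace Λ]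
    [MeasurableSingletonClass Λ] {ν : Measure Λ} [SFinite ν] {c : ℝ} (hc : 0 < c)
    (hν : ∀ γ, ν {γ} = ENNReal.ofReal c) {p : ℝ≥0∞} (hp : 1 ≤ p) {φ : Λ × Λ → ℂ} {C : ℝ≥0}
    (h : IsCBSchurBound p ν φ C) {H : Type u} [NormedAddCommGroup H] [InnerProductSpace ℂ H]
    [CompleteSpace H] {P : Λ → (H →L[ℂ] H)} (hP : OrthogonalIdempotents P)
    (hsa : ∀ γ, IsSelfAdjoint (P γ)) (E : Finset Λ) {T : H →L[ℂ] H} (hT : MemSchatten p T) :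
    schattenNorm p (∑ γ ∈ E, ∑ γ' ∈ E, φ (γ, γ') • (P γ ∘L T ∘L P γ')) ≤
      C * schattenNorm p T := by
  have hb := (pointBasis hc hν).orthonormal
  have hV : ‖blockColumn (pointBasis hc hν) P E‖ ≤ 1 := norm_blockColumn_le_one hb hP hsa
  have hV' : ‖(blockColumn (pointBasis hc hν) P E)†‖ ≤ 1 := by rwa [LinearIsometryEquiv.norm_map]
  have hPnorm : ∀ γ, ‖P γ‖ ≤ 1 := fun γ => IsStarProjection.norm_le _ ⟨hP.idem γ, hsa γ⟩
  have hblock : ∀ i : Λ × Λ, MemSchatten p (P i.1 ∘L T ∘L P i.2) := fun i => by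
    have hle := schattenNorm_conj_le hp T (hPnorm i.2) (hPnorm i.1)
    rw [(hsa i.1).adjoint_eq] at hle
    exact hle.trans_lt hT
  have hbound := h.bound_sum (E ×ˢ E)
    (fun i => memSchatten_rankOne hp (pointBasis hc hν i.1) (pointBasis hc hν i.2))
    (fun i => isSchurImage_rankOne_pointBasis hc hν φ i.1 i.2) hblock
  rw [sum_tensorMap_rankOne_eq_blockColumn_comp hsa] at hbound
  have hcol := schattenNorm_conj_le hp T hV' hV'
  rw [ContinuousLinearMap.adjoint_adjoint] at hcol
  rw [← adjoint_blockColumn_comp_sum_tensorMap_comp hb hP hsa φ T]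
  exact (schattenNorm_conj_le hp _ hV hV).trans (hbound.trans (mul_le_mul_right hcol _))

section Indicator

variable {X : Type*} [MeasurableSpace X] {μ : Measure X} {s t : Set X}

/-- Multiplication by the indicator function of the measurable set `s`, as an operator
on `L²(X, μ)`. -/
noncomputable def indicatorCLM (μ : Measure X) (hs : MeasurableSet s) :
    Lp ℂ 2 μ →L[ℂ] Lp ℂ 2 μ :=
  LinearMap.mkContinuous
    { toFun := fun f => ((Lp.memLp f).indicator hs).toLp _
      map_add' := fun f g => by
        rw [← MemLp.toLp_add, MemLp.toLp_eq_toLp_iff, ← Set.indicator_add']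
        exact (Lp.coeFn_add f g).indicator
      map_smul' := fun c f => by
        rw [RingHom.id_apply, ← MemLp.toLp_const_smul, MemLp.toLp_eq_toLp_iff]
        exact (Lp.coeFn_smul c f).indicator.trans
          (.of_eq (Set.indicator_const_smul s c f)) } 1 fun f => by
    rw [one_mul]
    change ‖((Lp.memLp f).indicator hs).toLp _‖ ≤ _
    rw [Lp.norm_toLp, Lp.norm_def]
    exact ENNReal.toReal_mono (Lp.memLp f).2.ne (eLpNorm_indicator_le _)

theorem indicatorCLM_ae_eq (hs : MeasurableSet s) (f : Lp ℂ 2 μ) :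
    indicatorCLM μ hs f =ᵐ[μ] s.indicator f :=
  ((Lp.memLp f).indicator hs).coeFn_toLp

theorem indicatorCLM_indicatorCLM_ae_eq (hs : MeasurableSet s) (ht : MeasurableSet t)
    (f : Lp ℂ 2 μ) :
    indicatorCLM μ hs (indicatorCLM μ ht f) =ᵐ[μ] (s ∩ t).indicator f := by
  rw [← Set.indicator_indicator]
  exact (indicatorCLM_ae_eq hs _).trans (indicatorCLM_ae_eq ht f).indicator

theorem isSelfAdjoint_indicatorCLM (hs : MeasurableSet s) :
    IsSelfAdjoint (indicatorCLM μ hs) := by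
  refine ((ContinuousLinearMap.eq_adjoint_iff _ _).2 fun f g => ?_).symm
  rw [L2.inner_def, L2.inner_def]
  refine integral_congr_ae ?_
  filter_upwards [indicatorCLM_ae_eq hs f, indicatorCLM_ae_eq hs g] with x hf hg
  rw [hf, hg]
  by_cases h : x ∈ s <;> simp [h]

end Indicator

section FiberProj

variable {X Λ : Type*} [MeasurableSpace X] {μ : Measure X} [MeasurableSpace Λ]
  [MeasurableSingletonClass Λ] {q : X → Λ}

/-- The projection of `L²(X, μ)` onto the functions supported by the fiber `q⁻¹ {γ}`. -/
noncomputable def fiberProj (μ : Measure X) (hq : Measurable q) (γ : Λ) :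
    Lp ℂ 2 μ →L[ℂ] Lp ℂ 2 μ :=
  indicatorCLM μ (hq (measurableSet_singleton γ))

theorem isSelfAdjoint_fiberProj (hq : Measurable q) (γ : Λ) : IsSelfAdjoint (fiberProj μ hq γ) :=
  isSelfAdjoint_indicatorCLM _

theorem fiberProj_ae_eq (hq : Measurable q) (γ : Λ) (f : Lp ℂ 2 μ) :
    fiberProj μ hq γ f =ᵐ[μ] (q ⁻¹' {γ}).indicator f :=
  indicatorCLM_ae_eq _ f

theorem orthogonalIdempotents_fiberProj (hq : Measurable q) :
    OrthogonalIdempotents (fiberProj μ hq) where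
  idem γ := ContinuousLinearMap.ext fun f => Lp.ext <| by
    have hγ := hq (measurableSet_singleton γ)
    refine (indicatorCLM_indicatorCLM_ae_eq hγ hγ f).trans ?_
    rw [Set.inter_self]
    exact (fiberProj_ae_eq hq γ f).symm
  ortho γ γ' hne := ContinuousLinearMap.ext fun f => Lp.ext <| by
    refine (indicatorCLM_indicatorCLM_ae_eq (hq (measurableSet_singleton γ))
      (hq (measurableSet_singleton γ')) f).trans ?_
    rw [(Disjoint.preimage q (Set.disjoint_singleton.2 hne)).inter_eq, Set.indicator_empty]
    exact (Lp.coeFn_zero ℂ 2 μ).symm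

theorem sum_fiberProj_ae_eq (hq : Measurable q) (E : Finset Λ) (f : Lp ℂ 2 μ) :
    (∑ γ ∈ E, fiberProj μ hq γ) f =ᵐ[μ] (q ⁻¹' E).indicator f := by
  classical
  induction E using Finset.induction_on with
  | empty => simpa [Pi.zero_def] using Lp.coeFn_zero ℂ 2 μ
  | insert γ E hγ ih =>
    rw [Finset.sum_insert hγ, add_apply, Finset.coe_insert, Set.insert_eq, Set.preimage_union,
      Set.indicator_union_of_disjoint
        (Disjoint.preimage q (Set.disjoint_singleton_left.2 (by simpa using hγ)))]
    exact (Lp.coeFn_add _ _).trans ((fiberProj_ae_eq hq γ f).add ih)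

theorem tendsto_sum_fiberProj [Countable Λ] (hq : Measurable q) (f : Lp ℂ 2 μ) :
    Tendsto (fun E : Finset Λ => (∑ γ ∈ E, fiberProj μ hq γ) f) atTop (nhds f) := by
  refine (Lp.tendsto_Lp_iff_tendsto_eLpNorm' _ f).2 ?_
  have hlim : Tendsto (fun E : Finset Λ => ∫⁻ x, ‖(q ⁻¹' E).indicator f x - f x‖ₑ ^ 2 ∂μ) atTop
      (nhds (∫⁻ _, 0 ∂μ)) := by
    refine tendsto_lintegral_filter_of_dominated_convergence (fun x => ‖f x‖ₑ ^ 2)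
      (Eventually.of_forall fun E => ?_)
      (Eventually.of_forall fun E => Eventually.of_forall fun x => ?_) ?_
      (Eventually.of_forall fun x => tendsto_const_nhds.congr' ?_)
    · exact (((Lp.stronglyMeasurable f).indicator (hq E.measurableSet)).sub
        (Lp.stronglyMeasurable f)).enorm.pow_const 2
    · by_cases hx : q x ∈ E <;> simp [hx]
    · rw [← enorm_Lp_sq]
      exact ENNReal.pow_ne_top enorm_ne_top
    · filter_upwards [eventually_ge_atTop {q x}] with E hE
      have hx : q x ∈ E := hE (Finset.mem_singleton_self _)
      simp [hx]
  rw [lintegral_zero] at hlim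
  have hsqrt := ((ENNReal.continuous_rpow_const (y := 1 / 2)).tendsto 0).comp hlim
  rw [ENNReal.zero_rpow_of_pos (by norm_num)] at hsqrt
  refine hsqrt.congr fun E => ?_
  rw [Function.comp_apply, eLpNorm_congr_ae ((sum_fiberProj_ae_eq hq E f).sub .rfl),
    eLpNorm_eq_lintegral_rpow_enorm_toReal two_ne_zero ENNReal.ofNat_ne_top]
  simp

theorem IsSchurImage.fiberProj_comp {X Λ : Type u} [MeasurableSpace X] {μ : Measure X} [SFinite μ]
    [MeasurableSpace Λ] [MeasurableSingletonClass Λ] {q : X → Λ} (hq : Measurable q)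
    {φ : Λ × Λ → ℂ} {A A' : Lp ℂ 2 μ →L[ℂ] Lp ℂ 2 μ}
    (h : IsSchurImage μ (fun z => φ (q z.1, q z.2)) A A') (γ γ' : Λ) :
    fiberProj μ hq γ ∘L A' ∘L fiberProj μ hq γ' =
      φ (γ, γ') • (fiberProj μ hq γ ∘L A ∘L fiberProj μ hq γ') := by
  obtain ⟨k, hA, hA'⟩ := h
  refine ContinuousLinearMap.ext fun η => ext_inner_left ℂ fun ξ => ?_
  simp only [smul_apply, ContinuousLinearMap.comp_apply, inner_smul_right,
    ← ContinuousLinearMap.adjoint_inner_left (fiberProj μ hq γ),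
    (isSelfAdjoint_fiberProj hq γ).adjoint_eq]
  rw [hA'.inner_eq, hA.inner_eq, ← integral_const_mul]
  refine integral_congr_ae ?_
  filter_upwards [Measure.quasiMeasurePreserving_fst.ae (fiberProj_ae_eq hq γ ξ),
    Measure.quasiMeasurePreserving_snd.ae (fiberProj_ae_eq hq γ' η)] with z hξ hη
  rw [hξ, hη]
  by_cases hz1 : q z.1 = γ
  · by_cases hz2 : q z.2 = γ'
    · rw [hz1, hz2]
      ring
    · simp [hz2]
  · simp [hz1]

end FiberProj

section Compression

variable {H K : Type*} [NormedAddCommGroup H] [InnerProductSpace ℂ H]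
  [NormedAddCommGroup K] [InnerProductSpace ℂ K] {Λ : Type*} {P : Λ → (H →L[ℂ] H)}

theorem orthogonalIdempotents_tensorMap_id (hP : OrthogonalIdempotents P) :
    OrthogonalIdempotents fun γ => tensorMap (P γ) (ContinuousLinearMap.id ℂ K) where
  idem _ := (tensorMap_comp _ _ _ _).symm.trans (congrArg₂ tensorMap (hP.idem _) rfl)
  ortho _ _ hne := (tensorMap_comp _ _ _ _).symm.trans <|
    (congrArg₂ tensorMap (hP.ortho hne) rfl).trans (tensorMap_zero_left _)

variable [CompleteSpace H]

theorem isSelfAdjoint_tensorMap_id [CompleteSpace K] {A : H →L[ℂ] H} (hA : IsSelfAdjoint A) :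
    IsSelfAdjoint (tensorMap A (ContinuousLinearMap.id ℂ K)) :=
  (adjoint_tensorMap _ _).trans (congrArg₂ tensorMap hA ContinuousLinearMap.adjoint_id)

theorem sum_norm_sq_le (hP : OrthogonalIdempotents P) (hsa : ∀ γ, IsSelfAdjoint (P γ))
    (E : Finset Λ) (x : H) : ∑ γ ∈ E, ‖P γ x‖ ^ 2 ≤ ‖x‖ ^ 2 := by
  have hnorm : ∀ γ, ‖P γ x‖ ^ 2 = RCLike.re ⟪x, P γ x⟫_ℂ := fun γ => by
    rw [← inner_self_eq_norm_sq (𝕜 := ℂ), ← ContinuousLinearMap.adjoint_inner_right,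
      (hsa γ).adjoint_eq]
    exact congrArg (fun T : H →L[ℂ] H => RCLike.re ⟪x, T x⟫_ℂ) (hP.idem γ)
  calc ∑ γ ∈ E, ‖P γ x‖ ^ 2 = RCLike.re ⟪x, (∑ γ ∈ E, P γ) x⟫_ℂ := by
        rw [sum_apply, inner_sum, map_sum]
        exact Finset.sum_congr rfl fun γ _ => hnorm γ
    _ ≤ ‖x‖ * ‖(∑ γ ∈ E, P γ) x‖ := re_inner_le_norm _ _
    _ ≤ ‖x‖ * ‖x‖ := by
        gcongr
        simpa only [one_mul] using ContinuousLinearMap.le_of_opNorm_le _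
          (norm_sum_le_one_of_orthogonalIdempotents hP hsa E) x
    _ = ‖x‖ ^ 2 := (sq _).symm

theorem schattenNorm_le_of_forall_compression {p : ℝ≥0∞} (hp : 1 ≤ p) {ι : Type*} {l : Filter ι}
    [l.NeBot] {T : H →L[ℂ] H} (hT : IsCompactOperator T) {Q : ι → (H →L[ℂ] H)}
    (hsa : ∀ i, IsSelfAdjoint (Q i)) (hlim : ∀ x, Tendsto (fun i => Q i x) l (nhds x)) {c : ℝ≥0∞}
    (h : ∀ i, schattenNorm p (Q i ∘L T ∘L Q i) ≤ c) : schattenNorm p T ≤ c := by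
  refine schattenNorm_le_of_tendsto hp hT (l := l) (S := fun i => Q i ∘L T ∘L Q i)
    (fun x y => ?_) h
  refine ((hlim x).inner (𝕜 := ℂ) ((T.continuous.tendsto y).comp (hlim y))).congr fun i => ?_
  rw [ContinuousLinearMap.comp_apply, ← ContinuousLinearMap.adjoint_inner_left,
    (hsa i).adjoint_eq]
  rfl

end Compression

section Pullback

variable {X : Type u} [MeasurableSpace X] {μ : Measure X} [SFinite μ]

theorem IsSchurImage.isCompactOperator {φ : X × X → ℂ} {A A' : Lp ℂ 2 μ →L[ℂ] Lp ℂ 2 μ}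
    (h : IsSchurImage μ φ A A') : IsCompactOperator A' :=
  let ⟨_, _, h'⟩ := h
  h'.isCompactOperator

theorem isCompactOperator_sum {H : Type*} [NormedAddCommGroup H] [NormedSpace ℂ H] {ι : Type*}
    (s : Finset ι) {T : ι → (H →L[ℂ] H)} (hT : ∀ i, IsCompactOperator (T i)) :
    IsCompactOperator (∑ i ∈ s, T i : H →L[ℂ] H) :=
  Finset.sum_induction T (fun T => IsCompactOperator T) (fun _ _ hS hT => hS.add hT)
    isCompactOperator_zero fun i _ => hT i

variable {Λ : Type u} [MeasurableSpace Λ] [MeasurableSingletonClass Λ] {φ : Λ × Λ → ℂ}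
  {q : X → Λ} {K : Type u} [NormedAddCommGroup K] [InnerProductSpace ℂ K] {ι : Type*}
  {A A' : ι → (Lp ℂ 2 μ →L[ℂ] Lp ℂ 2 μ)} {B : ι → (K →L[ℂ] K)}

theorem sum_tensorMap_fiberProj_comp (hq : Measurable q) (s : Finset ι)
    (hA : ∀ i, IsSchurImage μ (fun z => φ (q z.1, q z.2)) (A i) (A' i)) (γ γ' : Λ) :
    tensorMap (fiberProj μ hq γ) (ContinuousLinearMap.id ℂ K) ∘L
        (∑ i ∈ s, tensorMap (A' i) (B i)) ∘L
        tensorMap (fiberProj μ hq γ') (ContinuousLinearMap.id ℂ K) =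
      φ (γ, γ') • (tensorMap (fiberProj μ hq γ) (ContinuousLinearMap.id ℂ K) ∘L
        (∑ i ∈ s, tensorMap (A i) (B i)) ∘L
        tensorMap (fiberProj μ hq γ') (ContinuousLinearMap.id ℂ K)) := by
  simp only [ContinuousLinearMap.finsetSum_comp, ContinuousLinearMap.comp_finsetSum,
    ← tensorMap_comp, ContinuousLinearMap.id_comp, ContinuousLinearMap.comp_id, Finset.smul_sum,
    (hA _).fiberProj_comp hq, tensorMap_smul_left]

theorem IsCBSchurBound.schattenNorm_pullback_le [CompleteSpace K] [Countable Λ] {ν : Measure Λ}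
    [SFinite ν] {c : ℝ} (hc : 0 < c) (hν : ∀ γ, ν {γ} = ENNReal.ofReal c) {p : ℝ≥0∞}
    (hp : 1 ≤ p) {C : ℝ≥0} (h : IsCBSchurBound p ν φ C) (hq : Measurable q) (s : Finset ι)
    (hA : ∀ i, IsSchurImage μ (fun z => φ (q z.1, q z.2)) (A i) (A' i))
    (hB : ∀ i, IsCompactOperator (B i)) (hT : MemSchatten p (∑ i ∈ s, tensorMap (A i) (B i))) :
    schattenNorm p (∑ i ∈ s, tensorMap (A' i) (B i)) ≤
      C * schattenNorm p (∑ i ∈ s, tensorMap (A i) (B i)) := by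
  have hR := orthogonalIdempotents_fiberProj (μ := μ) hq
  let P : Λ → (HilbertTensor (Lp ℂ 2 μ) K →L[ℂ] HilbertTensor (Lp ℂ 2 μ) K) :=
    fun γ => tensorMap (fiberProj μ hq γ) (ContinuousLinearMap.id ℂ K)
  have hsa : ∀ γ, IsSelfAdjoint (P γ) := fun γ =>
    isSelfAdjoint_tensorMap_id (isSelfAdjoint_fiberProj hq γ)
  have hlim : ∀ z, Tendsto (fun E : Finset Λ => (∑ γ ∈ E, P γ) z) atTop (nhds z) := fun z => by
    simpa only [tensorMap_sum_left] using tendsto_tensorMap_id (K := K)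
      (norm_sum_le_one_of_orthogonalIdempotents hR (isSelfAdjoint_fiberProj hq))
      (tendsto_sum_fiberProj hq) z
  refine schattenNorm_le_of_forall_compression hp (isCompactOperator_sum s fun i =>
    isCompactOperator_tensorMap (hA i).isCompactOperator (hB i))
    (fun E => isSelfAdjoint_sum E fun γ _ => hsa γ) hlim fun E => ?_
  have hcut : (∑ γ ∈ E, P γ) ∘L (∑ i ∈ s, tensorMap (A' i) (B i)) ∘L (∑ γ ∈ E, P γ) =
      ∑ γ ∈ E, ∑ γ' ∈ E, φ (γ, γ') • (P γ ∘L (∑ i ∈ s, tensorMap (A i) (B i)) ∘L P γ') := by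
    rw [ContinuousLinearMap.finsetSum_comp]
    refine Finset.sum_congr rfl fun γ _ => ?_
    rw [ContinuousLinearMap.comp_finsetSum, ContinuousLinearMap.comp_finsetSum]
    exact Finset.sum_congr rfl fun γ' _ => sum_tensorMap_fiberProj_comp hq s hA γ γ'
  rw [hcut]
  exact h.schattenNorm_sum_smul_comp_le hc hν hp (orthogonalIdempotents_tensorMap_id hR) hsa E hT

end Pullback

section Average

theorem IsCBSchurBound.norm_le {Λ : Type u} [MeasurableSpace Λ] [MeasurableSingletonClass Λ]
    {ν : Measure Λ} [SFinite ν] {c : ℝ} (hc : 0 < c) (hν : ∀ γ, ν {γ} = ENNReal.ofReal c)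
    {p : ℝ≥0∞} (hp : 1 ≤ p) {φ : Λ × Λ → ℂ} {C : ℝ≥0} (h : IsCBSchurBound p ν φ C) (z : Λ × Λ) :
    ‖φ z‖ ≤ C := by
  have hb := (pointBasis hc hν).orthonormal.1
  have hbound := h.bound_sum {z}
    (fun i => memSchatten_rankOne hp (pointBasis hc hν i.1) (pointBasis hc hν i.2))
    (fun i => isSchurImage_rankOne_pointBasis hc hν φ i.1 i.2)
    (fun i => memSchatten_rankOne hp (pointBasis hc hν i.1) (pointBasis hc hν i.1))
  rw [Finset.sum_singleton, Finset.sum_singleton, tensorMap_smul_left, tensorMap_rankOne] at hbound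
  exact norm_le_of_schattenNorm_smul_rankOne_le hp (norm_pureTensor_eq_one (hb z.1) (hb z.1))
    (norm_pureTensor_eq_one (hb z.2) (hb z.1)) hbound

variable {X : Type u} [MeasurableSpace X] {μ : Measure X} [SFinite μ] {Ω : Type*}
  [MeasurableSpace Ω] {m : Measure Ω} {Φ : (X × X) × Ω → ℂ} {C : ℝ≥0}

theorem exists_isKernelOf_mul {ψ k : X × X → ℂ} (hψ : Measurable ψ) (hC : ∀ z, ‖ψ z‖ ≤ C)
    (hk : MemLp k 2 (μ.prod μ)) :
    ∃ D : Lp ℂ 2 μ →L[ℂ] Lp ℂ 2 μ, IsKernelOf μ (fun z => ψ z * k z) D ∧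
      ‖D‖ ≤ C * (eLpNorm k 2 (μ.prod μ)).toReal := by
  have hle : ∀ᵐ z ∂μ.prod μ, ‖ψ z * k z‖ ≤ C * ‖k z‖ := Eventually.of_forall fun z => by
    rw [norm_mul]
    gcongr
    exact hC z
  obtain ⟨D, hD, hnorm⟩ := exists_isKernelOf
    (hk.of_le_mul (hψ.aestronglyMeasurable.mul hk.1) hle)
  refine ⟨D, hD, hnorm.trans ?_⟩
  have hbound := eLpNorm_le_nnreal_smul_eLpNorm_of_ae_le_mul hle 2
  have htop : C • eLpNorm k 2 (μ.prod μ) ≠ ∞ := ENNReal.mul_ne_top ENNReal.coe_ne_top hk.2.ne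
  exact (ENNReal.toReal_mono htop hbound).trans (ENNReal.toReal_smul _ _).le

theorem isWeakIntegral_of_isKernelOf [IsFiniteMeasure m] (hΦ : Measurable Φ)
    (hC : ∀ w, ‖Φ w‖ ≤ C) {k : X × X → ℂ} (hk : MemLp k 2 (μ.prod μ))
    {D : Ω → (Lp ℂ 2 μ →L[ℂ] Lp ℂ 2 μ)} (hD : ∀ ω, IsKernelOf μ (fun z => Φ (z, ω) * k z) (D ω))
    {A' : Lp ℂ 2 μ →L[ℂ] Lp ℂ 2 μ} (hA' : IsKernelOf μ (fun z => (∫ ω, Φ (z, ω) ∂m) * k z) A') :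
    IsWeakIntegral m D A' := by
  intro ξ η
  have hint : Integrable (fun w : (X × X) × Ω => Φ w * (conj (ξ w.1.1) * k w.1 * η w.1.2))
      ((μ.prod μ).prod m) :=
    ((integrable_conj_mul_kernel_mul hk ξ η).comp_fst m).bdd_mul hΦ.aestronglyMeasurable
      (Eventually.of_forall hC)
  have hinner : ∀ ω, ⟪ξ, D ω η⟫_ℂ =
      ∫ z, Φ (z, ω) * (conj (ξ z.1) * k z * η z.2) ∂(μ.prod μ) := fun ω => by
    rw [(hD ω).inner_eq]
    exact integral_congr_ae (Eventually.of_forall fun z => by ring)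
  simp only [hinner]
  refine ⟨hint.integral_prod_right, ?_⟩
  rw [← integral_integral_swap hint, hA'.inner_eq]
  refine integral_congr_ae (Eventually.of_forall fun z => ?_)
  simp only [integral_mul_const]
  ring

theorem IsSchurImage.exists_isWeakIntegral [IsFiniteMeasure m] (hΦ : Measurable Φ)
    (hC : ∀ w, ‖Φ w‖ ≤ C) {A A' : Lp ℂ 2 μ →L[ℂ] Lp ℂ 2 μ}
    (h : IsSchurImage μ (fun z => ∫ ω, Φ (z, ω) ∂m) A A') :
    ∃ (D : Ω → (Lp ℂ 2 μ →L[ℂ] Lp ℂ 2 μ)) (M : ℝ),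
      (∀ ω, IsSchurImage μ (fun z => Φ (z, ω)) A (D ω)) ∧ (∀ ω, ‖D ω‖ ≤ M) ∧
        IsWeakIntegral m D A' := by
  obtain ⟨k, hk, hk'⟩ := h
  choose D hD hM using fun ω => exists_isKernelOf_mul (μ := μ)
    (hΦ.comp (measurable_prodMk_right (y := ω))) (fun z => hC (z, ω)) hk.1
  exact ⟨D, _, fun ω => ⟨k, hk, hD ω⟩, hM, isWeakIntegral_of_isKernelOf hΦ hC hk.1 hD hk'⟩

theorem IsCBSchurBound.average {Λ : Type u} [MeasurableSpace Λ] [MeasurableSingletonClass Λ]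
    [Countable Λ] {ν : Measure Λ} [SFinite ν] {c : ℝ} (hc : 0 < c)
    (hν : ∀ γ, ν {γ} = ENNReal.ofReal c) {p : ℝ≥0∞} (hp : 1 ≤ p) {φ : Λ × Λ → ℂ} (hC : 0 < C)
    (h : IsCBSchurBound p ν φ C) [IsProbabilityMeasure m] {q : Ω → X → Λ}
    (hq : Measurable (Function.uncurry q)) :
    IsCBSchurBound p μ (fun z => ∫ ω, φ (q ω z.1, q ω z.2) ∂m) C := by
  have hφ : ∀ z, ‖φ z‖ ≤ C := h.norm_le hc hν hp
  have hmeas : Measurable fun w : (X × X) × Ω => φ (q w.2 w.1.1, q w.2 w.1.2) :=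
    (Measurable.of_discrete (f := φ)).comp
      ((hq.comp (measurable_snd.prodMk (measurable_fst.comp measurable_fst))).prodMk
        (hq.comp (measurable_snd.prodMk (measurable_snd.comp measurable_fst))))
  refine ⟨memLp_top_of_bound hmeas.stronglyMeasurable.integral_prod_right'.aestronglyMeasurable C
    (Eventually.of_forall fun z => ?_), fun K _ _ _ n A A' B _ hA' hB => ?_⟩
  · simpa using norm_integral_le_of_norm_le_const (μ := m)
      (Eventually.of_forall fun ω => hφ (q ω z.1, q ω z.2))
  simp only [tensorOp_eq_tensorMap]
  rcases eq_or_ne (schattenNorm p (∑ i, tensorMap (A i) (B i))) ∞ with htop | htop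
  · rw [htop, ENNReal.mul_top (ENNReal.coe_pos.2 hC).ne']
    exact le_top
  choose D M hD hM hint using fun i => (hA' i).exists_isWeakIntegral
    (Φ := fun w => φ (q w.2 w.1.1, q w.2 w.1.2)) hmeas fun w => hφ _
  have hB' : ∀ i, IsCompactOperator (B i) := fun i => isCompactOperator_of_memSchatten hp (hB i)
  exact schattenNorm_le_of_integral hp
    (isCompactOperator_sum _ fun i => isCompactOperator_tensorMap (hA' i).isCompactOperator (hB' i))
    (IsWeakIntegral.sum Finset.univ fun i => (hint i).tensorMap (hM i) (B i))
    fun ω => h.schattenNorm_pullback_le hc hν hp (hq.comp measurable_prodMk_left) Finset.univ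
      (fun i => hD i ω) hB' htop.lt_top

end Average

section SchurImage

variable {X : Type u} [MeasurableSpace X] {μ : Measure X} {φ : X × X → ℂ}

theorem IsSchurImage.const_smul {A D : Lp ℂ 2 μ →L[ℂ] Lp ℂ 2 μ} (h : IsSchurImage μ φ A D)
    (c : ℂ) : IsSchurImage μ φ (c • A) (c • D) := by
  obtain ⟨k, hk, hD⟩ := h
  refine ⟨_, hk.const_smul c, ?_⟩
  simpa only [mul_left_comm c] using hD.const_smul c

theorem isSchurImage_zero (φ : X × X → ℂ) : IsSchurImage μ φ 0 0 := by
  have hzero : IsKernelOf μ (fun _ => 0) 0 := by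
    refine ⟨MemLp.zero, fun ξ => ?_⟩
    filter_upwards [Lp.coeFn_zero ℂ 2 μ] with x hx
    simp only [zero_apply, hx, Pi.zero_apply, zero_mul, integral_zero]
  exact ⟨fun _ => 0, hzero, by simpa only [mul_zero] using hzero⟩

variable [SFinite μ]

theorem IsKernelOf.add {k k' : X × X → ℂ} {A A' : Lp ℂ 2 μ →L[ℂ] Lp ℂ 2 μ}
    (h : IsKernelOf μ k A) (h' : IsKernelOf μ k' A') :
    IsKernelOf μ (fun z => k z + k' z) (A + A') := by
  obtain ⟨D, hD, -⟩ := exists_isKernelOf (h.1.add h'.1)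
  suffices hsum : D = A + A' from hsum ▸ hD
  refine ContinuousLinearMap.ext fun η => ext_inner_left ℂ fun ξ => ?_
  rw [add_apply, inner_add_right, hD.inner_eq, h.inner_eq, h'.inner_eq,
    ← integral_add (integrable_conj_mul_kernel_mul h.1 ξ η)
      (integrable_conj_mul_kernel_mul h'.1 ξ η)]
  simp only [Pi.add_apply, mul_add, add_mul]

theorem IsSchurImage.add {A A' D D' : Lp ℂ 2 μ →L[ℂ] Lp ℂ 2 μ} (h : IsSchurImage μ φ A D)
    (h' : IsSchurImage μ φ A' D') : IsSchurImage μ φ (A + A') (D + D') := by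
  obtain ⟨k, hk, hD⟩ := h
  obtain ⟨k', hk', hD'⟩ := h'
  refine ⟨_, hk.add hk', ?_⟩
  simpa only [mul_add] using hD.add hD'

theorem IsSchurImage.sum {ι : Type*} (s : Finset ι) {A D : ι → (Lp ℂ 2 μ →L[ℂ] Lp ℂ 2 μ)}
    (h : ∀ i, IsSchurImage μ φ (A i) (D i)) : IsSchurImage μ φ (∑ i ∈ s, A i) (∑ i ∈ s, D i) := by
  classical
  induction s using Finset.induction_on with
  | empty => exact isSchurImage_zero φ
  | insert a s ha ih =>
    rw [Finset.sum_insert ha, Finset.sum_insert ha]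
    exact (h a).add ih

theorem exists_isSchurImage_rankOne (hφ : MemLp φ ∞ (μ.prod μ)) (ξ η : Lp ℂ 2 μ) :
    ∃ D, IsSchurImage μ φ (InnerProductSpace.rankOne ℂ ξ η) D ∧ ∀ ξ' η' : Lp ℂ 2 μ, ⟪ξ', D η'⟫_ℂ =
      ∫ z : X × X, conj (ξ' z.1) * (φ z * (ξ z.1 * conj (η z.2))) * η' z.2 ∂(μ.prod μ) := by
  have hk := isKernelOf_rankOne ξ η
  obtain ⟨D, hD, -⟩ := exists_isKernelOf (hk.1.mul' hφ : MemLp (fun z => φ z * _) 2 (μ.prod μ))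
  exact ⟨D, ⟨_, hk, hD⟩, hD.inner_eq⟩

end SchurImage

section PartialIsometry

variable {H L K Λ : Type*} [NormedAddCommGroup H] [InnerProductSpace ℂ H]
  [NormedAddCommGroup L] [InnerProductSpace ℂ L] [NormedAddCommGroup K] [InnerProductSpace ℂ K]
  {s : Λ → H} {b : Λ → L}

/-- The operator `∑ γ ∈ E, s γ ⊗ (b γ)*`. For orthonormal families `s` and `b` it is the partial
isometry that maps `b γ` to `s γ` for `γ ∈ E` and vanishes on the orthogonal complement. -/
noncomputable def partialIsometry (s : Λ → H) (b : Λ → L) (E : Finset Λ) : L →L[ℂ] H :=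
  ∑ γ ∈ E, InnerProductSpace.rankOne ℂ (s γ) (b γ)

theorem partialIsometry_conj (s : Λ → H) (b : Λ → L) (E : Finset Λ) (A : L →L[ℂ] L) :
    partialIsometry s b E ∘L A ∘L partialIsometry b s E =
      ∑ γ ∈ E, ∑ γ' ∈ E, ⟪b γ, A (b γ')⟫_ℂ • InnerProductSpace.rankOne ℂ (s γ) (s γ') := by
  ext x
  simp only [partialIsometry, ContinuousLinearMap.comp_apply, sum_apply, smul_apply,
    InnerProductSpace.rankOne_apply, map_sum, map_smul, Finset.smul_sum, smul_smul,
    mul_comm]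
  exact Finset.sum_comm

theorem tensorMap_id_comp_sum_comp {ι : Type*} (t : Finset ι) (R : L →L[ℂ] H)
    (T : ι → (L →L[ℂ] L)) (R' : H →L[ℂ] L) (B : ι → (K →L[ℂ] K)) :
    tensorMap R (ContinuousLinearMap.id ℂ K) ∘L (∑ i ∈ t, tensorMap (T i) (B i)) ∘L
        tensorMap R' (ContinuousLinearMap.id ℂ K) =
      ∑ i ∈ t, tensorMap (R ∘L T i ∘L R') (B i) := by
  simp only [ContinuousLinearMap.finsetSum_comp, ContinuousLinearMap.comp_finsetSum,
    ← tensorMap_comp, ContinuousLinearMap.id_comp, ContinuousLinearMap.comp_id]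

variable [CompleteSpace H] [CompleteSpace L]

theorem adjoint_partialIsometry (s : Λ → H) (b : Λ → L) (E : Finset Λ) :
    (partialIsometry s b E)† = partialIsometry b s E := by
  simp only [partialIsometry, map_sum, InnerProductSpace.adjoint_rankOne]

theorem norm_partialIsometry_le_one (hs : Orthonormal ℂ s) (hb : Orthonormal ℂ b) (E : Finset Λ) :
    ‖partialIsometry s b E‖ ≤ 1 := by
  classical
  have hgram : (partialIsometry s b E)† ∘L partialIsometry s b E =
      ∑ γ ∈ E, InnerProductSpace.rankOne ℂ (b γ) (b γ) := by
    have hconj := partialIsometry_conj b s E (ContinuousLinearMap.id ℂ H)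
    rw [ContinuousLinearMap.id_comp] at hconj
    rw [adjoint_partialIsometry, hconj]
    refine Finset.sum_congr rfl fun γ hγ => ?_
    simp only [ContinuousLinearMap.id_apply, orthonormal_iff_ite.1 hs, ite_smul, one_smul,
      zero_smul, Finset.sum_ite_eq, hγ, if_true]
  refine (sq_le_one_iff₀ (norm_nonneg _)).1 ?_
  rw [sq, ← ContinuousLinearMap.norm_adjoint_comp_self, hgram]
  exact norm_sum_rankOne_self_le hb E

theorem adjoint_tensorMap_partialIsometry_id [CompleteSpace K] (s : Λ → H) (b : Λ → L)
    (E : Finset Λ) :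
    (tensorMap (partialIsometry s b E) (ContinuousLinearMap.id ℂ K))† =
      tensorMap (partialIsometry b s E) (ContinuousLinearMap.id ℂ K) := by
  rw [adjoint_tensorMap, adjoint_partialIsometry]
  exact congrArg _ ContinuousLinearMap.adjoint_id

theorem schattenNorm_sum_tensorMap_conj_le {p : ℝ≥0∞} (hp : 1 ≤ p) [CompleteSpace K]
    (hs : Orthonormal ℂ s) (hb : Orthonormal ℂ b) (E : Finset Λ) {ι : Type*} (t : Finset ι)
    (T : ι → (L →L[ℂ] L)) (B : ι → (K →L[ℂ] K)) :
    schattenNorm p (∑ i ∈ t, tensorMap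
        (partialIsometry s b E ∘L T i ∘L partialIsometry b s E) (B i)) ≤
      schattenNorm p (∑ i ∈ t, tensorMap (T i) (B i)) := by
  have hnorm := norm_tensorMap_id_le (K := K) (norm_partialIsometry_le_one hb hs E)
  rw [← tensorMap_id_comp_sum_comp, ← adjoint_tensorMap_partialIsometry_id b s E]
  exact schattenNorm_conj_le hp _ hnorm hnorm

end PartialIsometry

section Sampling

variable {X : Type u} [MeasurableSpace X] {μ : Measure X} {Λ : Type u} {S : Λ → Set X}
  {a : ℝ}

theorem integral_normalizedIndicator_mul [DecidableEq Λ] (ha : 0 ≤ a)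
    (hS : ∀ γ, MeasurableSet (S γ)) (hμ : ∀ γ, μ (S γ) = ENNReal.ofReal a)
    (hd : Pairwise (Function.onFun Disjoint S)) (φ : X × X → ℂ) (γ γ' δ δ' : Λ) :
    ∫ z : X × X, conj (normalizedIndicator hS hμ δ z.1) * (φ z * (normalizedIndicator hS hμ γ z.1 *
        conj (normalizedIndicator hS hμ γ' z.2))) * normalizedIndicator hS hμ δ' z.2 ∂(μ.prod μ) =
      if δ = γ ∧ γ' = δ' then
        ((a : ℂ) ^ 2)⁻¹ * ∫ z in S γ ×ˢ S γ', φ z ∂(μ.prod μ) else 0 := by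
  have hfst := Measure.quasiMeasurePreserving_fst (μ := μ) (ν := μ) |>.ae_eq_comp
    (conj_mul_normalizedIndicator_ae_eq ha hS hμ hd δ γ)
  have hsnd := Measure.quasiMeasurePreserving_snd (μ := μ) (ν := μ) |>.ae_eq_comp
    (conj_mul_normalizedIndicator_ae_eq ha hS hμ hd γ' δ')
  rw [← integral_const_mul, ← integral_indicator ((hS γ).prod (hS γ')), ← integral_zero (X × X) ℂ,
    ← apply_ite]
  refine integral_congr_ae ?_
  filter_upwards [hfst, hsnd] with z h1 h2
  simp only [Function.comp_apply] at h1 h2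
  calc _ = (conj (normalizedIndicator hS hμ δ z.1) * normalizedIndicator hS hμ γ z.1) *
        (conj (normalizedIndicator hS hμ γ' z.2) * normalizedIndicator hS hμ δ' z.2) * φ z := by
        ring
    _ = _ := by
      rw [h1, h2]
      by_cases hz1 : z.1 ∈ S γ <;> by_cases hz2 : z.2 ∈ S γ' <;> split_ifs <;>
        simp_all [sq, Set.indicator]

variable [SFinite μ]

theorem exists_isSchurImage_sum_rankOne_normalizedIndicator {φ : X × X → ℂ}
    (hφ : MemLp φ ∞ (μ.prod μ)) (ha : 0 ≤ a) (hS : ∀ γ, MeasurableSet (S γ))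
    (hμ : ∀ γ, μ (S γ) = ENNReal.ofReal a) (hd : Pairwise (Function.onFun Disjoint S))
    (E : Finset Λ) (t : Λ → Λ → ℂ) :
    ∃ D, IsSchurImage μ φ (∑ γ ∈ E, ∑ γ' ∈ E, t γ γ' • InnerProductSpace.rankOne ℂ
        (normalizedIndicator hS hμ γ) (normalizedIndicator hS hμ γ')) D ∧
      ∀ γ ∈ E, ∀ γ' ∈ E, ⟪normalizedIndicator hS hμ γ, D (normalizedIndicator hS hμ γ')⟫_ℂ =
        (((a : ℂ) ^ 2)⁻¹ * ∫ z in S γ ×ˢ S γ', φ z ∂(μ.prod μ)) * t γ γ' := by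
  classical
  choose D hD hinner using fun γ γ' => exists_isSchurImage_rankOne hφ
    (normalizedIndicator hS hμ γ) (normalizedIndicator hS hμ γ')
  refine ⟨∑ γ ∈ E, ∑ γ' ∈ E, t γ γ' • D γ γ',
    .sum _ fun γ => .sum _ fun γ' => (hD γ γ').const_smul _, fun γ hγ γ' hγ' => ?_⟩
  simp only [sum_apply, smul_apply, inner_sum, inner_smul_right, hinner,
    integral_normalizedIndicator_mul ha hS hμ hd, ite_and, mul_ite, mul_zero]
  simp [hγ, hγ', mul_comm]

theorem IsCBSchurBound.sample [MeasurableSpace Λ] [MeasurableSingletonClass Λ] [Countable Λ]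
    {ν : Measure Λ} [SFinite ν] {c : ℝ} (hc : 0 < c) (hν : ∀ γ, ν {γ} = ENNReal.ofReal c)
    {p : ℝ≥0∞} (hp : 1 ≤ p) {φ : X × X → ℂ} {C : ℝ≥0} (h : IsCBSchurBound p μ φ C)
    (hS : ∀ γ, MeasurableSet (S γ)) (hd : Pairwise (Function.onFun Disjoint S))
    (ha : 0 < a) (hμ : ∀ γ, μ (S γ) = ENNReal.ofReal a) {ψ : Λ × Λ → ℂ}
    (hψ : ∀ γ γ', ψ (γ, γ') = ((a : ℂ) ^ 2)⁻¹ * ∫ z in S γ ×ˢ S γ', φ z ∂(μ.prod μ))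
    (hψb : MemLp ψ ∞ (ν.prod ν)) :
    IsCBSchurBound p ν ψ C := by
  refine ⟨hψb, fun K _ _ _ n A A' B hA hA' hB => ?_⟩
  simp only [tensorOp_eq_tensorMap]
  have hs := orthonormal_normalizedIndicator ha hS hμ hd
  have hb := (pointBasis hc hν).orthonormal
  have hcompact := isCompactOperator_sum Finset.univ fun i => isCompactOperator_tensorMap
    (hA' i).isCompactOperator (isCompactOperator_of_memSchatten hp (hB i))
  refine schattenNorm_le_of_forall_compression hp (l := atTop)
    (Q := fun E => tensorMap (partialIsometry (pointBasis hc hν) (pointBasis hc hν) E)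
      (ContinuousLinearMap.id ℂ K)) hcompact (fun E => ?_) (fun z => ?_) fun E => ?_
  · exact adjoint_tensorMap_partialIsometry_id _ _ E
  · exact tendsto_tensorMap_id (norm_sum_rankOne_self_le hb)
      (tendsto_sum_rankOne_self (pointBasis hc hν)) z
  choose D hD hDinner using fun i => exists_isSchurImage_sum_rankOne_normalizedIndicator h.1
    ha.le hS hμ hd E fun γ γ' => ⟪pointBasis hc hν γ, A i (pointBasis hc hν γ')⟫_ℂ
  simp only [← partialIsometry_conj] at hD
  have hcompress : ∀ i, partialIsometry (pointBasis hc hν) (pointBasis hc hν) E ∘L A' i ∘L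
        partialIsometry (pointBasis hc hν) (pointBasis hc hν) E =
      partialIsometry (pointBasis hc hν) (normalizedIndicator hS hμ) E ∘L D i ∘L
        partialIsometry (normalizedIndicator hS hμ) (pointBasis hc hν) E := fun i => by
    rw [partialIsometry_conj, partialIsometry_conj]
    refine Finset.sum_congr rfl fun γ hγ => Finset.sum_congr rfl fun γ' hγ' => ?_
    rw [hDinner i γ hγ γ' hγ', (hA' i).inner_eq hc hν, hψ]
  have hAmem : ∀ i, MemSchatten p (partialIsometry (normalizedIndicator hS hμ) (pointBasis hc hν) E
      ∘L A i ∘L partialIsometry (pointBasis hc hν) (normalizedIndicator hS hμ) E) := fun i => by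
    have hV := norm_partialIsometry_le_one hb hs E
    have hle := schattenNorm_conj_le hp (A i) hV hV
    rw [adjoint_partialIsometry] at hle
    exact hle.trans_lt (hA i)
  have hbound := h.bound_sum Finset.univ hAmem hD hB
  rw [tensorMap_id_comp_sum_comp, Finset.sum_congr rfl fun i _ => by rw [hcompress i]]
  exact (schattenNorm_sum_tensorMap_conj_le hp hb hs E _ D B).trans <| hbound.trans <|
    mul_le_mul_right (schattenNorm_sum_tensorMap_conj_le hp hs hb E _ A B) _

end Sampling

/-! ### Coefficients of the regular representation -/

section Intertwiner

theorem mapsTo_topologicalClosure_span {E : Type*} [NormedAddCommGroup E] [NormedSpace ℂ E]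
    {A : E →L[ℂ] E} {s : Set E} (h : Set.MapsTo A s s) :
    Set.MapsTo A (Submodule.span ℂ s).topologicalClosure (Submodule.span ℂ s).topologicalClosure :=
  Set.MapsTo.closure (fun _ hx => Submodule.span_mono h.image_subset
    (Submodule.map_span A.toLinearMap s ▸ Submodule.mem_map_of_mem hx)) A.continuous

variable {H L : Type*} [NormedAddCommGroup H] [InnerProductSpace ℂ H] [CompleteSpace H]
  [NormedAddCommGroup L] [InnerProductSpace ℂ L] [CompleteSpace L]

theorem norm_sqrt_adjoint_comp_self_apply (S : H →L[ℂ] L) (x : H) :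
    ‖CFC.sqrt (S† ∘L S) x‖ = ‖S x‖ := by
  have hpos : 0 ≤ S† ∘L S :=
    (ContinuousLinearMap.nonneg_iff_isPositive _).2 (S.isPositive_adjoint_comp_self)
  rw [← sq_eq_sq₀ (norm_nonneg _) (norm_nonneg _), norm_sqrt_apply_sq hpos,
    ContinuousLinearMap.comp_apply, ContinuousLinearMap.adjoint_inner_right]
  exact inner_self_eq_norm_sq (𝕜 := ℂ) (S x)

theorem denseRange_of_isSelfAdjoint_of_injective {T : H →L[ℂ] H} (hT : IsSelfAdjoint T)
    (hinj : Function.Injective T) : DenseRange T := by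
  refine Submodule.dense_iff_topologicalClosure_eq_top (s := T.range) |>.2 ?_
  rw [Submodule.topologicalClosure_eq_top_iff, T.orthogonal_range, hT.adjoint_eq]
  exact LinearMap.ker_eq_bot.2 hinj

theorem exists_isometry_intertwining (S : H →L[ℂ] L) (hS : Function.Injective S) :
    ∃ W : H →ₗᵢ[ℂ] L, ∀ (A : H →L[ℂ] H) (B : L →L[ℂ] L), S ∘L A = B ∘L S →
      S ∘L A† = B† ∘L S → ∀ x, W (A x) = B (W x) := by
  set T := CFC.sqrt (S† ∘L S) with hTdef
  have hnorm : ∀ x, ‖S x‖ = ‖T x‖ := fun x => (norm_sqrt_adjoint_comp_self_apply S x).symm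
  obtain ⟨W, -, hWT⟩ := exists_contraction_comp_eq S T fun x => (hnorm x).le
  have hWT_apply : ∀ x, W (T x) = S x := DFunLike.congr_fun hWT
  have hdense : DenseRange T := by
    refine denseRange_of_isSelfAdjoint_of_injective (CFC.sqrt_nonneg _).isSelfAdjoint
      ((injective_iff_map_eq_zero T).2 fun x hx => ?_)
    rw [← norm_eq_zero, ← hnorm, norm_eq_zero] at hx
    exact hS (hx.trans (map_zero S).symm)
  have hisometry : ∀ x, ‖W x‖ = ‖x‖ := fun x => by
    refine hdense.induction_on (p := fun x => ‖W x‖ = ‖x‖) x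
      (isClosed_eq (by fun_prop) (by fun_prop)) fun y => ?_
    rw [hWT_apply, hnorm]
  refine ⟨⟨W.toLinearMap, hisometry⟩, fun A B hAB hAB' x => ?_⟩
  have hcomm : Commute (S† ∘L S) A := by
    have hadj := congrArg (·†) hAB'
    simp only [ContinuousLinearMap.adjoint_comp, ContinuousLinearMap.adjoint_adjoint] at hadj
    change (S† ∘L S) ∘L A = A ∘L (S† ∘L S)
    rw [ContinuousLinearMap.comp_assoc, hAB, ← ContinuousLinearMap.comp_assoc, ← hadj,
      ContinuousLinearMap.comp_assoc]
  have hcommT : ∀ x, T (A x) = A (T x) := by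
    have hsqrt : Commute T A := by
      rw [hTdef, CFC.sqrt]
      exact hcomm.cfcₙ_nnreal _
    exact DFunLike.congr_fun hsqrt
  refine hdense.induction_on (p := fun x => W (A x) = B (W x)) x
    (isClosed_eq (by fun_prop) (by fun_prop)) fun y => ?_
  rw [← hcommT, hWT_apply, hWT_apply]
  exact DFunLike.congr_fun hAB y

/-- The operator `A ⊕ B` on the Hilbert space direct sum of `L` and `H`. -/
noncomputable def directSumMap (A : L →L[ℂ] L) (B : H →L[ℂ] H) :
    WithLp 2 (L × H) →L[ℂ] WithLp 2 (L × H) :=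
  (WithLp.prodContinuousLinearEquiv 2 ℂ L H).symm ∘L A.prodMap B ∘L
    WithLp.prodContinuousLinearEquiv 2 ℂ L H

theorem adjoint_directSumMap (A : L →L[ℂ] L) (B : H →L[ℂ] H) :
    (directSumMap A B)† = directSumMap (A†) (B†) := by
  refine ((ContinuousLinearMap.eq_adjoint_iff _ _).2 fun z w => ?_).symm
  simp [directSumMap, ContinuousLinearMap.adjoint_inner_left]

theorem adjoint_restrict {V : Submodule ℂ H} [CompleteSpace V] {A : H →L[ℂ] H}
    (hA : Set.MapsTo A V V) (hA' : Set.MapsTo (A†) V V) : (A.restrict hA)† = A†.restrict hA' := by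
  refine ((ContinuousLinearMap.eq_adjoint_iff _ _).2 fun z w => ?_).symm
  exact A.adjoint_inner_left w z

variable {Λ : Type*} [Group Λ] {π : Λ →* (H →L[ℂ] H)} {ρ : Λ →* (L →L[ℂ] L)}

/-- The closed invariant subspace of `L ⊕ H` generated by `(δ, ξ)`, which is the graph of a closed
intertwiner `ρ g δ ↦ π g ξ` when its first projection is injective. -/
noncomputable def orbitGraph (π : Λ →* (H →L[ℂ] H)) (ρ : Λ →* (L →L[ℂ] L)) (ξ : H) (δ : L) :
    Submodule ℂ (WithLp 2 (L × H)) :=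
  (Submodule.span ℂ (Set.range fun g => WithLp.toLp 2 (ρ g δ, π g ξ))).topologicalClosure

section OrbitGraph

variable {H L : Type*} [NormedAddCommGroup H] [InnerProductSpace ℂ H] [NormedAddCommGroup L]
  [InnerProductSpace ℂ L] {Λ : Type*} [Group Λ] {π : Λ →* (H →L[ℂ] H)} {ρ : Λ →* (L →L[ℂ] L)}
  {ξ : H} {δ : L}

theorem toLp_mem_orbitGraph (g : Λ) : WithLp.toLp 2 (ρ g δ, π g ξ) ∈ orbitGraph π ρ ξ δ :=
  Submodule.le_topologicalClosure _ (Submodule.subset_span ⟨g, rfl⟩)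

theorem mapsTo_orbitGraph (π : Λ →* (H →L[ℂ] H)) (ρ : Λ →* (L →L[ℂ] L)) (ξ : H) (δ : L) (g : Λ) :
    Set.MapsTo (directSumMap (ρ g) (π g)) (orbitGraph π ρ ξ δ) (orbitGraph π ρ ξ δ) := by
  refine mapsTo_topologicalClosure_span ?_
  rintro _ ⟨g', rfl⟩
  exact ⟨g * g', by simp [directSumMap]⟩

theorem inner_fst_eq_inner_snd_of_mem_orbitGraph {v : L} {ζ : H}
    (h : ∀ g, ⟪v, ρ g δ⟫_ℂ = ⟪ζ, π g ξ⟫_ℂ) {z : WithLp 2 (L × H)} (hz : z ∈ orbitGraph π ρ ξ δ) :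
    ⟪v, z.fst⟫_ℂ = ⟪ζ, z.snd⟫_ℂ := by
  have hle : orbitGraph π ρ ξ δ ≤ LinearMap.eqLocus
      (innerSL ℂ v ∘L WithLp.fstL 2 ℂ L H).toLinearMap
      (innerSL ℂ ζ ∘L WithLp.sndL 2 ℂ L H).toLinearMap := by
    refine Submodule.topologicalClosure_minimal _ (Submodule.span_le.2 ?_)
      (isClosed_eq (ContinuousLinearMap.continuous _) (ContinuousLinearMap.continuous _))
    rintro _ ⟨g, rfl⟩
    exact h g
  exact hle hz

end OrbitGraph

theorem exists_coefficient_eq (hπ : ∀ g, (π g)† = π g⁻¹) (hρ : ∀ g, (ρ g)† = ρ g⁻¹) {D : Set H}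
    (hD : ∀ y, (∀ ζ ∈ D, ⟪ζ, y⟫_ℂ = 0) → y = 0) {ξ : H} {δ : L}
    (hξ : ∀ ζ ∈ D, ∃ v : L, ∀ g, ⟪v, ρ g δ⟫_ℂ = ⟪ζ, π g ξ⟫_ℂ) (η : H) :
    ∃ f h : L, ∀ g, ⟪η, π g ξ⟫_ℂ = ⟪h, ρ g f⟫_ℂ := by
  let 𝒢 := orbitGraph π ρ ξ δ
  have : CompleteSpace 𝒢 := (Submodule.isClosed_topologicalClosure _).completeSpace_coe
  let S : 𝒢 →L[ℂ] L := WithLp.fstL 2 ℂ L H ∘L 𝒢.subtypeL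
  let R : 𝒢 →L[ℂ] H := WithLp.sndL 2 ℂ L H ∘L 𝒢.subtypeL
  let P (g : Λ) : 𝒢 →L[ℂ] 𝒢 := (directSumMap (ρ g) (π g)).restrict (mapsTo_orbitGraph π ρ ξ δ g)
  have hadj : ∀ g, directSumMap (ρ g⁻¹) (π g⁻¹) = (directSumMap (ρ g) (π g))† := fun g => by
    rw [adjoint_directSumMap, hπ, hρ]
  have hPadj : ∀ g, (P g)† = P g⁻¹ := fun g => by
    rw [adjoint_restrict _ (hadj g ▸ mapsTo_orbitGraph π ρ ξ δ g⁻¹)]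
    simp only [P, hadj]
  have hS : Function.Injective S := by
    refine (injective_iff_map_eq_zero S).2 fun z hz => Subtype.ext (WithLp.ofLp_injective 2
      (Prod.ext hz (hD _ fun ζ hζ => ?_)))
    obtain ⟨v, hv⟩ := hξ ζ hζ
    refine (inner_fst_eq_inner_snd_of_mem_orbitGraph hv z.2).symm.trans ?_
    exact (congrArg (⟪v, ·⟫_ℂ) hz).trans (inner_zero_right v)
  have hSP : ∀ g, S ∘L P g = ρ g ∘L S := fun g => rfl
  obtain ⟨W, hW⟩ := exists_isometry_intertwining S hS
  let x : 𝒢 := ⟨WithLp.toLp 2 (ρ 1 δ, π 1 ξ), toLp_mem_orbitGraph 1⟩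
  refine ⟨W x, W ((R†) η), fun g => ?_⟩
  rw [← hW (P g) (ρ g) (hSP g) (by rw [hPadj, hρ, hSP]), W.inner_map_map,
    ContinuousLinearMap.adjoint_inner_left]
  change _ = ⟪η, π g (π 1 ξ)⟫_ℂ
  rw [map_one]
  rfl

end Intertwiner

section Translation

variable {G : Type*} [Group G] [MeasurableSpace G] [MeasurableMul G] (μ : Measure G)
  [μ.IsMulLeftInvariant]

/-- The left regular representation `(λ(g) f)(x) = f(g⁻¹ x)` on `L²(G, μ)`. -/
noncomputable def leftTranslation : G →* (Lp ℂ 2 μ →L[ℂ] Lp ℂ 2 μ) where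
  toFun g := (Lp.compMeasurePreservingₗᵢ ℂ (g⁻¹ * ·)
    (measurePreserving_mul_left μ g⁻¹)).toContinuousLinearMap
  map_one' := by
    ext1 f
    refine Lp.ext ?_
    filter_upwards [Lp.coeFn_compMeasurePreserving f (measurePreserving_mul_left μ (1 : G)⁻¹)]
      with x hx
    exact hx.trans (by simp)
  map_mul' g g' := by
    ext1 f
    refine Lp.ext ?_
    filter_upwards [Lp.coeFn_compMeasurePreserving f (measurePreserving_mul_left μ (g * g')⁻¹),
      Lp.coeFn_compMeasurePreserving (Lp.compMeasurePreserving _ (measurePreserving_mul_left μ g'⁻¹)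
        f) (measurePreserving_mul_left μ g⁻¹),
      (measurePreserving_mul_left μ g⁻¹).quasiMeasurePreserving.ae
        (Lp.coeFn_compMeasurePreserving f (measurePreserving_mul_left μ g'⁻¹))] with x h₁ h₂ h₃
    refine h₁.trans (Eq.symm ((h₂.trans h₃).trans ?_))
    simp only [Function.comp_apply, mul_inv_rev, mul_assoc]

theorem leftTranslation_ae_eq (g : G) (f : Lp ℂ 2 μ) :
    leftTranslation μ g f =ᵐ[μ] fun x => f (g⁻¹ * x) :=
  Lp.coeFn_compMeasurePreserving f (measurePreserving_mul_left μ g⁻¹)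

theorem norm_leftTranslation (g : G) (f : Lp ℂ 2 μ) : ‖leftTranslation μ g f‖ = ‖f‖ :=
  Lp.norm_compMeasurePreserving f (measurePreserving_mul_left μ g⁻¹)

theorem inner_leftTranslation (g : G) (f h : Lp ℂ 2 μ) :
    ⟪leftTranslation μ g f, leftTranslation μ g h⟫_ℂ = ⟪f, h⟫_ℂ :=
  (Lp.compMeasurePreservingₗᵢ ℂ (g⁻¹ * ·) (measurePreserving_mul_left μ g⁻¹)).inner_map_map f h

theorem adjoint_leftTranslation (g : G) : (leftTranslation μ g)† = leftTranslation μ g⁻¹ := by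
  refine ((ContinuousLinearMap.eq_adjoint_iff _ _).2 fun f h => ?_).symm
  rw [← inner_leftTranslation μ g, ← mul_apply_eq_comp, ← map_mul, mul_inv_cancel, map_one,
    one_apply_eq_self]

variable {μ}

theorem inner_leftTranslation_toLp {f h : G → ℂ} (hf : MemLp f 2 μ) (hh : MemLp h 2 μ) (g : G) :
    ⟪hh.toLp h, leftTranslation μ g (hf.toLp f)⟫_ℂ = ∫ x, f (g⁻¹ * x) * conj (h x) ∂μ := by
  rw [inner_toLp_left]
  refine integral_congr_ae ?_
  filter_upwards [leftTranslation_ae_eq μ g (hf.toLp f),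
    (measurePreserving_mul_left μ g⁻¹).quasiMeasurePreserving.ae hf.coeFn_toLp] with x hx hfx
  rw [hx, hfx, mul_comm]

theorem memFourierAlgebra_iff {φ : G → ℂ} :
    MemFourierAlgebra μ φ ↔ ∃ f h : Lp ℂ 2 μ, ∀ g, φ g = ⟪h, leftTranslation μ g f⟫_ℂ := by
  refine ⟨fun ⟨f, h, hf, hh, hφ⟩ => ⟨hf.toLp f, hh.toLp h, fun g => ?_⟩,
    fun ⟨f, h, hφ⟩ => ⟨f, h, Lp.memLp f, Lp.memLp h, fun g => ?_⟩⟩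
  · rw [hφ, inner_leftTranslation_toLp]
  · rw [hφ, ← inner_leftTranslation_toLp (Lp.memLp f) (Lp.memLp h), Lp.toLp_coeFn, Lp.toLp_coeFn]

theorem MemFourierAlgebra.exists_norm_le {φ : G → ℂ} (h : MemFourierAlgebra μ φ) :
    ∃ M : ℝ, ∀ g, ‖φ g‖ ≤ M := by
  obtain ⟨f, k, hφ⟩ := memFourierAlgebra_iff.1 h
  refine ⟨‖k‖ * ‖f‖, fun g => ?_⟩
  rw [hφ, ← norm_leftTranslation μ g f]
  exact norm_inner_le_norm _ _

end Translation

section Restriction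

variable {G : Type*} [Group G] [MeasurableSpace G] [MeasurableMul G] {Γ : Subgroup G}

theorem fiberProj_leftTranslation [MeasurableSingletonClass Γ] {μ : Measure G}
    [μ.IsMulLeftInvariant] {κ : G → Γ} (hκ : Measurable κ)
    (hκm : ∀ (γ : Γ) x, κ (γ * x) = γ * κ x) (γ γ' : Γ) (f : Lp ℂ 2 μ) :
    fiberProj μ hκ γ (leftTranslation μ (γ' : G) f)
      = leftTranslation μ (γ' : G) (fiberProj μ hκ (γ'⁻¹ * γ) f) := by
  classical
  refine Lp.ext ?_
  filter_upwards [fiberProj_ae_eq hκ γ (leftTranslation μ (γ' : G) f),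
    leftTranslation_ae_eq μ (γ' : G) f,
    leftTranslation_ae_eq μ (γ' : G) (fiberProj μ hκ (γ'⁻¹ * γ) f),
    (measurePreserving_mul_left μ (γ' : G)⁻¹).quasiMeasurePreserving.ae
      (fiberProj_ae_eq hκ (γ'⁻¹ * γ) f)] with x h₁ h₂ h₃ h₄
  have hmem : (γ' : G)⁻¹ * x ∈ κ ⁻¹' {γ'⁻¹ * γ} ↔ x ∈ κ ⁻¹' {γ} := by
    have hκx : κ ((γ' : G)⁻¹ * x) = γ'⁻¹ * κ x := hκm γ'⁻¹ x
    simp only [Set.mem_preimage, Set.mem_singleton_iff, hκx, mul_right_inj]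
  rw [h₁, h₃, h₄, Set.indicator_apply, Set.indicator_apply, h₂]
  exact if_congr hmem.symm rfl rfl

theorem eq_zero_of_forall_fiberProj_eq_zero {X Λ : Type*} [MeasurableSpace X] {μ : Measure X}
    [MeasurableSpace Λ] [MeasurableSingletonClass Λ] [Countable Λ] {q : X → Λ} (hq : Measurable q)
    {f : Lp ℂ 2 μ} (hf : ∀ γ, fiberProj μ hq γ f = 0) : f = 0 := by
  refine tendsto_nhds_unique (tendsto_sum_fiberProj hq f) (tendsto_const_nhds.congr fun E => ?_)
  rw [sum_apply, Finset.sum_eq_zero fun γ _ => hf γ]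

theorem memℓp_inner_leftTranslation [MeasurableSingletonClass Γ] {μ : Measure G}
    [μ.IsMulLeftInvariant] {κ : G → Γ} (hκ : Measurable κ)
    (hκm : ∀ (γ : Γ) x, κ (γ * x) = γ * κ x) {γ : Γ} {ζ : Lp ℂ 2 μ}
    (hζ : fiberProj μ hκ γ ζ = ζ) (f : Lp ℂ 2 μ) :
    Memℓp (fun g : Γ => ⟪leftTranslation μ (g : G) f, ζ⟫_ℂ) 2 := by
  have hbound : ∀ g : Γ,
      ‖⟪leftTranslation μ (g : G) f, ζ⟫_ℂ‖ ≤ ‖fiberProj μ hκ (g⁻¹ * γ) f‖ * ‖ζ‖ := fun g => by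
    rw [← hζ, ← ContinuousLinearMap.adjoint_inner_left, (isSelfAdjoint_fiberProj hκ γ).adjoint_eq,
      fiberProj_leftTranslation hκ hκm, hζ, ← norm_leftTranslation μ (g : G)]
    exact norm_inner_le_norm _ _
  refine memℓp_gen' (C := ‖f‖ ^ 2 * ‖ζ‖ ^ 2) fun E => ?_
  classical
  calc ∑ g ∈ E, ‖⟪leftTranslation μ (g : G) f, ζ⟫_ℂ‖ ^ (2 : ℝ≥0∞).toReal
      ≤ ∑ g ∈ E, ‖fiberProj μ hκ (g⁻¹ * γ) f‖ ^ 2 * ‖ζ‖ ^ 2 :=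
        Finset.sum_le_sum fun g _ => by
          rw [ENNReal.toReal_ofNat, Real.rpow_ofNat, ← mul_pow]
          exact pow_le_pow_left₀ (norm_nonneg _) (hbound g) 2
    _ = (∑ γ' ∈ E.image (·⁻¹ * γ), ‖fiberProj μ hκ γ' f‖ ^ 2) * ‖ζ‖ ^ 2 := by
        rw [Finset.sum_image fun x _ y _ hxy => by simpa using hxy, Finset.sum_mul]
    _ ≤ ‖f‖ ^ 2 * ‖ζ‖ ^ 2 := by
        gcongr
        exact sum_norm_sq_le (orthogonalIdempotents_fiberProj hκ) (isSelfAdjoint_fiberProj hκ) _ f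


theorem leftTranslation_pointBasis_one {Λ : Type u} [Group Λ] [MeasurableSpace Λ]
    [MeasurableSingletonClass Λ] [MeasurableMul Λ] {ν : Measure Λ} [ν.IsMulLeftInvariant] {c : ℝ}
    (hc : 0 < c) (hν : ∀ γ, ν {γ} = ENNReal.ofReal c) (γ : Λ) :
    leftTranslation ν γ (pointBasis hc hν 1) = pointBasis hc hν γ := by
  classical
  refine Lp.ext ((leftTranslation_ae_eq ν γ _).trans (Eventually.of_forall fun x => ?_))
  simp only [coe_pointBasis, pointMass_apply hc, Set.indicator_apply]
  exact if_congr (by simp [inv_mul_eq_one, eq_comm]) rfl rfl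

theorem MemFourierAlgebra.restrict [Countable Γ] [MeasurableSingletonClass Γ] {μ : Measure G}
    [μ.IsMulLeftInvariant] {ν : Measure Γ} [ν.IsMulLeftInvariant] {c : ℝ} (hc : 0 < c)
    (hν : ∀ γ, ν {γ} = ENNReal.ofReal c) {κ : G → Γ} (hκ : Measurable κ)
    (hκm : ∀ (γ : Γ) x, κ (γ * x) = γ * κ x) {φ : G → ℂ} (hφ : MemFourierAlgebra μ φ) :
    MemFourierAlgebra ν fun γ => φ γ := by
  obtain ⟨f, h, hφ⟩ := memFourierAlgebra_iff.1 hφ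
  have htotal : ∀ y, (∀ ζ ∈ {ζ | ∃ γ, fiberProj μ hκ γ ζ = ζ}, ⟪ζ, y⟫_ℂ = 0) → y = 0 :=
    fun y hy => eq_zero_of_forall_fiberProj_eq_zero hκ fun γ => by
      refine inner_self_eq_zero (𝕜 := ℂ) |>.1 ?_
      have hidem : fiberProj μ hκ γ (fiberProj μ hκ γ y) = fiberProj μ hκ γ y :=
        DFunLike.congr_fun ((orthogonalIdempotents_fiberProj hκ).idem γ) y
      rw [← ContinuousLinearMap.adjoint_inner_left, (isSelfAdjoint_fiberProj hκ γ).adjoint_eq,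
        hidem]
      exact hy _ ⟨γ, hidem⟩
  obtain ⟨f', h', hfh⟩ := exists_coefficient_eq (π := (leftTranslation μ).comp Γ.subtype)
    (ρ := leftTranslation ν) (fun γ => adjoint_leftTranslation μ (γ : G))
    (adjoint_leftTranslation ν) htotal (ξ := f) (δ := pointBasis hc hν 1) (fun ζ ⟨γ, hζ⟩ =>
      ⟨(pointBasis hc hν).repr.symm ⟨_, memℓp_inner_leftTranslation hκ hκm hζ f⟩, fun g => by
        rw [leftTranslation_pointBasis_one, ← inner_conj_symm, ← HilbertBasis.repr_apply_apply,
          LinearIsometryEquiv.apply_symm_apply]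
        exact inner_conj_symm _ _⟩) h
  exact memFourierAlgebra_iff.2 ⟨f', h', fun γ => (hφ γ).trans (hfh γ)⟩

end Restriction

/-! ### Fundamental domains and unimodularity -/

section FundamentalDomain

variable {G : Type u} [Group G] [TopologicalSpace G] {Γ : Subgroup G}

theorem exists_isOpen_forall_mul_mem_imp_eq_one [IsTopologicalGroup G] (Γ : Subgroup G)
    [DiscreteTopology Γ] :
    ∃ U : Set G, IsOpen U ∧ 1 ∈ U ∧ ∀ (γ : Γ) x, x ∈ U → γ * x ∈ U → γ = 1 := by
  obtain ⟨W, hW, hWΓ⟩ :=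
    nhds_inter_eq_singleton_of_mem_discrete (SetLike.isDiscrete_iff_discreteTopology.2 ‹_›)
      Γ.one_mem
  obtain ⟨V, hV, hVW⟩ := exists_nhds_split_inv hW
  obtain ⟨U, hUV, hU, h1U⟩ := mem_nhds_iff.1 hV
  refine ⟨U, hU, h1U, fun γ x hx hγx => Subtype.ext ?_⟩
  have hγ : (γ : G) ∈ W ∩ Γ := ⟨by simpa using hVW _ (hUV hγx) _ (hUV hx), γ.2⟩
  rwa [hWΓ] at hγ

theorem exists_isOpen_cover_forall_mul_mem_imp_eq_one [IsTopologicalGroup G]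
    [SecondCountableTopology G] (Γ : Subgroup G) [DiscreteTopology Γ] :
    ∃ V : ℕ → Set G, (∀ n, IsOpen (V n)) ∧ (∀ x, ∃ n, x ∈ V n) ∧
      ∀ n (γ : Γ) x, x ∈ V n → γ * x ∈ V n → γ = 1 := by
  obtain ⟨U, hU, h1U, hUΓ⟩ := exists_isOpen_forall_mul_mem_imp_eq_one Γ
  let d := TopologicalSpace.denseSeq G
  refine ⟨fun n => {x | x * (d n)⁻¹ ∈ U}, fun n => hU.preimage (by fun_prop), fun x => ?_,
    fun n γ x hx hγx => hUΓ γ _ hx (by simpa [mul_assoc] using hγx)⟩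
  obtain ⟨_, hy, n, rfl⟩ := (TopologicalSpace.denseRange_denseSeq G).inter_open_nonempty
    {y | x * y⁻¹ ∈ U} (hU.preimage (by fun_prop)) ⟨x, by simpa using h1U⟩
  exact ⟨n, hy⟩

variable [MeasurableSpace G] [BorelSpace G]

-- The sets `V n` of a countable cover meet each orbit at most once; an orbit is represented by its
-- point in the first `V n` that it meets.
theorem exists_measurableSet_existsUnique_inv_mul_mem [IsTopologicalGroup G]
    [SecondCountableTopology G] (Γ : Subgroup G) [DiscreteTopology Γ] [Countable Γ] :
    ∃ F : Set G, MeasurableSet F ∧ ∀ x, ∃! γ : Γ, (γ : G)⁻¹ * x ∈ F := by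
  obtain ⟨V, hVo, hVcover, hV⟩ := exists_isOpen_cover_forall_mul_mem_imp_eq_one Γ
  have hmeas : ∀ (γ : Γ) n, MeasurableSet {x | (γ : G) * x ∈ V n} := fun γ n =>
    ((hVo n).preimage (continuous_const_mul (γ : G))).measurableSet
  refine ⟨⋃ n, V n \ ⋃ m < n, ⋃ γ : Γ, {x | (γ : G) * x ∈ V m},
    .iUnion fun n => (hVo n).measurableSet.diff <| .iUnion fun m => .iUnion fun _ =>
      .iUnion fun γ => hmeas γ m, fun x => ?_⟩
  classical
  have hex : ∃ n, ∃ γ : Γ, (γ : G) * x ∈ V n := by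
    obtain ⟨n, hn⟩ := hVcover x
    exact ⟨n, 1, by simpa using hn⟩
  have hF : ∀ γ : Γ, ((γ : G)⁻¹ * x ∈ ⋃ n, V n \ ⋃ m < n, ⋃ γ : Γ, {x | (γ : G) * x ∈ V m}) ↔
      (γ : G)⁻¹ * x ∈ V (Nat.find hex) := fun γ => by
    simp only [Set.mem_iUnion, Set.mem_sdiff, not_exists, Set.mem_ofPred_eq]
    constructor
    · rintro ⟨n, hn, hmin⟩
      rwa [(Nat.find_eq_iff hex).2 ⟨⟨γ⁻¹, hn⟩, fun m hm ⟨δ, hδ⟩ =>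
        hmin m hm (δ * γ) (by simpa [mul_assoc] using hδ)⟩]
    · exact fun h => ⟨_, h, fun m hm δ hδ =>
        Nat.find_min hex hm ⟨δ * γ⁻¹, by simpa [mul_assoc] using hδ⟩⟩
  simp only [hF]
  obtain ⟨γ, hγ⟩ := Nat.find_spec hex
  refine ⟨γ⁻¹, by simpa using hγ, fun δ hδ => ?_⟩
  have h := hV _ (γ * δ) _ hδ (by simpa [mul_assoc] using hγ)
  exact eq_inv_of_mul_eq_one_right h

theorem exists_equivariant_map [IsTopologicalGroup G] [SecondCountableTopology G]
    [DiscreteTopology Γ] [Countable Γ] :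
    ∃ κ : G → Γ, Measurable κ ∧ ∀ (γ : Γ) x, κ (γ * x) = γ * κ x := by
  obtain ⟨F, hF, hFu⟩ := exists_measurableSet_existsUnique_inv_mul_mem Γ
  choose κ hκ hκu using hFu
  refine ⟨κ, measurable_to_countable' fun γ => ?_, fun γ x => ?_⟩
  · have hpre : κ ⁻¹' {γ} = (fun x => (γ : G)⁻¹ * x) ⁻¹' F := by
      ext x
      exact ⟨fun h => h ▸ hκ x, fun h => (hκu x γ h).symm⟩
    rw [hpre]
    exact measurable_const_mul _ hF
  · refine (hκu (γ * x) (γ * κ x) ?_).symm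
    simpa [mul_assoc] using hκ x

end FundamentalDomain

section FundamentalDomainMeasure

variable {G : Type u} [Group G] [MeasurableSpace G] {Γ : Subgroup G} [MeasurableSingletonClass Γ]
  {μ : Measure G} {κ : G → Γ}

theorem isFundamentalDomain_preimage_one (hκ : Measurable κ)
    (hκm : ∀ (γ : Γ) x, κ (γ * x) = γ * κ x) : IsFundamentalDomain Γ (κ ⁻¹' {1}) μ := by
  refine .mk' (hκ (measurableSet_singleton 1)).nullMeasurableSet fun x =>
    ⟨(κ x)⁻¹, ?_, fun γ hγ => ?_⟩
  · change κ (((κ x)⁻¹ : Γ) * x) = 1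
    rw [hκm, inv_mul_cancel]
  · replace hγ : κ (γ * x) = 1 := hγ
    rw [hκm] at hγ
    exact eq_inv_of_mul_eq_one_left hγ

variable [Countable Γ] [μ.IsMulLeftInvariant]

theorem measure_preimage_one_ne_zero [NeZero μ] (hκ : Measurable κ)
    (hκm : ∀ (γ : Γ) x, κ (γ * x) = γ * κ x) : μ (κ ⁻¹' {1}) ≠ 0 :=
  (isFundamentalDomain_preimage_one hκ hκm).measure_ne_zero (NeZero.ne μ)

variable [TopologicalSpace G] [MeasurableMul G]

theorem measure_preimage_one_ne_top (hΓ : IsLattice Γ μ) (hκ : Measurable κ)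
    (hκm : ∀ (γ : Γ) x, κ (γ * x) = γ * κ x) : μ (κ ⁻¹' {1}) ≠ ∞ := by
  obtain ⟨F, hF, hfin⟩ := hΓ.finite_covolume
  rw [(isFundamentalDomain_preimage_one hκ hκm).measure_eq hF]
  exact hfin.ne

end FundamentalDomainMeasure

section Unimodular

variable {G : Type u} [Group G] [TopologicalSpace G] [IsTopologicalGroup G] [MeasurableSpace G]
  [BorelSpace G] [LocallyCompactSpace G] [SecondCountableTopology G] {μ : Measure G}
  [μ.IsHaarMeasure]

-- Right translation multiplies `μ` by a scalar, and it maps a fundamental domain of `Γ` to another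
-- one, which has the same finite measure; so the scalar is `1`.
theorem isMulRightInvariant_of_isLattice {Γ : Subgroup G} [Countable Γ]
    [MeasurableSingletonClass Γ] {κ : G → Γ} (hΓ : IsLattice Γ μ) (hκ : Measurable κ)
    (hκm : ∀ (γ : Γ) x, κ (γ * x) = γ * κ x) : μ.IsMulRightInvariant := by
  refine ⟨fun g => ?_⟩
  have hsmul := Measure.isMulLeftInvariant_eq_smul (Measure.map (· * g) μ) μ
  have hmap : Measure.map (· * g) μ (κ ⁻¹' {1}) = μ (κ ⁻¹' {1}) := by
    rw [Measure.map_apply (measurable_mul_const g) (hκ (measurableSet_singleton 1))]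
    exact (isFundamentalDomain_preimage_one (κ := fun x => κ (x * g))
      (hκ.comp (measurable_mul_const g)) fun γ x => by rw [mul_assoc, hκm]).measure_eq
      (isFundamentalDomain_preimage_one hκ hκm)
  have hone : Measure.haarScalarFactor (Measure.map (· * g) μ) μ = 1 := by
    rw [hsmul, Measure.smul_apply] at hmap
    exact_mod_cast (ENNReal.mul_eq_right (measure_preimage_one_ne_zero hκ hκm)
      (measure_preimage_one_ne_top hΓ hκ hκm)).1 hmap
  rw [hsmul, hone, one_smul]

theorem isInvInvariant_of_isMulRightInvariant [μ.IsMulRightInvariant] : μ.IsInvInvariant := by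
  have hinv := Measure.isMulLeftInvariant_eq_smul μ.inv μ
  set c := Measure.haarScalarFactor μ.inv μ
  have hsq : (c * c) • μ = μ := by
    rw [← smul_smul, ← hinv, Measure.inv_def, ← Measure.map_smul, ← hinv, ← Measure.inv_def,
      Measure.inv_inv]
  obtain ⟨K, hK, hK1⟩ := exists_compact_mem_nhds (1 : G)
  have hK0 : μ K ≠ 0 := (Measure.measure_pos_of_mem_nhds μ hK1).ne'
  have hcc : c * c = 1 := by
    have hμK := congrArg (fun m : Measure G => m K) hsq
    exact_mod_cast (ENNReal.mul_eq_right hK0 hK.measure_ne_top).1 hμK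
  rw [← sq, pow_eq_one_iff_of_nonneg zero_le two_ne_zero] at hcc
  exact ⟨by rw [hinv, hcc, one_smul]⟩

end Unimodular

/-! ### Induction from the lattice -/

section DomainMeasure

variable {G : Type u} [Group G] {Γ : Subgroup G} {κ : G → Γ}

/-- The representative of the orbit `Γ x` in the fundamental domain `κ⁻¹(1)`. -/
def domainRep (κ : G → Γ) (x : G) : G :=
  (κ x : G)⁻¹ * x

theorem domainRep_mul (hκm : ∀ (γ : Γ) x, κ (γ * x) = γ * κ x) (γ : Γ) (x : G) :
    domainRep κ (γ * x) = domainRep κ x := by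
  simp only [domainRep, hκm, Subgroup.coe_mul]
  group

theorem mul_inv_domainRep (x : G) : x * (domainRep κ x)⁻¹ = κ x := by
  simp only [domainRep]
  group

variable [MeasurableSpace G]

theorem measurable_domainRep [MeasurableMul₂ G] [MeasurableInv G] (hκ : Measurable κ) :
    Measurable (domainRep κ) :=
  (measurable_subtype_coe.comp hκ).inv.mul measurable_id

variable {μ : Measure G}

/-- The normalized restriction of the Haar measure `μ` to the fundamental domain `κ⁻¹(1)`; it
represents the invariant probability measure of `Γ \ G`. -/
noncomputable def domainMeasure (μ : Measure G) (κ : G → Γ) : Measure G :=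
  (μ (κ ⁻¹' {1}))⁻¹ • μ.restrict (κ ⁻¹' {1})

variable [MeasurableSingletonClass Γ]

theorem ae_domainMeasure (hκ : Measurable κ) : ∀ᵐ y ∂(domainMeasure μ κ), κ y = 1 :=
  Measure.ae_smul_measure (ae_restrict_mem (hκ (measurableSet_singleton 1))) _

variable [Countable Γ] [MeasurableMul G] [μ.IsMulLeftInvariant]

theorem isProbabilityMeasure_domainMeasure [TopologicalSpace G] [NeZero μ] (hΓ : IsLattice Γ μ)
    (hκ : Measurable κ) (hκm : ∀ (γ : Γ) x, κ (γ * x) = γ * κ x) :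
    IsProbabilityMeasure (domainMeasure μ κ) :=
  ProbabilityTheory.cond_isProbabilityMeasure_of_finite (measure_preimage_one_ne_zero hκ hκm)
    (measure_preimage_one_ne_top hΓ hκ hκm)

theorem integral_domainMeasure_mul_right [μ.IsMulRightInvariant] (hκ : Measurable κ)
    (hκm : ∀ (γ : Γ) x, κ (γ * x) = γ * κ x) {E : Type*} [NormedAddCommGroup E] [NormedSpace ℝ E]
    {w : G → E} (hw : ∀ (γ : Γ) x, w (γ * x) = w x) (g : G) :
    ∫ y, w (y * g) ∂(domainMeasure μ κ) = ∫ y, w y ∂(domainMeasure μ κ) := by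
  rw [domainMeasure, integral_smul_measure, integral_smul_measure]
  congr 1
  let κ' : G → Γ := fun x => κ (x * g⁻¹)
  have hpre : (· * g) ⁻¹' (κ' ⁻¹' {1}) = κ ⁻¹' {1} := by
    ext x
    simp [κ']
  have hdomain : IsFundamentalDomain Γ (κ' ⁻¹' {1}) μ :=
    isFundamentalDomain_preimage_one (hκ.comp (measurable_mul_const g⁻¹)) fun γ x => by
      simp only [κ', mul_assoc, hκm]
  rw [← hdomain.setIntegral_eq (isFundamentalDomain_preimage_one hκ hκm) hw, ← hpre]
  exact (measurePreserving_mul_right μ g).setIntegral_preimage_emb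
    (measurableEmbedding_mulRight g) w _

theorem measureReal_domainMeasure_preimage_domainRep [MeasurableMul₂ G] [MeasurableInv G]
    [μ.IsMulRightInvariant] (hκ : Measurable κ) (hκm : ∀ (γ : Γ) x, κ (γ * x) = γ * κ x) (g : G)
    {S : Set G} (hS : MeasurableSet S) :
    (domainMeasure μ κ).real ((fun y => domainRep κ (y * g)) ⁻¹' S) =
      (domainMeasure μ κ).real S := by
  have hpre : MeasurableSet ((fun y => domainRep κ (y * g)) ⁻¹' S) :=
    (measurable_domainRep hκ).comp (measurable_mul_const g) hS
  rw [← integral_indicator_one hS, ← integral_indicator_one hpre]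
  refine (integral_domainMeasure_mul_right hκ hκm (w := S.indicator 1 ∘ domainRep κ)
    (fun γ x => congrArg (S.indicator 1) (domainRep_mul hκm γ x)) g).trans (integral_congr_ae ?_)
  filter_upwards [ae_domainMeasure hκ] with y hy
  simp [domainRep, hy]

end DomainMeasure

section Induction

variable {G : Type u} [Group G] [MeasurableSpace G] {Γ : Subgroup G} {μ : Measure G} {κ : G → Γ}

/-- The function on `G` induced from `φ : Γ → ℂ`: the average of `g ↦ φ (κ (y * g))` over `y` in
the fundamental domain `κ⁻¹(1)`. -/
noncomputable def induced (μ : Measure G) (κ : G → Γ) (φ : Γ → ℂ) (g : G) : ℂ :=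
  ∫ y, φ (κ (y * g)) ∂(domainMeasure μ κ)

variable [MeasurableSingletonClass Γ] [Countable Γ]

theorem herzSchurSymbol_induced [MeasurableMul G] [μ.IsMulLeftInvariant] [μ.IsMulRightInvariant]
    (hκ : Measurable κ) (hκm : ∀ (γ : Γ) x, κ (γ * x) = γ * κ x) (φ : Γ → ℂ) :
    herzSchurSymbol (induced μ κ φ) =
      fun z => ∫ y, herzSchurSymbol φ (κ (y * z.1), κ (y * z.2)) ∂(domainMeasure μ κ) := by
  funext z
  let w : G → ℂ := fun x => φ ((κ x)⁻¹ * κ (x * (z.1⁻¹ * z.2)))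
  have hw : ∀ (γ : Γ) x, w (γ * x) = w x := fun γ x => by
    simp only [w, mul_assoc (γ : G), hκm]
    group
  calc herzSchurSymbol (induced μ κ φ) z = ∫ y, w y ∂(domainMeasure μ κ) :=
        integral_congr_ae <| (ae_domainMeasure hκ).mono fun y hy => by simp [w, hy]
    _ = ∫ y, w (y * z.1) ∂(domainMeasure μ κ) :=
        (integral_domainMeasure_mul_right hκ hκm hw z.1).symm
    _ = _ := by simp [w, herzSchurSymbol, mul_assoc]

variable [TopologicalSpace G] [IsTopologicalGroup G] [SecondCountableTopology G]
  [LocallyCompactSpace G] [BorelSpace G] [μ.IsHaarMeasure]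

theorem cbSchurNorm_induced_le {ν : Measure Γ} [SFinite ν] {c : ℝ} (hc : 0 < c)
    (hν : ∀ γ, ν {γ} = ENNReal.ofReal c) (hΓ : IsLattice Γ μ) (hκ : Measurable κ)
    (hκm : ∀ (γ : Γ) x, κ (γ * x) = γ * κ x) {p : ℝ≥0∞} (hp : 1 ≤ p) {φ : Γ → ℂ} {C : ℝ≥0}
    (h : cbSchurNorm p ν (herzSchurSymbol φ) ≤ C) :
    cbSchurNorm p μ (herzSchurSymbol (induced μ κ φ)) ≤ C := by
  have := isMulRightInvariant_of_isLattice hΓ hκ hκm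
  have := isProbabilityMeasure_domainMeasure hΓ hκ hκm
  rw [cbSchurNorm_le_iff] at h ⊢
  intro C' hC'
  rw [herzSchurSymbol_induced hκ hκm]
  exact (h C' hC').average hc hν hp (zero_le.trans_lt hC') (q := fun y x => κ (y * x))
    (hκ.comp measurable_mul)

theorem measurePreserving_unfold {ν : Measure Γ} [SFinite ν] {c : ℝ}
    (hν : ∀ γ, ν {γ} = ENNReal.ofReal c) (hκ : Measurable κ)
    (hκm : ∀ (γ : Γ) x, κ (γ * x) = γ * κ x) :
    MeasurePreserving (fun z : Γ × G => (z.1 : G)⁻¹ * z.2) (ν.prod (μ.restrict (κ ⁻¹' {1})))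
      (ENNReal.ofReal c • μ) := by
  have hm : Measurable fun z : Γ × G => (z.1 : G)⁻¹ * z.2 := by fun_prop
  refine ⟨hm, Measure.ext fun s hs => ?_⟩
  rw [Measure.map_apply hm hs, Measure.prod_apply (hm hs), lintegral_countable',
    Measure.smul_apply, (isFundamentalDomain_preimage_one hκ hκm).measure_eq_tsum s, smul_eq_mul,
    ← ENNReal.tsum_mul_left]
  refine tsum_congr fun γ => ?_
  rw [hν, mul_comm, Measure.restrict_apply (measurable_prodMk_left (hm hs))]
  congr 2
  ext x
  simp only [Set.mem_inter_iff, Set.mem_preimage, Set.mem_smul_set_iff_inv_smul_mem]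
  rfl

theorem setIntegral_integral_eq_integral {ν : Measure Γ} [SFinite ν] {c : ℝ} (hc : 0 < c)
    (hν : ∀ γ, ν {γ} = ENNReal.ofReal c) (hκ : Measurable κ)
    (hκm : ∀ (γ : Γ) x, κ (γ * x) = γ * κ x) {I : G → ℂ} (hI : Integrable I μ) :
    ∫ y in κ ⁻¹' {1}, ∫ γ : Γ, I ((γ : G)⁻¹ * y) ∂ν ∂μ = c * ∫ y, I y ∂μ := by
  have hunf := measurePreserving_unfold (μ := μ) hν hκ hκm
  have hIc : Integrable I (ENNReal.ofReal c • μ) := hI.smul_measure ENNReal.ofReal_ne_top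
  calc ∫ y in κ ⁻¹' {1}, ∫ γ : Γ, I ((γ : G)⁻¹ * y) ∂ν ∂μ
      = ∫ z : Γ × G, I ((z.1 : G)⁻¹ * z.2) ∂(ν.prod (μ.restrict (κ ⁻¹' {1}))) :=
        (integral_prod_symm _ (hunf.integrable_comp_of_integrable hIc)).symm
    _ = ∫ y, I y ∂(ENNReal.ofReal c • μ) := by
        rw [← hunf.map_eq, integral_map hunf.aemeasurable]
        rw [hunf.map_eq]
        exact hIc.aestronglyMeasurable
    _ = c * ∫ y, I y ∂μ := by
        rw [integral_smul_measure, ENNReal.toReal_ofReal hc.le, Complex.real_smul]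

theorem memLp_comp_equivariant {ν : Measure Γ} [SFinite ν] {c : ℝ} (hc : 0 < c)
    (hν : ∀ γ, ν {γ} = ENNReal.ofReal c) (hΓ : IsLattice Γ μ) (hκ : Measurable κ)
    (hκm : ∀ (γ : Γ) x, κ (γ * x) = γ * κ x) {f : Γ → ℂ} (hf : MemLp f 2 ν) :
    MemLp (fun x => f (κ x)⁻¹) 2 μ := by
  have hc0 : ENNReal.ofReal c ≠ 0 := by simpa using hc
  have hunf := measurePreserving_unfold (μ := μ) hν hκ hκm
  have : IsFiniteMeasure (μ.restrict (κ ⁻¹' {1})) :=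
    ⟨by simpa using (measure_preimage_one_ne_top hΓ hκ hκm).lt_top⟩
  have hmeas : Measurable fun x => f (κ x)⁻¹ :=
    (Measurable.of_discrete (f := fun γ : Γ => f γ⁻¹)).comp hκ
  have hdomain : ∀ᵐ z : Γ × G ∂(ν.prod (μ.restrict (κ ⁻¹' {1}))), κ z.2 = 1 :=
    Measure.quasiMeasurePreserving_snd.ae (ae_restrict_mem (hκ (measurableSet_singleton 1)))
  have hsmul : MemLp (fun x => f (κ x)⁻¹) 2 (ENNReal.ofReal c • μ) := by
    rw [← hunf.map_eq, memLp_map_measure_iff hmeas.aestronglyMeasurable hunf.aemeasurable]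
    refine (hf.comp_fst (μ.restrict (κ ⁻¹' {1}))).ae_eq ?_
    filter_upwards [hdomain] with z hz
    have hzκ : κ ((z.1 : G)⁻¹ * z.2) = z.1⁻¹ * κ z.2 := hκm z.1⁻¹ z.2
    simp [hzκ, hz]
  refine hsmul.of_measure_le_smul (c := (ENNReal.ofReal c)⁻¹) (ENNReal.inv_ne_top.2 hc0) ?_
  rw [smul_smul, ENNReal.inv_mul_cancel hc0 ENNReal.ofReal_ne_top, one_smul]

-- If `φ(γ) = ⟪λ(γ) f, k⟫`, then unfolding the integral over the fundamental domain shows that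
-- `induced φ` is a multiple of the coefficient of the lifts of `f` and `k` to `G`.
theorem memFourierAlgebra_induced {ν : Measure Γ} [SFinite ν] {c : ℝ} (hc : 0 < c)
    (hν : ∀ γ, ν {γ} = ENNReal.ofReal c) (hΓ : IsLattice Γ μ) (hκ : Measurable κ)
    (hκm : ∀ (γ : Γ) x, κ (γ * x) = γ * κ x) {φ : Γ → ℂ} (h : MemFourierAlgebra ν φ) :
    MemFourierAlgebra μ (induced μ κ φ) := by
  have := isMulRightInvariant_of_isLattice hΓ hκ hκm
  have := isInvInvariant_of_isMulRightInvariant (μ := μ)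
  obtain ⟨f, k, hf, hk, hφ⟩ := h
  have hf' := memLp_comp_equivariant hc hν hΓ hκ hκm hf
  have hk' := memLp_comp_equivariant hc hν hΓ hκ hκm hk
  let a : ℂ := ((μ (κ ⁻¹' {1}))⁻¹.toReal * c : ℝ)
  refine ⟨fun x => a * f (κ x⁻¹)⁻¹, fun x => k (κ x⁻¹)⁻¹,
    (hf'.comp_measurePreserving (Measure.measurePreserving_inv μ)).const_mul a,
    hk'.comp_measurePreserving (Measure.measurePreserving_inv μ), fun g => ?_⟩
  let I : G → ℂ := fun y => f (κ (y * g))⁻¹ * conj (k (κ y)⁻¹)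
  have hI : Integrable I μ :=
    (hf'.comp_measurePreserving (measurePreserving_mul_right μ g)).integrable_mul hk'.star
  have hunfold : ∫ y in κ ⁻¹' {1}, φ (κ (y * g)) ∂μ = c * ∫ y, I y ∂μ := by
    rw [← setIntegral_integral_eq_integral hc hν hκ hκm hI]
    refine setIntegral_congr_fun (hκ (measurableSet_singleton 1)) fun y (hy : κ y = 1) => ?_
    have hyκ : ∀ (γ : Γ) x, κ ((γ : G)⁻¹ * x) = γ⁻¹ * κ x := fun γ => hκm γ⁻¹
    simp only [hφ, I, mul_assoc, hyκ, hy, mul_inv_rev, inv_inv, mul_one]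
  calc induced μ κ φ g = a * ∫ y, I y ∂μ := by
        rw [induced, domainMeasure, integral_smul_measure, hunfold, Complex.real_smul]
        push_cast [a]
        ring
    _ = a * ∫ x, I x⁻¹ ∂μ := by rw [integral_inv_eq_self I μ]
    _ = _ := by simp [I, ← integral_const_mul, mul_assoc]

end Induction

section InducedConvergence

open scoped Pointwise

theorem norm_integral_le_add_mul_measureReal {Ω E : Type*} [MeasurableSpace Ω] {P : Measure Ω}
    [IsProbabilityMeasure P] [NormedAddCommGroup E] [NormedSpace ℝ E] {f : Ω → E} {a b : ℝ}
    {B : Set Ω} (hB : MeasurableSet B) (ha : 0 ≤ a) (hb : ∀ ω, ‖f ω‖ ≤ b)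
    (hfB : ∀ᵐ ω ∂P, ω ∉ B → ‖f ω‖ ≤ a) : ‖∫ ω, f ω ∂P‖ ≤ a + b * P.real B := by
  have hint : Integrable (B.indicator fun _ => b) P := (integrable_const b).indicator hB
  calc ‖∫ ω, f ω ∂P‖ ≤ ∫ ω, a + B.indicator (fun _ => b) ω ∂P := by
        refine norm_integral_le_of_norm_le ((integrable_const a).add hint) ?_
        filter_upwards [hfB] with ω hω
        by_cases hωB : ω ∈ B
        · simpa [hωB] using (hb ω).trans (le_add_of_nonneg_left ha)
        · simpa [hωB] using hω hωB
    _ = a + b * P.real B := by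
        rw [integral_add (integrable_const a) hint, integral_indicator_const b hB]
        simp [mul_comm]

variable {G : Type u} [Group G] [TopologicalSpace G] [IsTopologicalGroup G]
  [SecondCountableTopology G] [LocallyCompactSpace G] [T2Space G] [MeasurableSpace G]
  [BorelSpace G] {Γ : Subgroup G} {μ : Measure G} {κ : G → Γ}

theorem exists_isCompact_domainMeasure_compl_lt [IsFiniteMeasure (domainMeasure μ κ)] {δ : ℝ}
    (hδ : 0 < δ) : ∃ L : Set G, IsCompact L ∧ (domainMeasure μ κ).real Lᶜ < δ := by
  obtain ⟨L, -, hL, hLδ⟩ := MeasurableSet.univ.exists_isCompact_sdiff_lt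
    (measure_ne_top (domainMeasure μ κ) _) (ENNReal.ofReal_pos.2 hδ).ne'
  rw [← Set.compl_eq_univ_sdiff] at hLδ
  exact ⟨L, hL, ENNReal.toReal_lt_of_lt_ofReal hLδ⟩

variable [Countable Γ] [MeasurableSingletonClass Γ] [μ.IsHaarMeasure]

-- Outside a set of `y` of small measure, both `y` and the representative of `Γ y g` lie in a
-- compact set `L`; then `κ (y g)` lies in the finite set `Γ ∩ L Q L⁻¹`.
theorem tendstoUniformlyOn_induced (hΓ : IsLattice Γ μ) (hκ : Measurable κ)
    (hκm : ∀ (γ : Γ) x, κ (γ * x) = γ * κ x) {ι : Type*} {l : Filter ι} {φ : ι → Γ → ℂ} {M : ℝ≥0}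
    (hM : ∀ α γ, ‖φ α γ‖ ≤ M)
    (h : ∀ Q : Set Γ, IsCompact Q → TendstoUniformlyOn φ (fun _ => 1) l Q) {Q : Set G}
    (hQ : IsCompact Q) :
    TendstoUniformlyOn (fun α => induced μ κ (φ α)) (fun _ => 1) l Q := by
  have := hΓ.discrete
  have := isMulRightInvariant_of_isLattice hΓ hκ hκm
  have := isProbabilityMeasure_domainMeasure hΓ hκ hκm
  rw [Metric.tendstoUniformlyOn_iff]
  intro ε hε
  obtain ⟨δ, hδ0, hδ⟩ : ∃ δ : ℝ, 0 < δ ∧ (1 + M) * (2 * δ) < ε / 2 :=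
    ⟨ε / (8 * (1 + M)), by positivity, by field_simp; norm_num⟩
  obtain ⟨L, hL, hLδ⟩ := exists_isCompact_domainMeasure_compl_lt (μ := μ) (κ := κ) hδ0
  have hLc : MeasurableSet Lᶜ := hL.measurableSet.compl
  have hT : IsCompact ((Subtype.val : Γ → G) ⁻¹' (L * Q * L⁻¹)) :=
    Γ.isClosed_of_discrete.isClosedEmbedding_subtypeVal.isCompact_preimage ((hL.mul hQ).mul hL.inv)
  filter_upwards [Metric.tendstoUniformlyOn_iff.1 (h _ hT) (ε / 2) (half_pos hε)] with α hα g hg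
  let B : Set G := Lᶜ ∪ (fun y => domainRep κ (y * g)) ⁻¹' Lᶜ
  have hB : MeasurableSet B :=
    hLc.union ((measurable_domainRep hκ).comp (measurable_mul_const g) hLc)
  have hBδ : (domainMeasure μ κ).real B ≤ 2 * δ := by
    refine (measureReal_union_le _ _).trans ?_
    rw [measureReal_domainMeasure_preimage_domainRep hκ hκm g hLc]
    linarith
  have hbound : ∀ y, ‖1 - φ α (κ (y * g))‖ ≤ 1 + M := fun y =>
    (norm_sub_le _ _).trans (by simpa using hM _ _)
  have hsmall : ∀ y ∉ B, ‖1 - φ α (κ (y * g))‖ ≤ ε / 2 := fun y hy => by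
    simp only [B, Set.mem_union, not_or, Set.mem_preimage, Set.mem_compl_iff, not_not] at hy
    have hmem : (κ (y * g) : G) ∈ L * Q * L⁻¹ := by
      rw [← mul_inv_domainRep]
      exact Set.mul_mem_mul (Set.mul_mem_mul hy.1 hg) (Set.inv_mem_inv.2 hy.2)
    exact (dist_eq_norm (1 : ℂ) _ ▸ hα _ hmem).le
  have hint : Integrable (fun y => φ α (κ (y * g))) (domainMeasure μ κ) :=
    .of_bound (Measurable.of_discrete.comp
      (hκ.comp (measurable_mul_const g))).aestronglyMeasurable M (.of_forall fun y => hM _ _)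
  calc dist 1 (induced μ κ (φ α) g) = ‖∫ y, (1 - φ α (κ (y * g))) ∂(domainMeasure μ κ)‖ := by
        rw [integral_sub (integrable_const _) hint, dist_eq_norm, induced]
        simp
    _ ≤ ε / 2 + (1 + M) * (domainMeasure μ κ).real B :=
        norm_integral_le_add_mul_measureReal hB (half_pos hε).le hbound (.of_forall hsmall)
    _ ≤ ε / 2 + (1 + M) * (2 * δ) := by gcongr
    _ < ε := by linarith

end InducedConvergence

/-! ### Sampling on the lattice -/

section Sampled

open scoped Pointwise

variable {G : Type u} [Group G] [MeasurableSpace G] {μ : Measure G}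

/-- The function on `Γ` sampled from `φ : G → ℂ`: the average of `φ(u⁻¹ γ u')` over
`u, u' ∈ U`. -/
noncomputable def sampled (μ : Measure G) (U : Set G) (Γ : Subgroup G) (φ : G → ℂ) (γ : Γ) : ℂ :=
  ((μ.real U : ℂ) ^ 2)⁻¹ * ∫ z in U ×ˢ U, φ (z.1⁻¹ * γ * z.2) ∂(μ.prod μ)

variable [MeasurableMul₂ G] [SFinite μ] [μ.IsMulLeftInvariant]

theorem herzSchurSymbol_sampled {Γ : Subgroup G} (φ : G → ℂ) (U : Set G) (γ γ' : Γ) :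
    herzSchurSymbol (sampled μ U Γ φ) (γ, γ') = ((μ.real U : ℂ) ^ 2)⁻¹ *
      ∫ z in ((fun x => (γ : G)⁻¹ * x) ⁻¹' U) ×ˢ ((fun x => (γ' : G)⁻¹ * x) ⁻¹' U),
        herzSchurSymbol φ z ∂(μ.prod μ) := by
  simp only [herzSchurSymbol, sampled]
  rw [← ((measurePreserving_mul_left μ (γ : G)⁻¹).prod
    (measurePreserving_mul_left μ (γ' : G)⁻¹)).setIntegral_preimage_emb
    ((measurableEmbedding_mulLeft (γ : G)⁻¹).prodMap (measurableEmbedding_mulLeft (γ' : G)⁻¹))]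
  congr 1
  refine integral_congr_ae (.of_forall fun z => ?_)
  simp [mul_assoc]

variable [MeasurableInv G]

theorem MemFourierAlgebra.measurable {φ : G → ℂ} (h : MemFourierAlgebra μ φ) : Measurable φ := by
  obtain ⟨f, k, hf, hk, hφ⟩ := h
  have hmk : φ = fun g => ∫ x, hf.1.mk f (g⁻¹ * x) * conj (hk.1.mk k x) ∂μ := by
    funext g
    rw [hφ]
    refine integral_congr_ae ?_
    filter_upwards [(measurePreserving_mul_left μ g⁻¹).quasiMeasurePreserving.ae hf.1.ae_eq_mk,
      hk.1.ae_eq_mk] with x hfx hkx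
    rw [hfx, hkx]
  have hmeas : StronglyMeasurable fun z : G × G =>
      hf.1.mk f (z.1⁻¹ * z.2) * conj (hk.1.mk k z.2) :=
    (hf.1.stronglyMeasurable_mk.comp_measurable (by fun_prop)).mul <|
      RCLike.continuous_conj.comp_stronglyMeasurable
        (hk.1.stronglyMeasurable_mk.comp_measurable measurable_snd)
  rw [hmk]
  exact hmeas.integral_prod_right'.measurable

theorem MemFourierAlgebra.integrableOn_sampled {φ : G → ℂ} (h : MemFourierAlgebra μ φ) {U : Set G}
    (hU : μ U ≠ ∞) (g : G) :
    IntegrableOn (fun z : G × G => φ (z.1⁻¹ * g * z.2)) (U ×ˢ U) (μ.prod μ) := by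
  obtain ⟨M, hM⟩ := h.exists_norm_le
  refine Measure.integrableOn_of_bounded (M := M) ?_
    (h.measurable.comp (by fun_prop)).aestronglyMeasurable (.of_forall fun z => hM _)
  rw [Measure.prod_prod]
  exact ENNReal.mul_ne_top hU hU

theorem exists_isWeakIntegral_leftTranslation {U : Set G} (hU : μ U ≠ ∞) :
    ∃ T, IsWeakIntegral (μ.restrict U) (leftTranslation μ) T := by
  have : IsFiniteMeasure (μ.restrict U) := ⟨by simpa using hU.lt_top⟩
  refine exists_isWeakIntegral (fun x y => ?_) fun g =>
    ContinuousLinearMap.opNorm_le_bound _ zero_le_one fun f => ?_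
  · exact (memFourierAlgebra_iff.2 ⟨y, x, fun _ => rfl⟩).measurable.aestronglyMeasurable
  · rw [norm_leftTranslation, one_mul]

theorem setIntegral_prod_inner_leftTranslation {U : Set G} (hU : μ U ≠ ∞)
    {T : Lp ℂ 2 μ →L[ℂ] Lp ℂ 2 μ} (hT : IsWeakIntegral (μ.restrict U) (leftTranslation μ) T)
    (f k : Lp ℂ 2 μ) (g : G) :
    ∫ z in U ×ˢ U, ⟪k, leftTranslation μ (z.1⁻¹ * g * z.2) f⟫_ℂ ∂(μ.prod μ) =
      ⟪T k, leftTranslation μ g (T f)⟫_ℂ := by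
  have hmem : MemFourierAlgebra μ fun g => ⟪k, leftTranslation μ g f⟫_ℂ :=
    memFourierAlgebra_iff.2 ⟨f, k, fun _ => rfl⟩
  have hinner : ∀ u u', ⟪k, leftTranslation μ (u⁻¹ * g * u') f⟫_ℂ =
      ⟪((leftTranslation μ g)†) (leftTranslation μ u k), leftTranslation μ u' f⟫_ℂ := fun u u' => by
    rw [ContinuousLinearMap.adjoint_inner_left, map_mul, map_mul, mul_apply_eq_comp,
      mul_apply_eq_comp, ← adjoint_leftTranslation, ContinuousLinearMap.adjoint_inner_right]
  rw [setIntegral_prod _ (hmem.integrableOn_sampled hU g)]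
  simp only [hinner, (hT _ f).2]
  simp only [ContinuousLinearMap.adjoint_inner_left]
  rw [← inner_conj_symm, ← (hT _ k).2, ← integral_conj]
  simp only [inner_conj_symm]

-- If `φ(g) = ⟪λ(g) f, k⟫` and `T = ∫_U λ(u) du`, then `∫∫ φ(u⁻¹ γ u')` is `⟪λ(γ) T f, T k⟫`.
theorem memFourierAlgebra_sampled {Γ : Subgroup G} [Countable Γ] [MeasurableSingletonClass Γ]
    {ν : Measure Γ} [ν.IsMulLeftInvariant] {c : ℝ} (hc : 0 < c)
    (hν : ∀ γ, ν {γ} = ENNReal.ofReal c) {κ : G → Γ} (hκ : Measurable κ)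
    (hκm : ∀ (γ : Γ) x, κ (γ * x) = γ * κ x) {φ : G → ℂ} (h : MemFourierAlgebra μ φ) {U : Set G}
    (hU : μ U ≠ ∞) : MemFourierAlgebra ν (sampled μ U Γ φ) := by
  obtain ⟨f, k, hφ⟩ := memFourierAlgebra_iff.1 h
  obtain ⟨T, hT⟩ := exists_isWeakIntegral_leftTranslation (μ := μ) hU
  refine MemFourierAlgebra.restrict hc hν hκ hκm (φ := fun g =>
    ((μ.real U : ℂ) ^ 2)⁻¹ * ∫ z in U ×ˢ U, φ (z.1⁻¹ * g * z.2) ∂(μ.prod μ))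
    (memFourierAlgebra_iff.2 ⟨((μ.real U : ℂ) ^ 2)⁻¹ • T f, T k, fun g => ?_⟩)
  simp only [hφ, setIntegral_prod_inner_leftTranslation hU hT, map_smul, inner_smul_right]

theorem cbSchurNorm_sampled_le {Γ : Subgroup G} [Countable Γ] [MeasurableSingletonClass Γ]
    {ν : Measure Γ} [SFinite ν] [ν.IsMulLeftInvariant] {c : ℝ} (hc : 0 < c)
    (hν : ∀ γ, ν {γ} = ENNReal.ofReal c) {κ : G → Γ} (hκ : Measurable κ)
    (hκm : ∀ (γ : Γ) x, κ (γ * x) = γ * κ x) {U : Set G} (hUm : MeasurableSet U)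
    (hUκ : U ⊆ κ ⁻¹' {1}) (hU : μ U ≠ ∞) (hU0 : μ U ≠ 0) {p : ℝ≥0∞} (hp : 1 ≤ p) {φ : G → ℂ}
    (hφ : MemFourierAlgebra μ φ) {C : ℝ≥0} (h : cbSchurNorm p μ (herzSchurSymbol φ) ≤ C) :
    cbSchurNorm p ν (herzSchurSymbol (sampled μ U Γ φ)) ≤ C := by
  rw [cbSchurNorm_le_iff] at h ⊢
  intro C' hC'
  obtain ⟨M, hM⟩ := (memFourierAlgebra_sampled hc hν hκ hκm hφ hU).exists_norm_le
  have hκU : ∀ (γ : Γ) x, (γ : G)⁻¹ * x ∈ U → κ x = γ := fun γ x hx => by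
    have hγx : κ ((γ⁻¹ : Γ) * x) = 1 := hUκ hx
    rw [hκm, inv_mul_eq_one] at hγx
    exact hγx.symm
  refine (h C' hC').sample hc hν hp (S := fun γ : Γ => (fun x => (γ : G)⁻¹ * x) ⁻¹' U)
    (fun γ => hUm.preimage (measurable_const_mul _)) (fun γ γ' hne => ?_)
    (ENNReal.toReal_pos hU0 hU) (fun γ => ?_) (herzSchurSymbol_sampled φ U)
    (memLp_top_of_bound Measurable.of_discrete.aestronglyMeasurable M (.of_forall fun z => hM _))
  · exact Set.disjoint_left.2 fun x hx hx' => hne ((hκU γ x hx).symm.trans (hκU γ' x hx'))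
  · rw [measure_preimage_mul, ENNReal.ofReal_toReal hU]

theorem norm_one_sub_sampled_le {Γ : Subgroup G} {U : Set G} (hU : μ U ≠ ∞) (hU0 : μ U ≠ 0)
    {φ : G → ℂ} (hφ : MemFourierAlgebra μ φ) (γ : Γ) {ε : ℝ}
    (h : ∀ z ∈ U ×ˢ U, ‖1 - φ (z.1⁻¹ * γ * z.2)‖ ≤ ε) : ‖1 - sampled μ U Γ φ γ‖ ≤ ε := by
  have ha : 0 < μ.real U := ENNReal.toReal_pos hU0 hU
  have hfin : (μ.prod μ) (U ×ˢ U) ≠ ∞ := by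
    rw [Measure.prod_prod]
    exact ENNReal.mul_ne_top hU hU
  have hreal : (μ.prod μ).real (U ×ˢ U) = μ.real U ^ 2 := by rw [measureReal_prod_prod, sq]
  have hone : IntegrableOn (fun _ => (1 : ℂ)) (U ×ˢ U) (μ.prod μ) := integrableOn_const hfin
  have hdiff : 1 - sampled μ U Γ φ γ = ((μ.real U : ℂ) ^ 2)⁻¹ *
      ∫ z in U ×ˢ U, (1 - φ (z.1⁻¹ * γ * z.2)) ∂(μ.prod μ) := by
    rw [integral_sub hone (hφ.integrableOn_sampled hU γ), sampled, mul_sub, setIntegral_const,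
      hreal, Complex.real_smul, mul_one, Complex.ofReal_pow,
      inv_mul_cancel₀ (by exact_mod_cast (pow_pos ha 2).ne')]
  calc ‖1 - sampled μ U Γ φ γ‖
      = (μ.real U ^ 2)⁻¹ * ‖∫ z in U ×ˢ U, (1 - φ (z.1⁻¹ * γ * z.2)) ∂(μ.prod μ)‖ := by
        rw [hdiff, norm_mul, norm_inv, norm_pow, Complex.norm_real, Real.norm_of_nonneg ha.le]
    _ ≤ (μ.real U ^ 2)⁻¹ * (ε * μ.real U ^ 2) := by
        rw [← hreal]
        gcongr
        exact norm_setIntegral_le_of_norm_le_const hfin.lt_top h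
    _ = ε := by field_simp

theorem tendstoUniformlyOn_sampled [TopologicalSpace G] [IsTopologicalGroup G] {Γ : Subgroup G}
    {U : Set G} (hUc : IsCompact U) (hU : μ U ≠ ∞) (hU0 : μ U ≠ 0) {ι : Type*} {l : Filter ι}
    {φ : ι → G → ℂ} (hφ : ∀ α, MemFourierAlgebra μ (φ α))
    (h : ∀ Q : Set G, IsCompact Q → TendstoUniformlyOn φ (fun _ => 1) l Q) {Q : Set Γ}
    (hQ : IsCompact Q) :
    TendstoUniformlyOn (fun α => sampled μ U Γ (φ α)) (fun _ => 1) l Q := by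
  have hT : IsCompact (U⁻¹ * Subtype.val '' Q * U) :=
    (hUc.inv.mul (hQ.image continuous_subtype_val)).mul hUc
  rw [Metric.tendstoUniformlyOn_iff]
  intro ε hε
  filter_upwards [Metric.tendstoUniformlyOn_iff.1 (h _ hT) (ε / 2) (half_pos hε)] with α hα γ hγ
  rw [dist_eq_norm]
  refine (norm_one_sub_sampled_le hU hU0 (hφ α) γ fun z hz => ?_).trans_lt (half_lt_self hε)
  rw [← dist_eq_norm]
  exact (hα _ (Set.mul_mem_mul (Set.mul_mem_mul (Set.inv_mem_inv.2 hz.1) ⟨γ, hγ, rfl⟩) hz.2)).le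

end Sampled

section Lattice

variable {G : Type u} [Group G] [TopologicalSpace G] [MeasurableSpace G] [BorelSpace G]
  {μ : Measure G} {Γ : Subgroup G} {ν : Measure Γ} [ν.IsHaarMeasure]

theorem exists_measure_singleton [ContinuousMul G] [DiscreteTopology Γ] :
    ∃ c : ℝ, 0 < c ∧ ∀ γ : Γ, ν {γ} = ENNReal.ofReal c := by
  have heq : ∀ γ : Γ, ν {γ} = ν {1} := fun γ => by
    rw [← measure_preimage_mul ν γ⁻¹ {1}]
    congr 1
    ext x
    simp [eq_comm]
  have htop : ν {1} ≠ ∞ := isCompact_singleton.measure_ne_top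
  have hpos : ν {1} ≠ 0 :=
    ((isOpen_discrete ({1} : Set Γ)).measure_pos ν (Set.singleton_nonempty 1)).ne'
  exact ⟨(ν {1}).toReal, ENNReal.toReal_pos hpos htop, fun γ => by
    rw [heq, ENNReal.ofReal_toReal htop]⟩

variable [IsTopologicalGroup G] [T2Space G] [LocallyCompactSpace G] [SecondCountableTopology G]
  [μ.IsHaarMeasure] {p : ℝ≥0∞} {C : ℝ≥0}

theorem HasSchurApprox.restrict (hΓ : IsLattice Γ μ) (hp : 1 ≤ p) (h : HasSchurApprox p μ C) :
    HasSchurApprox p ν C := by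
  have := hΓ.discrete
  have : Countable Γ := countable_of_Lindelof_of_discrete
  obtain ⟨c, hc, hν⟩ := exists_measure_singleton (ν := ν)
  obtain ⟨κ, hκ, hκm⟩ := exists_equivariant_map (Γ := Γ)
  obtain ⟨U, hUF, hUc, hU0⟩ := (hκ (measurableSet_singleton 1)).exists_lt_isCompact_of_ne_top
    (measure_preimage_one_ne_top hΓ hκ hκm)
    (measure_preimage_one_ne_zero (μ := μ) hκ hκm).bot_lt
  have hU : μ U ≠ ∞ := hUc.measure_ne_top
  obtain ⟨ι, _, _, _, φ, hA, hconv, hcb⟩ := h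
  exact ⟨ι, ‹_›, ‹_›, ‹_›, fun α => sampled μ U Γ (φ α),
    fun α => memFourierAlgebra_sampled hc hν hκ hκm (hA α) hU,
    fun Q hQ => tendstoUniformlyOn_sampled hUc hU hU0.ne' hA hconv hQ,
    fun α => cbSchurNorm_sampled_le hc hν hκ hκm hUc.measurableSet hUF hU hU0.ne' hp (hA α)
      (hcb α)⟩

theorem HasSchurApprox.induce (hΓ : IsLattice Γ μ) (hp : 1 ≤ p) (h : HasSchurApprox p ν C) :
    HasSchurApprox p μ C := by
  have := hΓ.discrete
  have : Countable Γ := countable_of_Lindelof_of_discrete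
  obtain ⟨c, hc, hν⟩ := exists_measure_singleton (ν := ν)
  obtain ⟨κ, hκ, hκm⟩ := exists_equivariant_map (Γ := Γ)
  obtain ⟨ι, _, _, _, φ, hA, hconv, hcb⟩ := h
  have hbound : ∀ α γ, ‖φ α γ‖ ≤ (C + 1 : ℝ≥0) := fun α γ => by
    simpa [herzSchurSymbol] using
      (cbSchurNorm_le_iff.1 (hcb α) (C + 1) (lt_add_one C)).norm_le hc hν hp (1, γ)
  exact ⟨ι, ‹_›, ‹_›, ‹_›, fun α => induced μ κ (φ α),
    fun α => memFourierAlgebra_induced hc hν hΓ hκ hκm (hA α),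
    fun Q hQ => tendstoUniformlyOn_induced hΓ hκ hκm hbound hconv hQ,
    fun α => cbSchurNorm_induced_le hc hν hΓ hκ hκm hp (hcb α)⟩

theorem hasSchurApprox_iff (hΓ : IsLattice Γ μ) (hp : 1 ≤ p) :
    HasSchurApprox p μ C ↔ HasSchurApprox p ν C :=
  ⟨.restrict hΓ hp, .induce hΓ hp⟩

end Lattice

end SchurAP

theorem theorem2p5 {G : Type u} [Group G] [TopologicalSpace G] [IsTopologicalGroup G]
    [T2Space G] [LocallyCompactSpace G] [SecondCountableTopology G]
    [MeasurableSpace G] [BorelSpace G]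
    (μ : Measure G) [μ.IsHaarMeasure]
    (Γ : Subgroup G) (hΓ : SchurAP.IsLattice Γ μ)
    (ν : Measure Γ) [ν.IsHaarMeasure]
    (p : ℝ≥0∞) (hp : 1 ≤ p) :
    SchurAP.schurConst p μ = SchurAP.schurConst p ν ∧
      (SchurAP.SchurAPpcb p μ ↔ SchurAP.SchurAPpcb p ν) := by
  have h := fun C => SchurAP.hasSchurApprox_iff (ν := ν) hΓ hp (C := C)
  constructor
  · simp only [SchurAP.schurConst, h]
  · simp only [SchurAP.SchurAPpcb, h]
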